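/- Let $k$ be a field, let $\mathcal C$ be a $k$-linear Grothendieck category and let $B$ be a DG-algebra over $k$, with cohomology algebra $H^*(B)$ (a graded $k$-algebra). Let $C(B,\mathcal C)$ be the DG-category of pairs $(M,\rho)$ with $M$ a complex over $\mathcal C$ and $\rho:B\to\underline{\operatorname{Hom}}_{\mathcal C}(M,M)$ a morphism of DG-algebras into the endomorphism complex, and let $D(B,\mathcal C)=Z^0(C(B,\mathcal C))[\mathrm{Qis}^{-1}]$ be obtained by inverting quasi-isomorphisms. Let $D(\mathcal C)_{H^*(B)}$ be the category of objects $M$ of the derived category $D(\mathcal C)$ equipped with a morphism of graded $k$-algebras $H^*(B)\to\operatorname{Ext}^*_{\mathcal C}(M,M)=\bigoplus_n\operatorname{Hom}_{D(\mathcal C)}(M,M[n])$; its morphisms are the morphisms of $D(\mathcal C)$ commuting with the actions. Let $F:D(B,\mathcal C)\to D(\mathcal C)_{H^*(B)}$ be the functor which sends $(M,\rho)$ to $M$ with the action of $H^*(B)$ induced by $\rho$ on cohomology. For a graded $k$-algebra $A$ and a graded $A$-bimodule $N$, let $\mathsf{HH}^n(A,N)_j$ be the $n$-th cohomology of the complex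 $C^i(A,N)_j=\operatorname{Hom}_k(A^{\otimes i},N)_j$ of $k$-multilinear maps of degree $j$, with differential, on homogeneous elements, $$(d f)(r_0,\dots,r_i)=(-1)^{j|r_0|}r_0f(r_1,\dots,r_i)+\sum_{p=0}^{i-1}(-1)^{p+1}f(r_0,\dots,r_pr_{p+1},\dots,r_i)+(-1)^{i+1}f(r_0,\dots,r_{i-1})r_i.$$ Let $M\in D(\mathcal C)_{H^*(B)}$, and regard $\operatorname{Ext}^*_{\mathcal C}(M,M)$ as a graded $H^*(B)$-bimodule through the action on $M$. Suppose that $$\mathsf{HH}^n\bigl(H^*(B),\operatorname{Ext}^*_{\mathcal C}(M,M)\bigr)_{-n+2}=0\qquad\text{for all } n\ge 3.$$ Then there exists an object $\tilde M$ of $D(B,\mathcal C)$ together with an isomorphism $F(\tilde M)\cong M$ in $D(\mathcal C)_{H^*(B)}$. -/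

import Mathlib

universe w v u t s

open CategoryTheory DirectSum

namespace DGLift

noncomputable section

section Hochschild

variable {k : Type*} {A : Type*} [CommRing k] [Ring A] [Algebra k A]
  (𝒜 : ℤ → Submodule k A) [GradedAlgebra 𝒜]
  (N : Type*) [AddCommGroup N] [Module k N] [Module A N] [Module Aᵐᵒᵖ N]
  [IsScalarTower k A N] [IsScalarTower k Aᵐᵒᵖ N]

/-- The linear map which multiplies a homogeneous element `a` of degree `i` by `(-1) ^ (j * i)`. -/
def koszulSign (j : ℤ) : A →ₗ[k] A :=
  DirectSum.toModule k ℤ A (fun i => ((j * i).negOnePow : ℤ) • (𝒜 i).subtype) ∘ₗ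
    (DirectSum.decomposeLinearEquiv 𝒜).toLinearMap

lemma koszulSign_of_mem (j : ℤ) {i : ℤ} {a : A} (ha : a ∈ 𝒜 i) :
    koszulSign 𝒜 j a = ((j * i).negOnePow : ℤ) • a := by
  have h : DirectSum.decomposeLinearEquiv 𝒜 a = DirectSum.lof k ℤ (fun i => 𝒜 i) i ⟨a, ha⟩ :=
    DirectSum.decompose_of_mem 𝒜 ha
  rw [koszulSign, LinearMap.comp_apply, LinearEquiv.coe_coe, h, DirectSum.toModule_lof]
  rfl

lemma contractNth_update {n : ℕ} (p : Fin n) (m : Fin (n + 1) → A) (i : Fin (n + 1)) :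
    ∃ (s : Fin n) (L : A →ₗ[k] A), ∀ x : A,
      Fin.contractNth p.castSucc (· * ·) (Function.update m i x) =
        Function.update (Fin.contractNth p.castSucc (· * ·) m) s (L x) := by
  rcases lt_trichotomy i.val p.val with h | h | h
  · refine ⟨⟨i.val, h.trans p.isLt⟩, LinearMap.id, fun x => ?_⟩
    funext t
    simp only [Fin.contractNth, Function.update_apply, Fin.ext_iff, Fin.val_castSucc, Fin.val_succ,
      LinearMap.id_apply]
    grind
  · refine ⟨p, LinearMap.mulRight k (m p.succ), fun x => ?_⟩
    funext t
    simp only [Fin.contractNth, Function.update_apply, Fin.ext_iff, Fin.val_castSucc, Fin.val_succ,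
      LinearMap.mulRight_apply]
    grind
  · by_cases h' : i.val = p.val + 1
    · refine ⟨p, LinearMap.mulLeft k (m p.castSucc), fun x => ?_⟩
      funext t
      simp only [Fin.contractNth, Function.update_apply, Fin.ext_iff, Fin.val_castSucc,
        Fin.val_succ, LinearMap.mulLeft_apply]
      grind
    · refine ⟨⟨i.val - 1, by omega⟩, LinearMap.id, fun x => ?_⟩
      funext t
      simp only [Fin.contractNth, Function.update_apply, Fin.ext_iff, Fin.val_castSucc,
        Fin.val_succ, LinearMap.id_apply]
      grind

/-- The multilinear map `(r₀, …, rₙ) ↦ f (r₀, …, rₚ * rₚ₊₁, …, rₙ)`. -/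
def contract {n : ℕ} (p : Fin n) (f : MultilinearMap k (fun _ : Fin n => A) N) :
    MultilinearMap k (fun _ : Fin (n + 1) => A) N :=
  MultilinearMap.mk' (fun r => f (Fin.contractNth p.castSucc (· * ·) r))
    (fun m i x y => by
      obtain ⟨s, L, h⟩ := contractNth_update (k := k) p m i
      simp only [h, map_add, MultilinearMap.map_update_add])
    (fun m i c x => by
      obtain ⟨s, L, h⟩ := contractNth_update (k := k) p m i
      simp only [h, map_smul, MultilinearMap.map_update_smul])

/-- The multilinear map `(r₀, …, rₙ) ↦ (-1) ^ (j * |r₀|) • r₀ • f (r₁, …, rₙ)`. -/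
def leftTerm {n : ℕ} (j : ℤ) (f : MultilinearMap k (fun _ : Fin n => A) N) :
    MultilinearMap k (fun _ : Fin (n + 1) => A) N :=
  LinearMap.uncurryLeft
    { toFun := fun a => (Algebra.lsmul k k N (koszulSign 𝒜 j a)).compMultilinearMap f
      map_add' := fun a b => by ext; simp
      map_smul' := fun c a => by ext; simp }

/-- The multilinear map `(r₀, …, rₙ) ↦ f (r₀, …, rₙ₋₁) • rₙ`. -/
def rightTerm {n : ℕ} (f : MultilinearMap k (fun _ : Fin n => A) N) :
    MultilinearMap k (fun _ : Fin (n + 1) => A) N :=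
  MultilinearMap.uncurryRight
    (LinearMap.compMultilinearMap (LinearMap.mk₂ k (fun (x : N) (a : A) => MulOpposite.op a • x)
      (by simp) (fun c x a => smul_comm _ _ _) (by simp [add_smul]) (by simp)) f)

/-- The Hochschild differential on cochains of internal degree `j`. It sends `f` to
`(r₀, …, rₙ) ↦ (-1) ^ (j * |r₀|) • r₀ • f (r₁, …, rₙ)
  + ∑ p < n, (-1) ^ (p + 1) • f (r₀, …, rₚ * rₚ₊₁, …, rₙ) + (-1) ^ (n + 1) • f (r₀, …, rₙ₋₁) • rₙ`,
where the first sign is the Koszul sign for exchanging `f` and `r₀`. -/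
def hochschildD (j : ℤ) (n : ℕ) :
    MultilinearMap k (fun _ : Fin n => A) N →ₗ[k]
      MultilinearMap k (fun _ : Fin (n + 1) => A) N where
  toFun f := leftTerm 𝒜 N j f + ∑ p : Fin n, (-1 : ℤ) ^ (p.val + 1) • contract N p f +
    (-1 : ℤ) ^ (n + 1) • rightTerm N f
  map_add' f g := by
    ext r
    simp [leftTerm, contract, rightTerm, Finset.sum_add_distrib]
    abel
  map_smul' c f := by
    ext r
    simp [leftTerm, contract, rightTerm, Finset.smul_sum, smul_comm c]

variable {N} in
lemma hochschildD_apply (j : ℤ) (n : ℕ) (f : MultilinearMap k (fun _ : Fin n => A) N)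
    (r : Fin (n + 1) → A) :
    hochschildD 𝒜 N j n f r = koszulSign 𝒜 j (r 0) • f (Fin.tail r) +
      ∑ p : Fin n, (-1 : ℤ) ^ (p.val + 1) • f (Fin.contractNth p.castSucc (· * ·) r) +
      (-1 : ℤ) ^ (n + 1) • MulOpposite.op (r (Fin.last n)) • f (Fin.init r) := by
  simp [hochschildD, leftTerm, contract, rightTerm]

variable (𝒩 : ℤ → Submodule k N)

variable {N} in
/-- The Hochschild cochains with `n` arguments of internal degree `j`, for a graded bimodule
`N = ⨁ i, 𝒩 i`: the multilinear maps which raise the total degree by `j`. -/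
def cochains (n : ℕ) (j : ℤ) : Submodule k (MultilinearMap k (fun _ : Fin n => A) N) where
  carrier := {f | ∀ (e : Fin n → ℤ) (r : Fin n → A), (∀ t, r t ∈ 𝒜 (e t)) →
    f r ∈ 𝒩 ((∑ t, e t) + j)}
  add_mem' := fun hf hg e r hr => add_mem (hf e r hr) (hg e r hr)
  zero_mem' := fun _ _ _ => zero_mem _
  smul_mem' := fun c _ hf e r hr => Submodule.smul_mem _ c (hf e r hr)

variable {N} in
/-- The Hochschild cocycles with `n` arguments of internal degree `j`. -/
def cocycles (n : ℕ) (j : ℤ) : Submodule k (MultilinearMap k (fun _ : Fin n => A) N) :=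
  cochains 𝒜 𝒩 n j ⊓ LinearMap.ker (hochschildD 𝒜 N j n)

variable {N} in
/-- The Hochschild coboundaries with `n` arguments of internal degree `j`. -/
def coboundaries :
    (n : ℕ) → (j : ℤ) → Submodule k (MultilinearMap k (fun _ : Fin n => A) N)
  | 0, _ => ⊥
  | n + 1, j => (cochains 𝒜 𝒩 n j).map (hochschildD 𝒜 N j n)

variable {N} in
/-- The graded Hochschild cohomology `HH^n(A, N)_j`. -/
abbrev HH (n : ℕ) (j : ℤ) : Type _ :=
  cocycles 𝒜 𝒩 n j ⧸ (coboundaries 𝒜 𝒩 n j).submoduleOf (cocycles 𝒜 𝒩 n j)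

end Hochschild

/-- A DG-algebra over `k` (cohomological grading, not necessarily commutative). -/
structure DGAlgebra (k : Type t) [CommRing k] where
  carrier : Type w
  [ring : Ring carrier]
  [algebra : Algebra k carrier]
  /-- the homogeneous components -/
  gr : ℤ → Submodule k carrier
  [graded : GradedAlgebra gr]
  /-- the differential -/
  d : carrier →ₗ[k] carrier
  d_mem : ∀ {n : ℤ} {b : carrier}, b ∈ gr n → d b ∈ gr (n + 1)
  d_d : ∀ b : carrier, d (d b) = 0
  leibniz : ∀ {n : ℤ} {a : carrier}, a ∈ gr n → ∀ b : carrier,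
    d (a * b) = d a * b + (n.negOnePow : ℤ) • (a * d b)

namespace DGAlgebra

attribute [instance] DGAlgebra.ring DGAlgebra.algebra DGAlgebra.graded

variable {k : Type t} [CommRing k] (B : DGAlgebra.{w} k)

lemma d_one : B.d 1 = 0 := by
  have h := B.leibniz (SetLike.GradedOne.one_mem : (1 : B.carrier) ∈ B.gr 0) 1
  simpa using h

lemma decompose_d (b : B.carrier) (i : ℤ) :
    (decompose B.gr (B.d b) (i + 1) : B.carrier) = B.d (decompose B.gr b i) := by
  induction b using DirectSum.Decomposition.inductionOn B.gr with
  | zero => simp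
  | @homogeneous j m =>
    by_cases h : j = i
    · subst h
      rw [decompose_of_mem_same _ (B.d_mem m.2), decompose_of_mem_same _ m.2]
    · rw [decompose_of_mem_ne _ (B.d_mem m.2) (by omega), decompose_of_mem_ne _ m.2 h, map_zero]
  | add m m' h h' => simp [h, h']

lemma d_mul_of_right (a b : B.carrier) (hb : B.d b = 0) : B.d (a * b) = B.d a * b := by
  induction a using DirectSum.Decomposition.inductionOn B.gr with
  | zero => simp
  | @homogeneous j m => rw [B.leibniz m.2, hb]; simp
  | add m m' h h' => rw [add_mul, map_add, map_add, h, h', add_mul]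

/-- The subalgebra of cocycles of `B`. -/
def cocycles : Subalgebra k B.carrier where
  carrier := {b | B.d b = 0}
  mul_mem' := fun {a b} (ha : B.d a = 0) (hb : B.d b = 0) => by
    change B.d (a * b) = 0
    rw [B.d_mul_of_right a b hb, ha, zero_mul]
  add_mem' := fun {a b} (ha : B.d a = 0) (hb : B.d b = 0) => by
    change B.d (a + b) = 0
    rw [map_add, ha, hb, add_zero]
  algebraMap_mem' := fun r => by
    change B.d _ = 0
    rw [Algebra.algebraMap_eq_smul_one, map_smul, B.d_one, smul_zero]

lemma mem_cocycles {b : B.carrier} : b ∈ B.cocycles ↔ B.d b = 0 := Iff.rfl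

lemma exists_mul_d (a b : B.carrier) (ha : B.d a = 0) : ∃ c, B.d c = a * B.d b := by
  classical
  have key : ∀ i, ∃ c, B.d c = (decompose B.gr a i : B.carrier) * B.d b := fun i => by
    refine ⟨(i.negOnePow : ℤ) • ((decompose B.gr a i : B.carrier) * b), ?_⟩
    have h0 : B.d (decompose B.gr a i) = 0 := by rw [← B.decompose_d, ha]; simp
    rw [map_zsmul, B.leibniz (decompose B.gr a i).2, h0, zero_mul, zero_add, smul_smul]
    simp [← Units.val_mul]
  choose c hc using key
  refine ⟨∑ i ∈ (decompose B.gr a).support, c i, ?_⟩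
  rw [map_sum]
  simp only [hc]
  rw [← Finset.sum_mul, DirectSum.sum_support_decompose]

/-- The two-sided ideal of coboundaries in the algebra of cocycles. -/
def coboundaries : Ideal B.cocycles where
  carrier := {z | ∃ b, B.d b = z}
  add_mem' := by
    rintro _ _ ⟨b, hb⟩ ⟨b', hb'⟩
    exact ⟨b + b', by simp [hb, hb']⟩
  zero_mem' := ⟨0, by simp⟩
  smul_mem' := by
    rintro a _ ⟨b, hb⟩
    obtain ⟨c, hc⟩ := B.exists_mul_d a b a.2
    exact ⟨c, by simp [hc, hb]⟩

lemma mem_coboundaries {z : B.cocycles} : z ∈ B.coboundaries ↔ ∃ b, B.d b = z := Iff.rfl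

instance : B.coboundaries.IsTwoSided where
  mul_mem_of_left := by
    rintro a z ⟨b, hb⟩
    exact ⟨b * z, by rw [B.d_mul_of_right _ _ z.2, hb]; rfl⟩

/-- The cohomology algebra `H^*(B)`. -/
abbrev Cohomology : Type w := B.cocycles ⧸ B.coboundaries

/-- The cocycles of degree `n`. -/
def cocyclesGr (n : ℤ) : Submodule k B.cocycles := (B.gr n).comap B.cocycles.val.toLinearMap

lemma mem_cocyclesGr {n : ℤ} {z : B.cocycles} : z ∈ B.cocyclesGr n ↔ (z : B.carrier) ∈ B.gr n :=
  Iff.rfl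

/-- The inclusion of the cocycles of degree `n` in the degree `n` part of `B`. -/
def toGr (n : ℤ) : B.cocyclesGr n →ₗ[k] B.gr n :=
  B.cocycles.val.toLinearMap.restrict (fun _ hz => hz)

/-- The projection from cocycles to cohomology. -/
def proj : B.cocycles →ₐ[k] B.Cohomology := Ideal.Quotient.mkₐ k B.coboundaries

lemma proj_eq_zero_iff (z : B.cocycles) : B.proj z = 0 ↔ ∃ b, B.d b = z :=
  Ideal.Quotient.eq_zero_iff_mem

/-- The degree `n` part `H^n(B)` of the cohomology algebra: classes of cocycles of degree `n`. -/
def cohomologyGr (n : ℤ) : Submodule k B.Cohomology :=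
  (B.cocyclesGr n).map B.proj.toLinearMap

lemma proj_mem {n : ℤ} {z : B.cocycles} (hz : z ∈ B.cocyclesGr n) : B.proj z ∈ B.cohomologyGr n :=
  ⟨z, hz, rfl⟩

/-- The projection from cocycles of degree `n` to `H^n(B)`. -/
def projGr (n : ℤ) :
    B.cocyclesGr n →ₗ[k] B.cohomologyGr n :=
  B.proj.toLinearMap.restrict (fun _ hz => B.proj_mem hz)

lemma projGr_surjective (n : ℤ) :
    Function.Surjective (B.projGr n) := by
  rintro ⟨_, z, hz, rfl⟩
  exact ⟨⟨z, hz⟩, rfl⟩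

instance : SetLike.GradedMonoid B.cohomologyGr where
  one_mem := ⟨1, SetLike.GradedOne.one_mem (A := B.gr), map_one B.proj⟩
  mul_mem := by
    rintro i j _ _ ⟨a, ha, rfl⟩ ⟨b, hb, rfl⟩
    exact ⟨a * b, SetLike.GradedMul.mul_mem (A := B.gr) ha hb, map_mul B.proj a b⟩

/-- The degree `i` component of a cocycle. -/
def component (z : B.cocycles) (i : ℤ) : B.cocycles :=
  ⟨decompose B.gr (z : B.carrier) i, by
    rw [mem_cocycles, ← B.decompose_d, B.mem_cocycles.1 z.2]; simp⟩

lemma component_mem (z : B.cocycles) (i : ℤ) : B.component z i ∈ B.cocyclesGr i :=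
  (decompose B.gr (z : B.carrier) i).2

lemma proj_eq_zero_iff_of_mem {i : ℤ} {z : B.cocycles} (hz : z ∈ B.cocyclesGr (i + 1)) :
    B.proj z = 0 ↔ ∃ b ∈ B.gr i, B.d b = z := by
  rw [proj_eq_zero_iff]
  constructor
  · rintro ⟨b, hb⟩
    refine ⟨decompose B.gr b i, (decompose B.gr b i).2, ?_⟩
    rw [← B.decompose_d, hb, decompose_of_mem_same B.gr (B.mem_cocyclesGr.1 hz)]
  · rintro ⟨b, _, hb⟩
    exact ⟨b, hb⟩

lemma isInternal_cohomologyGr : DirectSum.IsInternal B.cohomologyGr := by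
  classical
  constructor
  · rw [injective_iff_map_eq_zero]
    intro x hx
    choose z hz hz' using fun i => (x i).2
    have hsum : B.proj (∑ i ∈ x.support, z i) = 0 := by
      rw [map_sum, ← hx]
      rw [DirectSum.coeAddMonoidHom_eq_dfinsuppSum, DFinsupp.sum]
      exact Finset.sum_congr rfl fun i _ => hz' i
    obtain ⟨b, hb⟩ := (B.proj_eq_zero_iff _).1 hsum
    ext i
    by_cases hi : i ∈ x.support
    · rw [← hz' i]
      change B.proj (z i) = 0
      rw [proj_eq_zero_iff]
      refine ⟨decompose B.gr b (i - 1), ?_⟩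
      rw [← B.decompose_d, hb]
      rw [show i - 1 + 1 = i by omega]
      rw [AddSubmonoidClass.coe_finsetSum, decompose_sum, DFinsupp.finsetSum_apply, AddSubmonoidClass.coe_finsetSum]
      rw [Finset.sum_eq_single i]
      · exact decompose_of_mem_same _ (hz i)
      · intro j _ hj
        exact decompose_of_mem_ne _ (hz j) hj
      · exact fun h => absurd hi h
    · rw [DFinsupp.notMem_support_iff.1 hi, DirectSum.zero_apply]
  · intro y
    obtain ⟨z, rfl⟩ := Ideal.Quotient.mkₐ_surjective k B.coboundaries y
    refine ⟨∑ i ∈ (decompose B.gr (z : B.carrier)).support,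
      DirectSum.of (fun i => B.cohomologyGr i) i
        ⟨B.proj (B.component z i), B.proj_mem (B.component_mem z i)⟩, ?_⟩
    rw [map_sum]
    simp only [DirectSum.coeAddMonoidHom_of]
    rw [← map_sum]
    congr 1
    ext
    rw [AddSubmonoidClass.coe_finsetSum]
    exact DirectSum.sum_support_decompose B.gr (z : B.carrier)

instance : GradedAlgebra B.cohomologyGr where
  __ := (inferInstance : SetLike.GradedMonoid B.cohomologyGr)
  __ := B.isInternal_cohomologyGr.chooseDecomposition

end DGAlgebra

section GradedActions

variable {k : Type*} [CommRing k] {A : Type*} [Ring A] [Algebra k A]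
  (𝒜 : ℤ → Submodule k A) [GradedAlgebra 𝒜]
  (T : Type*) [Category T] [Preadditive T] [Linear k T] [HasShift T ℤ]

/-- An object of the category `T_A`: an object `X` of `T` with a morphism of graded `k`-algebras
`A ⟶ ⨁ n, Hom(X, X⟦n⟧)`, given by its homogeneous components. -/
structure GradedObj where
  obj : T
  act (n : ℤ) : 𝒜 n →ₗ[k] ShiftedHom obj obj n
  act_one : act 0 ⟨1, SetLike.GradedOne.one_mem⟩ = ShiftedHom.mk₀ (0 : ℤ) rfl (𝟙 obj)
  act_mul : ∀ {i j n : ℤ} (h : i + j = n) (a : 𝒜 i) (b : 𝒜 j),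
    act n ⟨a * b, h ▸ SetLike.GradedMul.mul_mem a.2 b.2⟩ = (act j b).comp (act i a) h

namespace GradedObj

variable {𝒜 T}

/-- A morphism in `T_A`: a morphism of `T` (of degree zero) which commutes with the actions. -/
@[ext]
structure Hom (X Y : GradedObj 𝒜 T) where
  hom : X.obj ⟶ Y.obj
  comm : ∀ (n : ℤ) (a : 𝒜 n), X.act n a ≫ hom⟦n⟧' = hom ≫ Y.act n a

instance : Category (GradedObj 𝒜 T) where
  Hom X Y := Hom X Y
  id X := { hom := 𝟙 _, comm := by simp }
  comp f g :=
    { hom := f.hom ≫ g.hom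
      comm := fun n a => by
        rw [Functor.map_comp, ← Category.assoc, f.comm, Category.assoc, g.comm, Category.assoc] }

@[ext]
lemma hom_ext {X Y : GradedObj 𝒜 T} {f g : X ⟶ Y} (h : f.hom = g.hom) : f = g := Hom.ext h

@[simp] lemma id_hom (X : GradedObj 𝒜 T) : Hom.hom (𝟙 X) = 𝟙 X.obj := rfl

@[simp] lemma comp_hom {X Y Z : GradedObj 𝒜 T} (f : X ⟶ Y) (g : Y ⟶ Z) :
    (f ≫ g).hom = f.hom ≫ g.hom := rfl

/-- A morphism of `T_A` whose underlying morphism is invertible is an isomorphism. -/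
lemma isIso_of_isIso_hom {X Y : GradedObj 𝒜 T} (f : X ⟶ Y) [IsIso f.hom] : IsIso f := by
  refine ⟨⟨{ hom := inv f.hom, comm := fun n a => ?_ }, ?_, ?_⟩⟩
  · rw [Functor.map_inv, IsIso.comp_inv_eq, Category.assoc, f.comm, IsIso.inv_hom_id_assoc]
  · ext; simp
  · ext; simp

end GradedObj

variable {T} in
/-- The graded endomorphism algebra `⨁ n, Hom(X, X⟦n⟧)`. -/
abbrev GradedEnd (X : T) : Type _ := ⨁ n : ℤ, ShiftedHom X X n

variable {T} in
/-- The product `f * g` in the graded endomorphism algebra is first `g`, then `f`. -/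
instance (X : T) : GradedMonoid.GMul (fun n : ℤ => ShiftedHom X X n) where
  mul {_ _} f g := ShiftedHom.comp g f rfl

variable {T} in
instance (X : T) : GradedMonoid.GOne (fun n : ℤ => ShiftedHom X X n) where
  one := ShiftedHom.mk₀ (0 : ℤ) rfl (𝟙 X)

variable {T} in
lemma gradedEnd_mul {X : T} {i j n : ℤ} (h : i + j = n) (f : ShiftedHom X X i)
    (g : ShiftedHom X X j) :
    GradedMonoid.mk (A := fun n : ℤ => ShiftedHom X X n) i f * GradedMonoid.mk j g =
      GradedMonoid.mk n (g.comp f h) := by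
  subst h
  rfl

variable {T} in
instance (X : T) : GradedMonoid.GMonoid (fun n : ℤ => ShiftedHom X X n) where
  one_mul := by
    rintro ⟨a, f⟩
    refine (gradedEnd_mul (zero_add a) (ShiftedHom.mk₀ (0 : ℤ) rfl (𝟙 X)) f).trans ?_
    rw [ShiftedHom.comp_mk₀_id]
    rfl
  mul_one := by
    rintro ⟨a, f⟩
    refine (gradedEnd_mul (add_zero a) f (ShiftedHom.mk₀ (0 : ℤ) rfl (𝟙 X))).trans ?_
    rw [ShiftedHom.mk₀_id_comp]
    rfl
  mul_assoc := by
    rintro ⟨a, f⟩ ⟨b, g⟩ ⟨c, h⟩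
    refine Eq.trans ?_ (gradedEnd_mul (add_assoc a b c).symm f (h.comp g rfl)).symm
    refine congrArg (GradedMonoid.mk _) ?_
    exact (ShiftedHom.comp_assoc h g f rfl rfl rfl).symm

variable [∀ n : ℤ, (shiftFunctor T n).Additive]

variable {T} in
instance (X : T) : DirectSum.GRing (fun n : ℤ => ShiftedHom X X n) where
  mul_zero f := ShiftedHom.zero_comp _ _ _ _
  zero_mul f := ShiftedHom.comp_zero _ _ _
  mul_add f g h := ShiftedHom.add_comp _ _ _ _
  add_mul f g h := ShiftedHom.comp_add _ _ _ _
  natCast n := n • GradedMonoid.GOne.one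
  natCast_zero := zero_smul _ _
  natCast_succ n := by rw [add_smul, one_smul]
  intCast n := n • GradedMonoid.GOne.one
  intCast_ofNat n := natCast_zsmul _ _
  intCast_negSucc_ofNat n := negSucc_zsmul _ _

variable [∀ n : ℤ, (shiftFunctor T n).Linear k]

variable {T} in
instance (X : T) : DirectSum.GAlgebra k (fun n : ℤ => ShiftedHom X X n) where
  toFun :=
    { toFun := fun c => c • GradedMonoid.GOne.one
      map_zero' := zero_smul _ _
      map_add' := fun c c' => add_smul _ _ _ }
  map_one := one_smul _ _
  map_mul c c' := by
    refine Eq.trans ?_ (gradedEnd_mul (add_zero 0) _ _).symm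
    refine congrArg (GradedMonoid.mk 0) ?_
    change (c * c') • (ShiftedHom.mk₀ (0 : ℤ) rfl (𝟙 X)) =
      (c' • ShiftedHom.mk₀ (0 : ℤ) rfl (𝟙 X)).comp (c • ShiftedHom.mk₀ (0 : ℤ) rfl (𝟙 X)) _
    rw [ShiftedHom.smul_comp, ShiftedHom.comp_smul, smul_smul, mul_comm, ShiftedHom.comp_mk₀_id]
  commutes := by
    rintro c ⟨a, f⟩
    refine (gradedEnd_mul (zero_add a) _ _).trans
      (Eq.trans ?_ (gradedEnd_mul (add_zero a) _ _).symm)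
    refine congrArg (GradedMonoid.mk a) ?_
    change f.comp (c • ShiftedHom.mk₀ (0 : ℤ) rfl (𝟙 X)) _ = (c • ShiftedHom.mk₀ (0 : ℤ) rfl (𝟙 X)).comp f _
    rw [ShiftedHom.smul_comp, ShiftedHom.comp_smul, ShiftedHom.comp_mk₀_id,
      ShiftedHom.mk₀_id_comp]
  smul_def := by
    rintro c ⟨a, f⟩
    refine Eq.trans ?_ (gradedEnd_mul (zero_add a) _ _).symm
    refine congrArg (GradedMonoid.mk a) ?_
    change c • f = f.comp (c • ShiftedHom.mk₀ (0 : ℤ) rfl (𝟙 X)) _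
    rw [ShiftedHom.comp_smul, ShiftedHom.comp_mk₀_id]

namespace GradedObj

variable {𝒜 T}

/-- The underlying `k`-module of `Ext^*(X, X)`, i.e. the graded endomorphism algebra of `X`. -/
def ExtStar (X : GradedObj 𝒜 T) : Type _ := GradedEnd X.obj

variable (X : GradedObj 𝒜 T)

instance : Ring X.ExtStar := inferInstanceAs (Ring (GradedEnd X.obj))

instance : Algebra k X.ExtStar := inferInstanceAs (Algebra k (GradedEnd X.obj))

/-- The action of `A` on `X` as a morphism of `k`-algebras `A ⟶ Ext^*(X, X)`. -/
def toAlgHom : A →ₐ[k] X.ExtStar :=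
  (DirectSum.toAlgebra k (fun i => 𝒜 i)
    (fun i => DirectSum.lof k ℤ (fun n : ℤ => ShiftedHom X.obj X.obj n) i ∘ₗ X.act i)
    (congrArg (DirectSum.of (fun n : ℤ => ShiftedHom X.obj X.obj n) 0) X.act_one)
    (fun {i j} a b => by
      refine Eq.trans ?_ (DirectSum.of_mul_of (A := fun n : ℤ => ShiftedHom X.obj X.obj n)
        (X.act i a) (X.act j b)).symm
      exact congrArg (DirectSum.of (fun n : ℤ => ShiftedHom X.obj X.obj n) (i + j))
        (X.act_mul rfl a b))).comp
    (DirectSum.decomposeAlgEquiv 𝒜).toAlgHom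

/-- The left action of `A` on `Ext^*(X, X)`, by postcomposition. -/
instance : Module A X.ExtStar := Module.compHom X.ExtStar X.toAlgHom.toRingHom

/-- The right action of `A` on `Ext^*(X, X)`, by precomposition. -/
instance : Module Aᵐᵒᵖ X.ExtStar :=
  Module.compHom X.ExtStar (X.toAlgHom.toRingHom.op : Aᵐᵒᵖ →+* X.ExtStarᵐᵒᵖ)

lemma smul_eq (a : A) (f : X.ExtStar) : a • f = X.toAlgHom a * f := rfl

lemma op_smul_eq (a : A) (f : X.ExtStar) : MulOpposite.op a • f = f * X.toAlgHom a := rfl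

instance : IsScalarTower k A X.ExtStar := ⟨fun c a f => by
  rw [smul_eq, smul_eq, map_smul, smul_mul_assoc]⟩

instance : IsScalarTower k Aᵐᵒᵖ X.ExtStar := ⟨fun c a f => by
  induction a with
  | _ a => rw [← MulOpposite.op_smul, op_smul_eq, op_smul_eq, map_smul, mul_smul_comm]⟩

instance : SMulCommClass A Aᵐᵒᵖ X.ExtStar := ⟨fun a b f => by
  induction b with
  | _ b => rw [smul_eq, op_smul_eq, smul_eq, op_smul_eq, mul_assoc]⟩

/-- `Ext^n(X, X)` as the degree `n` part of `Ext^*(X, X)`. -/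
def extGr (n : ℤ) : Submodule k X.ExtStar :=
  LinearMap.range (DirectSum.lof k ℤ (fun n => ShiftedHom X.obj X.obj n) n)

end GradedObj

end GradedActions

section DGModules

open CochainComplex CochainComplex.HomComplex

variable {k : Type t} [CommRing k] (B : DGAlgebra.{w} k)
  (C : Type u) [Category.{v} C] [Abelian C] [Linear k C]

/-- An object of `C(B, C)`: a complex `M` over `C` together with a morphism of DG-algebras from
`B` to the DG-algebra of endomorphisms of `M`, given by its homogeneous components. -/
structure DGModule where
  complex : CochainComplex C ℤ
  act (n : ℤ) : B.gr n →ₗ[k] Cochain complex complex n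
  act_one : act 0 ⟨1, SetLike.GradedOne.one_mem⟩ = Cochain.ofHom (𝟙 complex)
  act_mul : ∀ {i j n : ℤ} (h : i + j = n) (a : B.gr i) (b : B.gr j),
    act n ⟨a * b, h ▸ SetLike.GradedMul.mul_mem a.2 b.2⟩ =
      (act j b).comp (act i a) ((add_comm j i).trans h)
  act_d : ∀ {n m : ℤ} (h : n + 1 = m) (b : B.gr n),
    act m ⟨B.d b, h ▸ B.d_mem b.2⟩ = δ n m (act n b)

namespace DGModule

variable {B C}

/-- A morphism in `Z⁰(C(B, C))`: a morphism of complexes which commutes with the actions. -/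
@[ext]
structure Hom (M N : DGModule B C) where
  hom : M.complex ⟶ N.complex
  comm : ∀ (n : ℤ) (b : B.gr n),
    (M.act n b).comp (Cochain.ofHom hom) (add_zero n) =
      (Cochain.ofHom hom).comp (N.act n b) (zero_add n)

/-- The category `Z⁰(C(B, C))`. -/
instance : Category (DGModule B C) where
  Hom M N := Hom M N
  id M := { hom := 𝟙 _, comm := by simp }
  comp f g :=
    { hom := f.hom ≫ g.hom
      comm := fun n b => by
        rw [Cochain.ofHom_comp, ← Cochain.comp_assoc_of_second_is_zero_cochain, f.comm,
          Cochain.comp_assoc_of_third_is_zero_cochain, g.comm,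
          Cochain.comp_assoc_of_first_is_zero_cochain] }

@[ext]
lemma hom_ext {M N : DGModule B C} {f g : M ⟶ N} (h : f.hom = g.hom) : f = g := Hom.ext h

@[simp] lemma id_hom (M : DGModule B C) : Hom.hom (𝟙 M) = 𝟙 M.complex := rfl

@[simp] lemma comp_hom {M N P : DGModule B C} (f : M ⟶ N) (g : N ⟶ P) :
    (f ≫ g).hom = f.hom ≫ g.hom := rfl

variable (B C) in
/-- The class of quasi-isomorphisms in `Z⁰(C(B, C))`. -/
def qis : MorphismProperty (DGModule B C) := fun _ _ f => QuasiIso f.hom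

variable (M : DGModule B C)

/-- The action of a cocycle of degree `n`, as a morphism of complexes `M ⟶ M⟦n⟧`. -/
def cocycleAct (n : ℤ) (z : B.cocyclesGr n) : M.complex ⟶ M.complex⟦n⟧ :=
  Cocycle.equivHomShift.symm (Cocycle.mk (M.act n (B.toGr n z)) (n + 1) rfl (by
    rw [← M.act_d rfl]
    have h : (⟨B.d (B.toGr n z), B.d_mem (B.toGr n z).2⟩ : B.gr (n + 1)) = 0 :=
      Subtype.ext z.1.2
    exact (congrArg _ h).trans (map_zero _)))

lemma cocycleAct_f (n : ℤ) (z : B.cocyclesGr n) (p : ℤ) :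
    (M.cocycleAct n z).f p = (M.act n (B.toGr n z)).v p (p + n) rfl := by
  simp only [cocycleAct, Cocycle.equivHomShift_symm_apply, Cocycle.homOf_f, Cocycle.rightShift_coe,
    Cochain.rightShift_v _ _ _ _ _ _ _ _ rfl, Cocycle.mk_coe, shiftFunctorObjXIso]
  exact Category.comp_id _

lemma cocycleAct_one (z : B.cocyclesGr 0) (hz : z.1 = 1) :
    M.cocycleAct 0 z = ShiftedHom.mk₀ (0 : ℤ) rfl (𝟙 M.complex) := by
  have h : B.toGr 0 z = ⟨1, SetLike.GradedOne.one_mem⟩ :=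
    Subtype.ext (congrArg (fun y : B.cocycles => (y : B.carrier)) hz)
  ext p
  rw [cocycleAct_f, h, M.act_one, ShiftedHom.mk₀]
  have h0 : (CategoryTheory.shiftFunctorZero' (CochainComplex C ℤ) (0 : ℤ) rfl).inv.app M.complex =
      (CategoryTheory.shiftFunctorZero (CochainComplex C ℤ) ℤ).inv.app M.complex := by
    simp [CategoryTheory.shiftFunctorZero']
  rw [h0, Category.id_comp, shiftFunctorZero_inv_app_f,
    ← Cochain.v_comp_XIsoOfEq_hom _ p p _ (add_zero p) (add_zero p).symm, Cochain.ofHom_v,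
    HomologicalComplex.id_f]
  exact Category.id_comp _

lemma cocycleAct_mul {i j n : ℤ} (h : i + j = n) (a : B.cocyclesGr i) (b : B.cocyclesGr j)
    (c : B.cocyclesGr n) (hc : c.1 = a.1 * b.1) :
    M.cocycleAct n c = ShiftedHom.comp (M.cocycleAct j b) (M.cocycleAct i a) h := by
  have h' : B.toGr n c = ⟨B.toGr i a * B.toGr j b,
      h ▸ SetLike.GradedMul.mul_mem (B.toGr i a).2 (B.toGr j b).2⟩ :=
    Subtype.ext (congrArg (fun y : B.cocycles => (y : B.carrier)) hc)
  ext p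
  rw [cocycleAct_f, h', M.act_mul h, Cochain.comp_v _ _ _ p (p + j) (p + n) rfl (by omega),
    ShiftedHom.comp]
  simp only [HomologicalComplex.comp_f, shiftFunctor_map_f', cocycleAct_f, 
    shiftFunctorAdd'_inv_app_f']
  congr 1
  exact (Cochain.v_comp_XIsoOfEq_hom _ _ _ _ _ _).symm

variable [HasDerivedCategory.{s} C]

/-- The action of the cocycles of `B` on the image of `M` in the derived category. -/
def derivedAct (n : ℤ) : B.cocyclesGr n →ₗ[k]
    ShiftedHom (DerivedCategory.Q.obj M.complex) (DerivedCategory.Q.obj M.complex) n where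
  toFun z := ShiftedHom.map (M.cocycleAct n z) DerivedCategory.Q
  map_add' z z' := by
    rw [← ShiftedHom.map_add]
    congr 1
    ext p
    rw [HomologicalComplex.add_f_apply, cocycleAct_f, cocycleAct_f, cocycleAct_f,
      map_add, map_add, Cochain.add_v]
    rfl
  map_smul' c z := by
    rw [RingHom.id_apply, ← ShiftedHom.map_smul]
    congr 1
    ext p
    rw [HomologicalComplex.smul_f_apply, cocycleAct_f, cocycleAct_f, map_smul, map_smul, Cochain.smul_v]
    rfl

lemma derivedAct_apply (n : ℤ) (z : B.cocyclesGr n) :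
    M.derivedAct n z = ShiftedHom.map (M.cocycleAct n z) DerivedCategory.Q := rfl

lemma derivedAct_eq_zero (n : ℤ) (z : B.cocyclesGr n) (hz : B.proj z = 0) :
    M.derivedAct n z = 0 := by
  obtain ⟨m, rfl⟩ : ∃ m, n = m + 1 := ⟨n - 1, by omega⟩
  obtain ⟨b, hb, hbz⟩ := (B.proj_eq_zero_iff_of_mem z.2).1 hz
  have hz' : M.act (m + 1) (B.toGr (m + 1) z) = δ m (m + 1) (M.act m ⟨b, hb⟩) :=
    (congrArg (M.act (m + 1)) (Subtype.ext hbz.symm)).trans (M.act_d rfl ⟨b, hb⟩)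
  have h : Homotopy (M.cocycleAct (m + 1) z) 0 :=
    (Cochain.equivHomotopy _ _).symm
      ⟨(m + 1).negOnePow • (M.act m ⟨b, hb⟩).rightShift _ _ (by omega), by
        rw [Cochain.ofHom_zero, add_zero, δ_units_smul,
          Cochain.δ_rightShift _ (m + 1) (-1) 0 (by omega) (m + 1) (by omega), smul_smul]
        simp [cocycleAct, Cocycle.equivHomShift_symm_apply, hz']⟩
  rw [derivedAct_apply, ShiftedHom.map, DerivedCategory.Q_map_eq_of_homotopy _ h, Functor.map_zero,
    Limits.zero_comp]

lemma ker_projGr_le (n : ℤ) : LinearMap.ker (B.projGr n) ≤ LinearMap.ker (M.derivedAct n) :=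
  fun z hz => M.derivedAct_eq_zero n z (congrArg Subtype.val hz)

/-- The action of `H^n(B)` on the image of `M` in the derived category, which sends the class of
a cocycle to the image of its action. -/
def cohomologyAct (n : ℤ) : B.cohomologyGr n →ₗ[k]
    ShiftedHom (DerivedCategory.Q.obj M.complex) (DerivedCategory.Q.obj M.complex) n :=
  (LinearMap.ker (B.projGr n)).liftQ (M.derivedAct n)
      (M.ker_projGr_le n) ∘ₗ
    ((B.projGr n).quotKerEquivOfSurjective (B.projGr_surjective n)).symm.toLinearMap

lemma cohomologyAct_projGr (n : ℤ) (z : B.cocyclesGr n) :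
    M.cohomologyAct n (B.projGr n z) = M.derivedAct n z := by
  have h : ((B.projGr n).quotKerEquivOfSurjective (B.projGr_surjective n)).symm (B.projGr n z) =
      Submodule.Quotient.mk z := by
    rw [LinearEquiv.symm_apply_eq]
    rfl
  rw [cohomologyAct, LinearMap.comp_apply, LinearEquiv.coe_coe, h, Submodule.liftQ_apply]

/-- The image of `M` in the derived category, with its action of `H^*(B)`. -/
def toDerivedObj : GradedObj B.cohomologyGr (DerivedCategory C) where
  obj := DerivedCategory.Q.obj M.complex
  act := M.cohomologyAct
  act_one := by
    refine (M.cohomologyAct_projGr 0 ⟨1, SetLike.GradedOne.one_mem (A := B.gr)⟩).trans ?_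
    rw [derivedAct_apply, M.cocycleAct_one _ rfl, ShiftedHom.map_mk₀, CategoryTheory.Functor.map_id]
  act_mul := fun {i j n} h a b => by
    obtain ⟨a, rfl⟩ := B.projGr_surjective i a
    obtain ⟨b, rfl⟩ := B.projGr_surjective j b
    have hab : a.1 * b.1 ∈ B.cocyclesGr n :=
      h ▸ SetLike.GradedMul.mul_mem (A := B.gr) a.2 b.2
    rw [cohomologyAct_projGr, cohomologyAct_projGr]
    refine (M.cohomologyAct_projGr n ⟨a.1 * b.1, hab⟩).trans ?_
    rw [derivedAct_apply, derivedAct_apply, derivedAct_apply, ← ShiftedHom.map_comp,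
      M.cocycleAct_mul h a b _ rfl]

variable {M} in
lemma derivedAct_naturality {N : DGModule B C} (f : M ⟶ N) (n : ℤ) (z : B.cocyclesGr n) :
    M.derivedAct n z ≫ (DerivedCategory.Q.map f.hom)⟦n⟧' =
      DerivedCategory.Q.map f.hom ≫ N.derivedAct n z := by
  have h : M.cocycleAct n z ≫ f.hom⟦n⟧' = f.hom ≫ N.cocycleAct n z := by
    ext p
    have := Cochain.congr_v (f.comm n (B.toGr n z)) p (p + n) rfl
    rw [Cochain.comp_zero_cochain_v, Cochain.zero_cochain_comp_v, Cochain.ofHom_v,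
      Cochain.ofHom_v] at this
    rw [HomologicalComplex.comp_f, HomologicalComplex.comp_f, cocycleAct_f, cocycleAct_f]
    exact this
  rw [derivedAct_apply, derivedAct_apply, ShiftedHom.map, ShiftedHom.map, Category.assoc,
    ← Functor.commShiftIso_hom_naturality, ← Functor.map_comp_assoc, h, Functor.map_comp_assoc]

variable (B C) in
/-- The functor `Z⁰(C(B, C)) ⥤ D(C)_{H^*(B)}`. -/
def toDerived : DGModule B C ⥤ GradedObj B.cohomologyGr (DerivedCategory C) where
  obj M := M.toDerivedObj
  map {M N} f :=
    { hom := DerivedCategory.Q.map f.hom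
      comm := fun n a => by
        obtain ⟨z, rfl⟩ := B.projGr_surjective n a
        change M.cohomologyAct n _ ≫ _ = _ ≫ N.cohomologyAct n _
        rw [cohomologyAct_projGr, cohomologyAct_projGr]
        exact derivedAct_naturality f n z }
  map_id M := GradedObj.hom_ext (DerivedCategory.Q.map_id M.complex)
  map_comp f g := GradedObj.hom_ext (DerivedCategory.Q.map_comp f.hom g.hom)

lemma toDerived_inverts : (qis B C).IsInvertedBy (toDerived B C) := fun M N f hf => by
  have : QuasiIso f.hom := hf
  have : IsIso ((toDerived B C).map f).hom :=
    inferInstanceAs (IsIso (DerivedCategory.Q.map f.hom))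
  exact GradedObj.isIso_of_isIso_hom _

end DGModule

/-- The derived category `D(B, C)`: the localization of `Z⁰(C(B, C))` with respect to
quasi-isomorphisms. -/
abbrev DerivedDG : Type _ := (DGModule.qis B C).Localization

/-- The functor `F : D(B, C) ⥤ D(C)_{H^*(B)}`. -/
def forgetF [HasDerivedCategory.{s} C] :
    DerivedDG B C ⥤ GradedObj B.cohomologyGr (DerivedCategory C) :=
  Localization.Construction.lift (DGModule.toDerived B C) DGModule.toDerived_inverts

end DGModules

end

end DGLift

/-! Choose a K-injective complex `I` that represents `M` in the derived category, and let `E = endDG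
k I` be its endomorphism DG-algebra. K-injectivity gives `H^*(E) ≅ Ext^*(M, M)`, so the action on
`M` becomes a morphism of graded algebras `φ : H^*(B) → H^*(E)`. A strict action of `B` on `I` that
induces `φ` need not exist. What can be built is an A∞-morphism from `B` to `E` inducing `φ`, and
such a morphism makes a complex homotopy equivalent to `I` into a DG-module over `B`.

The A∞-morphism is encoded as a twisting cochain: a linear map `τ` of degree one from the tensor
algebra on `B` (letters `x` of degree `|x| - 1`) to `E` whose curvature `curv τ`, the defect in the
Maurer-Cartan equation, vanishes. It is built by induction on the length of words. Suppose that the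
curvature vanishes in lengths at most `n`. The Bianchi identity (`bianchi`) then shows that the
classes of the curvature in length `n + 1` form a Hochschild cocycle of arity `n + 1` and degree `2
- (n + 1)` (`hochHom_obstruction`). By hypothesis it is a coboundary `dg`. Adding to `τ` a cochain
of length `n` that represents `g` makes these classes vanish (`p_curv_add_suppCochain`), and a
contraction of `B` and of `E` to their cohomology, which exists over a field, yields a correction in
length `n + 1` that removes the curvature itself (`exists_correction`). The induction starts at
length two, where multiplicativity of `φ` is what is needed; this is why only arities at least three
matter. The corrections stabilise on each length, so there is a limit (`exists_twistingCochain`).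

The module is the bar construction `N = B ⊗ T(B[1]) ⊗ I` with differential twisted by `τ`, where `B`
multiplies the first letter. The cochain `τ` itself defines a chain map `ε : N → I`, and insertion
of the letter `1` gives `s : I → N`. The composite `ε ≫ s` is homotopic to the identity by the usual
bar homotopy. The composite `s ≫ ε` is `τ` of the letter `1`, whose class is `φ 1 = 1`. The cocycle
`x` of `B` acts on `I` through `s` and `ε` as `τ x`, so the induced action on cohomology is `φ`
(`exists_dgModule`, `exists_forgetF_iso`).

K-injective resolutions come from the small object argument, applied to a set of monomorphisms
between acyclic complexes that is large enough to make acyclic fibrant complexes contractible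
(`exists_kInjective_resolution`). -/

namespace DGLift

noncomputable section

/-! ### Lifting properties that detect quasi-isomorphisms, and the small object argument for
monomorphisms. -/

section KInjectiveResolutions

open Limits HomologicalComplex ZeroObject

variable {C : Type u} [Category.{v} C] [Abelian C]

/-- The complex `X = X` concentrated in degrees `n` and `n + 1`. -/
abbrev disc (X : C) (n : ℤ) : CochainComplex C ℤ :=
  double (𝟙 X) (show (ComplexShape.up ℤ).Rel n (n + 1) from rfl)

lemma int_ne_succ (n : ℤ) : n ≠ n + 1 := by omega

lemma pred_unique {i m n : ℤ} (hi : (ComplexShape.up ℤ).Rel i n) (hm : m + 1 = n) : i = m := by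
  simp only [ComplexShape.up_Rel] at hi
  omega

/-- The morphism from a disc given by a morphism in degree `n`. -/
def fromDisc {X : C} {n : ℤ} {K : CochainComplex C ℤ} (x : X ⟶ K.X n) : disc X n ⟶ K :=
  mkHomFromDouble _ (int_ne_succ n) x (x ≫ K.d n (n + 1)) (by simp) (by simp)

@[simp]
lemma fromDisc_f {X : C} {n : ℤ} {K : CochainComplex C ℤ} (x : X ⟶ K.X n) :
    (fromDisc x).f n = (doubleXIso₀ _ _).hom ≫ x := by
  simp [fromDisc]

open scoped Classical in
/-- The morphism to a disc given by a morphism in degree `n + 1`. -/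
def toDisc {X : C} {n : ℤ} {K : CochainComplex C ℤ} (x : K.X (n + 1) ⟶ X) : K ⟶ disc X n where
  f k :=
    if hk₀ : k = n then
      (K.XIsoOfEq hk₀).hom ≫ K.d n (n + 1) ≫ x ≫ (doubleXIso₀ _ _).inv ≫
        ((disc X n).XIsoOfEq hk₀).inv
    else if hk₁ : k = n + 1 then
      (K.XIsoOfEq hk₁).hom ≫ x ≫ (doubleXIso₁ _ _ (int_ne_succ n)).inv ≫
        ((disc X n).XIsoOfEq hk₁).inv
    else 0
  comm' i j hij := by
    obtain rfl : i + 1 = j := hij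
    by_cases h₀ : i = n
    · subst h₀
      simp [double_d _ _ (int_ne_succ i)]
    · rw [double_d_eq_zero₀ _ _ _ _ h₀, comp_zero]
      by_cases h₁ : i + 1 = n
      · subst h₁
        simp
      · rw [dif_neg h₁, dif_neg (by omega), comp_zero]

@[simp]
lemma toDisc_f₁ {X : C} {n : ℤ} {K : CochainComplex C ℤ} (x : K.X (n + 1) ⟶ X) :
    (toDisc x).f (n + 1) = x ≫ (doubleXIso₁ _ _ (int_ne_succ n)).inv := by
  simp [toDisc]

@[simp]
lemma toDisc_f₀ {X : C} {n : ℤ} {K : CochainComplex C ℤ} (x : K.X (n + 1) ⟶ X) :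
    (toDisc x).f n = K.d n (n + 1) ≫ x ≫ (doubleXIso₀ _ _).inv := by
  simp [toDisc]

/-- The projection from the disc to the sphere of its lower degree. -/
def discToSphere (X : C) (n : ℤ) : disc X n ⟶ (single C (ComplexShape.up ℤ) n).obj X :=
  mkHomToSingle (doubleXIso₀ _ _).hom (fun i hi => by
    rw [double_d_eq_zero₁ _ _ _ _ (int_ne_succ n), zero_comp])

/-- The lifting problems which detect quasi-isomorphisms among morphisms of complexes. -/
inductive sphereDiscLifts : MorphismProperty (CochainComplex C ℤ)
  | sphere (Q : C) [Injective Q] (n : ℤ) :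
      sphereDiscLifts (0 : (single C (ComplexShape.up ℤ) n).obj Q ⟶ 0)
  | disc (Q : C) [Injective Q] (n : ℤ) : sphereDiscLifts (discToSphere Q n)

/-- A cocycle with values in an injective object extends along `j`. -/
def ExtendsCocycles {X Y : CochainComplex C ℤ} (j : X ⟶ Y) : Prop :=
  ∀ ⦃Q : C⦄ [Injective Q] (n m : ℤ) (x : X.X n ⟶ Q), m + 1 = n → X.d m n ≫ x = 0 →
    ∃ y : Y.X n ⟶ Q, Y.d m n ≫ y = 0 ∧ j.f n ≫ y = x

/-- A primitive of a cocycle with values in an injective object extends along `j`. -/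
def ExtendsPrimitives {X Y : CochainComplex C ℤ} (j : X ⟶ Y) : Prop :=
  ∀ ⦃Q : C⦄ [Injective Q] (m n : ℤ) (y : Y.X n ⟶ Q) (x : X.X (n + 1) ⟶ Q), m + 1 = n →
    Y.d m n ≫ y = 0 → X.d n (n + 1) ≫ x = j.f n ≫ y →
    ∃ y' : Y.X (n + 1) ⟶ Q, Y.d n (n + 1) ≫ y' = y ∧ j.f (n + 1) ≫ y' = x

/-- A cocycle with values in `Q` is a morphism to the sphere on `Q`, so extending it is lifting
against `sphere → 0`. In the same way, a primitive of a cocycle is a lift along `disc → sphere`. -/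
lemma extendsCocycles_of_llp {X Y : CochainComplex C ℤ} {j : X ⟶ Y}
    (hj : (sphereDiscLifts (C := C)).llp j) : ExtendsCocycles j := by
  intro Q _ n m x hm hx
  have := hj _ (sphereDiscLifts.sphere Q n)
  have sq : CommSq (mkHomToSingle x (fun i hi => by
      obtain rfl := pred_unique hi hm
      exact hx)) j (0 : (single C (ComplexShape.up ℤ) n).obj Q ⟶ 0) 0 := ⟨by simp⟩
  obtain ⟨l, hl, -⟩ : ∃ l, j ≫ l = _ ∧ l ≫ _ = _ := ⟨sq.lift, sq.fac_left, sq.fac_right⟩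
  replace hl := congr_arg (fun φ => φ.f n) hl
  simp only [comp_f, mkHomToSingle_f] at hl
  refine ⟨l.f n ≫ (singleObjXSelf _ n Q).hom, ?_, ?_⟩
  · rw [← Category.assoc, ← l.comm]
    simp
  · rw [← Category.assoc, hl]
    simp

lemma extendsPrimitives_of_llp {X Y : CochainComplex C ℤ} {j : X ⟶ Y}
    (hj : (sphereDiscLifts (C := C)).llp j) : ExtendsPrimitives j := by
  intro Q _ m n y x hm hy hx
  have := hj _ (sphereDiscLifts.disc Q n)
  have sq : CommSq (toDisc x) j (discToSphere Q n) (mkHomToSingle y (fun i hi => by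
      obtain rfl := pred_unique hi hm
      exact hy)) := ⟨by
    apply to_single_hom_ext
    simp [discToSphere, reassoc_of% hx]⟩
  obtain ⟨l, hl, hr⟩ : ∃ l, j ≫ l = _ ∧ l ≫ _ = _ := ⟨sq.lift, sq.fac_left, sq.fac_right⟩
  replace hl := congr_arg (fun φ => φ.f (n + 1)) hl
  replace hr := congr_arg (fun φ => φ.f n) hr
  simp only [comp_f, mkHomToSingle_f, discToSphere, toDisc_f₁] at hl hr
  refine ⟨l.f (n + 1) ≫ (doubleXIso₁ _ _ (int_ne_succ n)).hom, ?_, ?_⟩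
  · rw [← Category.assoc, ← l.comm, double_d _ _ (int_ne_succ n)]
    simpa [← cancel_mono (singleObjXSelf (ComplexShape.up ℤ) n Q).inv] using hr
  · rw [← Category.assoc, hl]
    simp

/-- Injective objects test homology. Extending a cocycle that embeds the homology of `X` in an
injective object gives injectivity on homology. Extending primitives shows that a morphism from the
homology of `Y` to an injective object vanishes once it vanishes on the homology of `X`, which gives
surjectivity. -/
lemma quasiIso_of_extends [EnoughInjectives C] {X Y : CochainComplex C ℤ} {j : X ⟶ Y}
    (h₁ : ExtendsCocycles j) (h₂ : ExtendsPrimitives j) : QuasiIso j := by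
  rw [quasiIso_iff]
  intro n
  rw [quasiIsoAt_iff_isIso_homologyMap]
  have hm : Mono (homologyMap j n) := by
    let e := Injective.ι (X.homology n)
    let a := Injective.factorThru e (X.homologyι n)
    obtain ⟨y, hy, hy'⟩ := h₁ n (n - 1) (X.pOpcycles n ≫ a) (by omega) (by simp)
    have hb : opcyclesMap j n ≫ Y.descOpcycles y (n - 1) (by simp) hy = a := by
      simp [← cancel_epi (X.pOpcycles n), hy']
    have : homologyMap j n ≫ Y.homologyι n ≫ Y.descOpcycles y (n - 1) (by simp) hy = e := by
      rw [homologyι_naturality_assoc, hb, Injective.comp_factorThru]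
    exact mono_of_mono_fac this
  have he : Epi (homologyMap j n) := by
    let c := cokernel.π (homologyMap j n) ≫ Injective.ι _
    let b := Injective.factorThru c (Y.homologyι n)
    have hb : Y.homologyι n ≫ b = c := Injective.comp_factorThru _ _
    let a := opcyclesMap j n ≫ b
    have ha : X.homologyι n ≫ a = 0 := by
      simp [a, ← homologyι_naturality_assoc, hb, c]
    have ex : (ShortComplex.mk _ _ (X.homologyι_comp_fromOpcycles n (n + 1))).Exact :=
      ShortComplex.exact_of_f_is_kernel _ (X.homologyIsKernel n (n + 1) (by simp))
    obtain ⟨y', hy', -⟩ := h₂ (n - 1) n (Y.pOpcycles n ≫ b) (ex.descToInjective a ha) (by omega)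
      (by simp) (by
        have := ex.comp_descToInjective a ha
        dsimp at this
        rw [← p_fromOpcycles, Category.assoc, this]
        simp [a])
    have hb' : b = Y.fromOpcycles n (n + 1) ≫ y' := by
      simp [← cancel_epi (Y.pOpcycles n), hy']
    have hc : c = 0 := by rw [← hb, hb']; simp
    apply Preadditive.epi_of_cokernel_zero
    rw [← cancel_mono (Injective.ι _)]
    simpa [c] using hc
  exact isIso_of_mono_of_epi _

/-- Since `Hom(-, Q)` is exact for injective `Q`, every cocycle on an acyclic complex has a
primitive. Primitives extend along the monomorphism `j` by injectivity, and the coboundary of the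
extension extends the cocycle. -/
lemma extends_of_acyclic {X Y : CochainComplex C ℤ} (j : X ⟶ Y) [Mono j] (hX : X.Acyclic)
    (hY : Y.Acyclic) : ExtendsCocycles j ∧ ExtendsPrimitives j := by
  have primitive {Z : CochainComplex C ℤ} (hZ : Z.Acyclic) {Q : C} [Injective Q] (m n : ℤ)
      (x : Z.X n ⟶ Q) (hm : m + 1 = n) (hx : Z.d m n ≫ x = 0) :
      ∃ x', Z.d n (n + 1) ≫ x' = x := by
    have := hZ n
    rw [exactAt_iff' Z m n (n + 1) (by simp; omega) (by simp)] at this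
    exact ⟨this.descToInjective x hx, this.comp_descToInjective x hx⟩
  have h₁ : ExtendsCocycles j := by
    intro Q _ n m x hm hx
    obtain ⟨x', rfl⟩ := primitive hX m n x hm hx
    exact ⟨Y.d n (n + 1) ≫ Injective.factorThru x' (j.f (n + 1)), by simp, by simp⟩
  refine ⟨h₁, ?_⟩
  intro Q _ m n y x hm hy hx
  obtain ⟨y₀, rfl⟩ := primitive hY m n y hm hy
  obtain ⟨z, hz, hz'⟩ := h₁ (n + 1) n (x - j.f (n + 1) ≫ y₀) rfl (by simp [hx])
  exact ⟨y₀ + z, by simp [hz], by simp [hz']⟩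

lemma llp_of_extends {X Y : CochainComplex C ℤ} {j : X ⟶ Y}
    (h₁ : ExtendsCocycles j) (h₂ : ExtendsPrimitives j) : (sphereDiscLifts (C := C)).llp j := by
  have hs (Q : C) [Injective Q] (n : ℤ) :
      HasLiftingProperty j (0 : (single C (ComplexShape.up ℤ) n).obj Q ⟶ 0) := by
    refine ⟨fun {f g} sq => ?_⟩
    have hd : X.d (n - 1) n ≫ f.f n = 0 := by rw [← f.comm]; simp
    obtain ⟨y, hy, hy'⟩ := h₁ n (n - 1) (f.f n ≫ (singleObjXSelf _ n Q).hom) (by omega)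
      (by rw [reassoc_of% hd, zero_comp])
    exact ⟨⟨⟨mkHomToSingle y (fun i hi => by
      obtain rfl := pred_unique hi (by omega : n - 1 + 1 = n)
      exact hy), by apply to_single_hom_ext; simp [reassoc_of% hy'],
      (isZero_zero _).eq_of_tgt _ _⟩⟩⟩
  have hd (Q : C) [Injective Q] (n : ℤ) : HasLiftingProperty j (discToSphere Q n) := by
    refine ⟨fun {f g} sq => ?_⟩
    have hd : Y.d (n - 1) n ≫ g.f n = 0 := by rw [← g.comm]; simp
    have hsq := congr_arg (fun φ => φ.f n) sq.w
    have hf := f.comm n (n + 1)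
    rw [double_d _ _ (int_ne_succ n)] at hf
    simp only [comp_f, discToSphere, mkHomToSingle_f] at hsq
    obtain ⟨y, hy, hy'⟩ := h₂ (n - 1) n (g.f n ≫ (singleObjXSelf _ n Q).hom)
      (f.f (n + 1) ≫ (doubleXIso₁ _ _ (int_ne_succ n)).hom) (by omega)
      (by rw [reassoc_of% hd, zero_comp]) (by
        rw [← Category.assoc, ← hf, ← Category.assoc (j.f n), ← hsq]; simp)
    refine ⟨⟨⟨toDisc y, ?_, ?_⟩⟩⟩
    · apply to_double_hom_ext
      · simp only [comp_f, toDisc_f₀]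
        rw [reassoc_of% hy, reassoc_of% hsq.symm]
        simp
      · simp [reassoc_of% hy']
    · apply to_single_hom_ext
      simp [discToSphere, reassoc_of% hy]
  intro K L p hp
  rcases hp with ⟨Q, n⟩ | ⟨Q, n⟩
  · exact hs Q n
  · exact hd Q n

/-- The test morphisms on spheres and discs have the right lifting property against every
monomorphism between acyclic complexes. Anything that lifts on the left against `J.rlp` therefore
lifts against the test morphisms. -/
lemma quasiIso_of_llp_rlp [EnoughInjectives C] (J : MorphismProperty (CochainComplex C ℤ))
    (hJ : ∀ ⦃X Y : CochainComplex C ℤ⦄ (j : X ⟶ Y), J j → Mono j ∧ X.Acyclic ∧ Y.Acyclic)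
    {X Y : CochainComplex C ℤ} (j : X ⟶ Y) (hj : J.rlp.llp j) : QuasiIso j := by
  have hle : sphereDiscLifts (C := C) ≤ J.rlp := by
    intro K L p hp A B i hi
    obtain ⟨_, hA, hB⟩ := hJ i hi
    obtain ⟨h₁, h₂⟩ := extends_of_acyclic i hA hB
    exact llp_of_extends h₁ h₂ _ hp
  have hj' := MorphismProperty.antitone_llp hle _ hj
  exact quasiIso_of_extends (extendsCocycles_of_llp hj') (extendsPrimitives_of_llp hj')

lemma acyclic_of (X : ℤ → C) (d : ∀ n, X n ⟶ X (n + 1)) (sq : ∀ n, d n ≫ d (n + 1) = 0)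
    (h : ∀ n, (ShortComplex.mk (d n) (d (n + 1)) (sq n)).Exact) :
    (CochainComplex.of X d sq).Acyclic := by
  intro j
  obtain ⟨n, rfl⟩ : ∃ n, j = n + 1 := ⟨j - 1, by omega⟩
  rw [exactAt_iff' _ n (n + 1) (n + 1 + 1) (by simp) (by simp)]
  refine (ShortComplex.exact_iff_of_iso (ShortComplex.isoMk
    (S₁ := ShortComplex.mk (d n) (d (n + 1)) (sq n))
    (S₂ := (CochainComplex.of X d sq).sc' n (n + 1) (n + 1 + 1)) (Iso.refl _) (Iso.refl _)
    (Iso.refl _) ?_ ?_)).1 (h n)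
  · exact (Category.id_comp _).trans ((CochainComplex.of_d X d n).trans (Category.comp_id
      (d n)).symm)
  · exact (Category.id_comp _).trans ((CochainComplex.of_d _ _ _).trans (Category.comp_id (d
      (n + 1))).symm)

/-- Pushouts of coproducts of monomorphisms are monomorphisms, so the transfinite compositions that
occur are increasing unions. A regular cardinal exceeding the number of subobjects of each source
makes the sources small with respect to such unions. -/
lemma hasSmallObjectArgument_of_mono {D : Type u} [Category.{v} D] [Abelian D]
    [IsGrothendieckAbelian.{w} D]
    (J : MorphismProperty D) [MorphismProperty.IsSmall.{w} J]
    (hJ : J ≤ MorphismProperty.monomorphisms D) :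
    MorphismProperty.HasSmallObjectArgument.{w} J := by
  obtain ⟨κ, hκ', hκ⟩ := HasCardinalLT.exists_regular_cardinal_forall.{w}
    (fun f : J.toSet => Subobject f.1.left)
  have : Fact κ.IsRegular := ⟨hκ'⟩
  have : Nonempty κ.ord.ToType := by simpa using hκ'.ne_zero
  have := WellFoundedLT.toOrderBot κ.ord.ToType
  exact ⟨κ, inferInstance, inferInstance,
    { preservesColimit {A B X Y} i hi f hf := by
        let hf' : (MorphismProperty.monomorphisms D).TransfiniteCompositionOfShape κ.ord.ToType f :=
          { toTransfiniteCompositionOfShape := hf.toTransfiniteCompositionOfShape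
            map_mem j hj := by
              have := (hf.attachCells j hj).pushouts_coproducts
              simp only [MorphismProperty.ofHoms_homFamily] at this
              refine (?_ : _ ≤ MorphismProperty.monomorphisms D) _ this
              simp only [MorphismProperty.pushouts_le_iff, MorphismProperty.coproducts_le_iff]
              exact hJ }
        have (j j' : κ.ord.ToType) (φ : j ⟶ j') : Mono (hf'.F.map φ) := hf'.mem_map φ
        exact IsGrothendieckAbelian.preservesColimit_coyoneda_obj_of_mono (Y := hf'.F) (κ := κ)
          (hκ ⟨Arrow.mk i, hi⟩) }⟩

end KInjectiveResolutions

/-! ### Left resolutions with terms in a small family, mapped to a given acyclic complex. -/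

section SmallAcyclicComplexes

open Limits HomologicalComplex ZeroObject

variable (C : Type u) [Category.{v} C] [Abelian C] [IsGrothendieckAbelian.{w} C]

/-- A family of objects which contains the zero object, the quotients of the separator, and the
copowers of the separator indexed by sets of morphisms to its members, by number of steps. -/
def coverFamily : ℕ → Σ ι : Type w, ι → C
  | 0 => ⟨Option (Shrink.{w} (Subobject (separator C))), fun a => a.elim 0
      fun a => cokernel ((equivShrink.{w} (Subobject (separator C))).symm a).arrow⟩
  | n + 1 => ⟨Σ a : (coverFamily n).1, Set (Shrink.{w} (separator C ⟶ (coverFamily n).2 a)),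
      fun x => ∐ (fun _ : x.2 => separator C)⟩

/-- The index type of `coverFamily`. -/
abbrev CoverIndex : Type w := Σ n : ℕ, (coverFamily.{w} C n).1

variable {C}

/-- The objects of `coverFamily`. -/
abbrev coverObj (a : CoverIndex.{w} C) : C := (coverFamily.{w} C a.1).2 a.2

variable (C) in
/-- The index of the zero object. -/
def zeroIndex : CoverIndex.{w} C := ⟨0, none⟩

lemma isZero_coverObj_zeroIndex : IsZero (coverObj (zeroIndex.{w} C)) := isZero_zero C

/-- The index of a quotient of the separator. -/
def quotIndex (U : Subobject (separator C)) : CoverIndex.{w} C := ⟨0, some (equivShrink _ U)⟩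

/-- The identification of the member of the family given by a quotient of the separator. -/
def quotIndexIso (U : Subobject (separator C)) :
    coverObj (quotIndex.{w} U) ≅ cokernel U.arrow :=
  eqToIso (by
    change cokernel ((equivShrink.{w} (Subobject (separator C))).symm (equivShrink _ U)).arrow = _
    rw [Equiv.symm_apply_apply])

/-- This is the inductive step for a resolution of `ker f` that comes with a chain map to a given
exact sequence. The next term has to cover the kernel and to carry a lift `χ` of `ψ` at the same
time, while staying in a family that does not depend on the target. -/
lemma exists_cover (a : CoverIndex.{w} C) {W : C} (f : coverObj a ⟶ W) (S : ShortComplex C)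
    (hS : S.Exact) (ψ : coverObj a ⟶ S.X₂) (hψ : kernel.ι f ≫ ψ ≫ S.g = 0) :
    ∃ (b : CoverIndex.{w} C) (g : coverObj b ⟶ coverObj a) (χ : coverObj b ⟶ S.X₁)
      (w : g ≫ f = 0), χ ≫ S.f = g ≫ ψ ∧ (ShortComplex.mk g f w).Exact := by
  -- One summand for each morphism from the separator to the kernel of `f` whose composite with `ψ`
  -- lifts through `S.f`.
  let T : Set (Shrink.{w} (separator C ⟶ coverObj a)) := {φ | (equivShrink _).symm φ ≫ f = 0 ∧
    ∃ χ, χ ≫ S.f = (equivShrink _).symm φ ≫ ψ}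
  choose χ hχ using fun φ : T => φ.2.2
  let g : (∐ fun _ : T => separator C) ⟶ coverObj a :=
    Sigma.desc (fun φ : T => (equivShrink _).symm φ.1)
  have w : g ≫ f = 0 := Sigma.hom_ext _ _ (fun φ => by simpa [g] using φ.2.1)
  refine ⟨⟨a.1 + 1, ⟨a.2, T⟩⟩, g, Sigma.desc χ, w, ?_, ?_⟩
  · refine Sigma.hom_ext _ _ (fun φ => ?_)
    erw [Sigma.ι_desc_assoc, Sigma.ι_desc_assoc]
    exact hχ φ
  rw [ShortComplex.exact_iff_epi_kernel_lift]
  apply Preadditive.epi_of_cancel_zero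
  intro Y h hh
  rw [ShortComplex.exact_iff_epi_kernel_lift] at hS
  let k := kernel.lift S.g (kernel.ι f ≫ ψ) (by simpa using hψ)
  -- By exactness `S.X₁` maps onto the kernel of `S.g`, so the pullback maps onto `ker f`. Every
  -- morphism from the separator to this pullback gives an element of `T`.
  rw [← cancel_epi (pullback.fst k (kernel.lift S.g S.f S.zero)), comp_zero]
  apply (isSeparator_separator C).def
  intro x
  have hx : x ≫ pullback.fst k (kernel.lift S.g S.f S.zero) ≫ kernel.ι f ≫ ψ =
      x ≫ pullback.snd k (kernel.lift S.g S.f S.zero) ≫ S.f := by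
    have := pullback.condition (f := k) (g := kernel.lift S.g S.f S.zero) =≫ kernel.ι S.g
    simp only [Category.assoc, kernel.lift_ι, k] at this
    rw [this]
  let φ : T := ⟨equivShrink _ (x ≫ pullback.fst k (kernel.lift S.g S.f S.zero) ≫ kernel.ι f),
    by simp, x ≫ pullback.snd k (kernel.lift S.g S.f S.zero), by simp [hx]⟩
  have key : Sigma.ι (fun _ : T => separator C) φ ≫ kernel.lift f g w =
      x ≫ pullback.fst k (kernel.lift S.g S.f S.zero) := by
    rw [← cancel_mono (kernel.ι f)]
    simp [g, φ]
  rw [comp_zero, ← Category.assoc, ← key, Category.assoc]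
  exact (congrArg _ hh).trans comp_zero

/-- The `i`-th degree downwards from zero. -/
def negDeg : ℕ → ℤ
  | 0 => 0
  | i + 1 => Int.negSucc i

lemma negDeg_eq (i : ℕ) : negDeg i = -(i : ℤ) := by
  cases i <;> simp [negDeg, Int.negSucc_eq]

/-- One step of a resolution over the family, with its morphism to a complex `F`. -/
structure CoverState (F : CochainComplex C ℤ) (i : ℕ) where
  src : CoverIndex.{w} C
  tgt : CoverIndex.{w} C
  f : coverObj src ⟶ coverObj tgt
  ψ : coverObj src ⟶ F.X (negDeg i)
  hψ : ∀ j, kernel.ι f ≫ ψ ≫ F.d (negDeg i) j = 0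

namespace CoverState

variable {F : CochainComplex C ℤ}

lemma exists_next (hF : F.Acyclic) {i : ℕ} (s : CoverState.{w} F i) :
    ∃ (b : CoverIndex.{w} C) (g : coverObj b ⟶ coverObj s.src)
      (χ : coverObj b ⟶ F.X (negDeg (i + 1)))
      (w : g ≫ s.f = 0), χ ≫ F.d (negDeg (i + 1)) (negDeg i) = g ≫ s.ψ ∧
        (ShortComplex.mk g s.f w).Exact := by
  have h := hF (negDeg i)
  rw [exactAt_iff' F (negDeg (i + 1)) (negDeg i) (negDeg i + 1)
    (by simp [negDeg_eq]; omega) (by simp)] at h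
  exact exists_cover s.src s.f _ h s.ψ (s.hψ _)

variable (hF : F.Acyclic)

/-- The next step of a resolution. -/
def next {i : ℕ} (s : CoverState.{w} F i) : CoverState.{w} F (i + 1) where
  src := (exists_next hF s).choose
  tgt := s.src
  f := (exists_next hF s).choose_spec.choose
  ψ := (exists_next hF s).choose_spec.choose_spec.choose
  hψ j := by
    obtain ⟨w, h₁, h₂⟩ := (exists_next hF s).choose_spec.choose_spec.choose_spec
    by_cases hj : j = negDeg i
    · subst hj
      rw [h₁, kernel.condition_assoc, zero_comp]
    · have h₀ : F.d (negDeg (i + 1)) j = 0 := F.shape _ _ (by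
        simp only [ComplexShape.up_Rel, negDeg_eq] at hj ⊢
        push_cast
        omega)
      exact (congrArg (fun t => _ ≫ _ ≫ t) h₀).trans (by simp)

lemma next_comp {i : ℕ} (s : CoverState.{w} F i) : (s.next hF).f ≫ s.f = 0 :=
  (exists_next hF s).choose_spec.choose_spec.choose_spec.choose

lemma next_ψ {i : ℕ} (s : CoverState.{w} F i) :
    (s.next hF).ψ ≫ F.d (negDeg (i + 1)) (negDeg i) = (s.next hF).f ≫ s.ψ :=
  (exists_next hF s).choose_spec.choose_spec.choose_spec.choose_spec.1

lemma next_exact {i : ℕ} (s : CoverState.{w} F i) :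
    (ShortComplex.mk (s.next hF).f s.f (s.next_comp hF)).Exact :=
  (exists_next hF s).choose_spec.choose_spec.choose_spec.choose_spec.2

variable (s : CoverState.{w} F 0)

/-- The resolution which starts with a given step. -/
def seq : ∀ i, CoverState.{w} F i
  | 0 => s
  | i + 1 => (seq i).next hF

/-- The indices of the terms of the resolution. -/
def index : ℤ → CoverIndex.{w} C
  | Int.ofNat 0 => s.src
  | Int.ofNat (_ + 1) => zeroIndex C
  | Int.negSucc i => (seq hF s (i + 1)).src

/-- The differentials of the resolution. -/
def diff : ∀ j : ℤ, coverObj (index hF s j) ⟶ coverObj (index hF s (j + 1))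
  | Int.ofNat _ => 0
  | Int.negSucc 0 => (seq hF s 1).f
  | Int.negSucc (i + 1) => (seq hF s (i + 2)).f

lemma diff_comp (j : ℤ) : diff hF s j ≫ diff hF s (j + 1) = 0 := by
  match j with
  | Int.ofNat _ => exact zero_comp
  | Int.negSucc 0 => exact comp_zero
  | Int.negSucc 1 => exact next_comp hF (seq hF s 1)
  | Int.negSucc (i + 2) => exact next_comp hF (seq hF s (i + 2))

end CoverState

variable (C) in
/-- The index type of the complexes whose terms are in `coverFamily`. -/
abbrev CoverComplexIndex : Type max v w := Σ x : ℤ → CoverIndex.{w} C,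
  { d : ∀ i, coverObj (x i) ⟶ coverObj (x (i + 1)) // ∀ i, d i ≫ d (i + 1) = 0 }

/-- The complexes whose terms are in `coverFamily`. -/
abbrev coverComplex (a : CoverComplexIndex.{w} C) : CochainComplex C ℤ :=
  CochainComplex.of (fun i => coverObj (a.1 i)) a.2.1 a.2.2

namespace CoverState

variable {F : CochainComplex C ℤ} (hF : F.Acyclic) (s : CoverState.{w} F 0)

/-- The index of the resolution. -/
def complexIndex : CoverComplexIndex.{w} C := ⟨index hF s, diff hF s, diff_comp hF s⟩

/-- In degree zero the outgoing morphism `s.f` has zero target, so exactness of the first step says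
that the next term maps onto `s.src`. The complex is thus a resolution of `s.src` including that
object. -/
lemma acyclic (hs : IsZero (coverObj s.tgt)) : (coverComplex (complexIndex hF s)).Acyclic := by
  apply acyclic_of
  intro j
  match j with
  | Int.ofNat n => exact ShortComplex.exact_of_isZero_X₂ _ isZero_coverObj_zeroIndex
  | Int.negSucc 0 =>
    have h := (ShortComplex.exact_iff_epi _ (hs.eq_of_tgt s.f 0)).1 (next_exact hF s)
    exact (ShortComplex.exact_iff_epi _ rfl).2 h
  | Int.negSucc 1 => exact next_exact hF (seq hF s 1)
  | Int.negSucc (i + 2) => exact next_exact hF (seq hF s (i + 2))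

/-- The morphism from the resolution to `F`, in each degree. -/
def toTarget : ∀ j : ℤ, coverObj (index hF s j) ⟶ F.X j
  | Int.ofNat 0 => s.ψ
  | Int.ofNat (_ + 1) => 0
  | Int.negSucc i => (seq hF s (i + 1)).ψ

lemma toTarget_comm (hs : s.ψ ≫ F.d 0 1 = 0) (j : ℤ) :
    toTarget hF s j ≫ F.d j (j + 1) = diff hF s j ≫ toTarget hF s (j + 1) := by
  match j with
  | Int.ofNat 0 => exact hs.trans zero_comp.symm
  | Int.ofNat (_ + 1) => exact zero_comp.trans zero_comp.symm
  | Int.negSucc 0 => exact next_ψ hF s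
  | Int.negSucc (i + 1) => exact next_ψ hF (seq hF s (i + 1))

/-- The morphism from the resolution to `F`. -/
def hom (hs : s.ψ ≫ F.d 0 1 = 0) : coverComplex (complexIndex hF s) ⟶ F where
  f := toTarget hF s
  comm' i j hij := by
    obtain rfl : i + 1 = j := hij
    exact (toTarget_comm hF s hs i).trans (congrArg (fun t => t ≫ toTarget hF s (i + 1))
      (CochainComplex.of_d (fun i => coverObj (index hF s i)) (diff hF s) i).symm)

end CoverState

end SmallAcyclicComplexes

/-! ### Fibrant complexes and the existence of K-injective resolutions. -/

section KInjectiveResolutions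

open Limits HomologicalComplex ZeroObject CochainComplex.HomComplex

variable {C : Type u} [Category.{v} C] [Abelian C]

lemma acyclic_of_homotopy {K : CochainComplex C ℤ} (h : Homotopy (𝟙 K) 0) : K.Acyclic := by
  intro n
  rw [exactAt_iff_isZero_homology, IsZero.iff_id_eq_zero, ← homologyMap_id,
    h.homologyMap_eq, homologyMap_zero]

lemma acyclic_shift {K : CochainComplex C ℤ} (hK : K.Acyclic) (m : ℤ) : (K⟦m⟧).Acyclic := by
  intro n
  rw [exactAt_iff_isZero_homology]
  exact ((exactAt_iff_isZero_homology _ _).1 (hK (m + n))).of_iso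
    ((CochainComplex.ShiftSequence.shiftIso C m n (m + n) rfl).app K)

/-- The contracting homotopy of a complex with injective objects of cycles. -/
lemma nonempty_contraction {F : CochainComplex C ℤ} (hF : F.Acyclic)
    (h : ∀ n, Injective (F.cycles n)) : Nonempty (Homotopy (𝟙 F) 0) := by
  -- Injectivity of the cycles splits their inclusion. Acyclicity then makes the differential onto
  -- the next cycles a split epimorphism, with section `s`.
  choose r hr using fun n => (⟨Injective.factorThru (𝟙 (F.cycles n)) (F.iCycles n),
    Injective.comp_factorThru _ _⟩ : ∃ r : F.X n ⟶ F.cycles n, F.iCycles n ≫ r = 𝟙 _)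
  have hs : ∀ q p : ℤ, q + 1 = p → ∃ s : F.cycles p ⟶ F.X q,
      F.toCycles q p ≫ s = 𝟙 _ - r q ≫ F.iCycles q ∧ s ≫ F.toCycles q p = 𝟙 _ := by
    rintro q _ rfl
    have he : Epi (F.toCycles q (q + 1)) := by
      have := hF (q + 1)
      rw [exactAt_iff' F q (q + 1) (q + 1 + 1) (by simp) (by simp),
        ShortComplex.exact_iff_epi_toCycles, ← F.toCycles_cyclesIsoSc'_hom q (q + 1) (q + 1 + 1)
          (by simp) (by simp)] at this
      rw [← Category.comp_id (F.toCycles q (q + 1)),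
        ← (F.cyclesIsoSc' q (q + 1) (q + 1 + 1) (by simp) (by simp)).hom_inv_id, ← Category.assoc]
      exact @epi_comp _ _ _ _ _ _ this _ inferInstance
    have hz : F.iCycles q ≫ F.toCycles q (q + 1) = 0 := by
      simp [← cancel_mono (F.iCycles (q + 1))]
    let S := ShortComplex.mk _ _ hz
    have hS : S.Exact := by
      apply ShortComplex.exact_of_f_is_kernel
      refine KernelFork.IsLimit.ofι' _ hz fun {A} k hk => ⟨F.liftCycles k (q + 1) (by simp) ?_, ?_⟩
      · rw [← F.toCycles_i, reassoc_of% hk, zero_comp]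
      · simp
    have : Epi S.g := he
    refine ⟨hS.desc (𝟙 _ - r q ≫ F.iCycles q) (by
      simp [S, Preadditive.comp_sub, reassoc_of% hr]), hS.g_desc _ _, ?_⟩
    rw [← cancel_epi (F.toCycles q (q + 1))]
    have := hS.g_desc (𝟙 _ - r q ≫ F.iCycles q) (by
      simp [S, Preadditive.comp_sub, reassoc_of% hr])
    dsimp only [S] at this
    rw [reassoc_of% this, Preadditive.sub_comp, Category.assoc, hz]
    simp
  choose s hs hs' using hs
  -- The contraction projects to the cycles by `r` and lifts these one degree down by `s`.
  refine ⟨(Cochain.equivHomotopy _ _).symm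
    ⟨Cochain.mk fun p q hpq => r p ≫ s q p (by omega), ?_⟩⟩
  ext p
  rw [Cochain.ofHom_zero, add_zero,
    δ_v (-1) 0 (by omega) _ p p (by omega) (p - 1) (p + 1) rfl rfl]
  have h₁ : s (p - 1) p (by omega) ≫ F.d (p - 1) p = F.iCycles p := by
    rw [← F.toCycles_i, reassoc_of% hs']
  have h₂ : F.d p (p + 1) ≫ r (p + 1) = F.toCycles p (p + 1) := by
    rw [← F.toCycles_i, Category.assoc, hr, Category.comp_id]
  simp [h₁, reassoc_of% h₂, hs]

variable (C) in
/-- The inclusions of discs on subobjects of the separator. -/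
def discInclusion [HasSeparator C] (x : Subobject (separator C) × ℤ) :
    disc (x.1 : C) x.2 ⟶ disc (separator C) x.2 :=
  fromDisc (x.1.arrow ≫ (doubleXIso₀ _ _).inv)

/-- The inclusion of a shifted complex in its cone. -/
def coneInclusion (A : CochainComplex C ℤ) (m : ℤ) :
    A⟦m⟧ ⟶ (CochainComplex.mappingCone (𝟙 A))⟦m⟧ :=
  (CochainComplex.mappingCone.inr (𝟙 A))⟦m⟧'

lemma acyclic_disc (X : C) (n : ℤ) : (disc X n).Acyclic := by
  refine acyclic_of_homotopy ((Cochain.equivHomotopy _ _).symm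
    ⟨Cochain.mk fun p q hpq => if h : q = n then ((disc X n).XIsoOfEq
      (show p = n + 1 by omega)).hom ≫ (doubleXIso₁ _ _ (int_ne_succ n)).hom ≫
        (doubleXIso₀ _ _).inv ≫ ((disc X n).XIsoOfEq h).inv else 0, ?_⟩)
  ext p
  obtain ⟨q, hq⟩ : ∃ q, q = p - 1 := ⟨_, rfl⟩
  rw [Cochain.ofHom_zero, add_zero,
    δ_v (-1) 0 (by omega) _ p p (by omega) q (p + 1) hq rfl]
  simp only [Cochain.ofHom_v, id_f, Cochain.mk_v, Int.negOnePow_zero, one_smul]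
  by_cases h₀ : p = n
  · subst h₀
    rw [dif_neg (by omega), dif_pos rfl, double_d _ _ (int_ne_succ p)]
    simp
  · by_cases h₁ : p = n + 1
    · subst h₁
      rw [dif_neg h₀, comp_zero, add_zero]
      obtain rfl : q = n := by omega
      rw [dif_pos rfl, double_d _ _ (int_ne_succ q)]
      simp
    · exact (isZero_double_X _ _ _ h₀ h₁).eq_of_src _ _

lemma mono_discInclusion [HasSeparator C] (x : Subobject (separator C) × ℤ) :
    Mono (discInclusion C x) := by
  have h₀ : Mono ((discInclusion C x).f x.2) := by
    rw [discInclusion, fromDisc_f]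
    infer_instance
  apply mono_of_mono_f
  intro i
  by_cases h : i = x.2
  · subst h; exact h₀
  by_cases h' : i = x.2 + 1
  · subst h'
    have := (discInclusion C x).comm x.2 (x.2 + 1)
    rw [double_d _ _ (int_ne_succ _), double_d _ _ (int_ne_succ _)] at this
    have h₁ : (discInclusion C x).f (x.2 + 1) = (doubleXIso₁ _ _ (int_ne_succ _)).hom ≫
        (doubleXIso₀ _ _).inv ≫ (discInclusion C x).f x.2 ≫ (doubleXIso₀ _ _).hom ≫
          (doubleXIso₁ _ _ (int_ne_succ _)).inv := by
      simp at this
      simp [this]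
    rw [h₁]
    infer_instance
  · exact ⟨fun _ _ _ => (isZero_double_X _ _ _ h h').eq_of_tgt _ _⟩

lemma mono_coneInclusion (A : CochainComplex C ℤ) (m : ℤ) : Mono (coneInclusion A m) := by
  apply mono_of_mono_f
  intro i
  have h : Mono ((CochainComplex.mappingCone.inr (𝟙 A)).f (i + m)) :=
    mono_of_mono_fac (CochainComplex.mappingCone.inr_f_snd_v (𝟙 A) (i + m))
  exact h

variable [IsGrothendieckAbelian.{w} C]

variable (C) in
/-- The generating monomorphisms between acyclic complexes. -/
def acyclicGenerators : MorphismProperty (CochainComplex C ℤ) :=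
  MorphismProperty.ofHoms (discInclusion C) ⊔
    MorphismProperty.ofHoms (fun x : { a : CoverComplexIndex.{w} C //
        (coverComplex a).Acyclic } × ℤ =>
      coneInclusion (coverComplex x.1.1) x.2)

lemma acyclicGenerators_spec ⦃X Y : CochainComplex C ℤ⦄ (j : X ⟶ Y)
    (hj : acyclicGenerators.{w} C j) : Mono j ∧ X.Acyclic ∧ Y.Acyclic := by
  rcases hj with hj | hj <;> obtain ⟨x⟩ := hj
  · exact ⟨mono_discInclusion x, acyclic_disc _ _, acyclic_disc _ _⟩
  · exact ⟨mono_coneInclusion _ _, acyclic_shift x.1.2 _, acyclic_shift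
      (acyclic_of_homotopy (CochainComplex.mappingCone.homotopyToZeroOfId _)) _⟩

instance : MorphismProperty.IsSmall.{w} (acyclicGenerators.{w} C) := by
  -- The index type lives in a larger universe because of the differentials, but morphisms in `C`
  -- form `w`-small sets.
  have : Small.{w} (CoverComplexIndex.{w} C) := inferInstance
  constructor
  have h₁ := MorphismProperty.isSmall_ofHoms.{w} (discInclusion C)
  have h₂ := MorphismProperty.isSmall_ofHoms.{w}
    (fun x : { a : CoverComplexIndex.{w} C // (coverComplex a).Acyclic } × ℤ =>
      coneInclusion (coverComplex x.1.1) x.2)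
  have := h₁.small_toSet
  have := h₂.small_toSet
  exact small_union (MorphismProperty.toSet (MorphismProperty.ofHoms (discInclusion C)))
    (MorphismProperty.toSet (MorphismProperty.ofHoms
      (fun x : { a : CoverComplexIndex.{w} C // (coverComplex a).Acyclic } × ℤ =>
        coneInclusion (coverComplex x.1.1) x.2)))

instance : MorphismProperty.HasSmallObjectArgument.{w} (acyclicGenerators.{w} C) :=
  hasSmallObjectArgument_of_mono _ (fun _ _ j hj => (acyclicGenerators_spec j hj).1)

/-- The complexes with the right lifting property with respect to `acyclicGenerators`. -/
def Fibrant (F : CochainComplex C ℤ) : Prop :=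
  (acyclicGenerators.{w} C).rlp (0 : F ⟶ 0)

lemma Fibrant.exists_extension {F : CochainComplex C ℤ} (hF : Fibrant.{w} F)
    {X Y : CochainComplex C ℤ} (j : X ⟶ Y) (hj : (acyclicGenerators.{w} C).rlp.llp j)
    (f : X ⟶ F) : ∃ g : Y ⟶ F, j ≫ g = f := by
  have := hj _ hF
  have sq : CommSq f j (0 : F ⟶ 0) 0 := ⟨by simp⟩
  exact ⟨sq.lift, sq.fac_left⟩

/-- Baer's criterion: the inclusions of subobjects of the separator generate all monomorphisms. -/
lemma injective_of_extends {Q : C} (h : ∀ (U : Subobject (separator C)) (f : (U : C) ⟶ Q),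
    ∃ g, U.arrow ≫ g = f) : Injective Q := by
  rw [injective_iff_rlp_monomorphisms_zero,
    ← IsGrothendieckAbelian.generatingMonomorphisms_rlp (isSeparator_separator C)]
  rintro _ _ _ ⟨U⟩
  refine ⟨fun {f g} sq => ?_⟩
  obtain ⟨g, hg⟩ := h U f
  exact ⟨⟨⟨g, hg, (isZero_zero C).eq_of_tgt _ _⟩⟩⟩

lemma Fibrant.injective {F : CochainComplex C ℤ} (hF : Fibrant.{w} F) (n : ℤ) :
    Injective (F.X n) := by
  apply injective_of_extends
  intro U f
  obtain ⟨g, hg⟩ := hF.exists_extension (discInclusion C (U, n))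
    (MorphismProperty.le_llp_rlp _ _ (Or.inl ⟨_⟩)) (fromDisc f)
  refine ⟨(doubleXIso₀ _ _).inv ≫ g.f n, ?_⟩
  have := congr_arg (fun φ => (doubleXIso₀ _ _).inv ≫ φ.f n) hg
  simpa [discInclusion] using this

/-- An extension of a morphism to the cone of the identity is a null-homotopy. The generators
contain all shifts of the cone inclusions, so a shift of the target can be moved to the source. -/
lemma Fibrant.nonempty_homotopy {F : CochainComplex C ℤ} (hF : Fibrant.{w} F) (m : ℤ)
    (a : CoverComplexIndex.{w} C) (ha : (coverComplex a).Acyclic) (f : coverComplex a ⟶ F⟦m⟧) :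
    Nonempty (Homotopy f 0) := by
  let e : (F⟦m⟧)⟦-m⟧ ≅ F := (shiftEquiv (CochainComplex C ℤ) m).unitIso.symm.app F
  obtain ⟨g, hg⟩ := hF.exists_extension (coneInclusion (coverComplex a) (-m))
    (MorphismProperty.le_llp_rlp _ _ (Or.inr ⟨(⟨⟨a, ha⟩, -m⟩ :
      { a : CoverComplexIndex.{w} C // (coverComplex a).Acyclic } × ℤ)⟩)) (f⟦-m⟧' ≫ e.hom)
  obtain ⟨g', hg'⟩ := (shiftFunctor (CochainComplex C ℤ) (-m)).map_surjective (g ≫ e.inv)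
  have hf : f = CochainComplex.mappingCone.inr (𝟙 (coverComplex a)) ≫ g' := by
    apply (shiftFunctor (CochainComplex C ℤ) (-m)).map_injective
    rw [Functor.map_comp, hg']
    change _ = coneInclusion _ _ ≫ _
    rw [reassoc_of% hg]
    simp
  rw [hf]
  exact ⟨(Homotopy.ofEq (by simp)).trans ((((CochainComplex.mappingCone.homotopyToZeroOfId
    (coverComplex a)).compLeft (CochainComplex.mappingCone.inr (𝟙 (coverComplex a)))).compRight
      g').trans (Homotopy.ofEq (by simp)))⟩

/-- Resolve the quotient of the separator to the left by a small acyclic complex that ends with it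
in degree zero, together with a chain map to `F` that is `v` there. The degree zero part of a
null-homotopy of this chain map is the lift. -/
lemma exists_lift_of_homotopy {F : CochainComplex C ℤ} (hF : F.Acyclic)
    (h : ∀ (a : CoverComplexIndex.{w} C) (_ : (coverComplex a).Acyclic) (f : coverComplex a ⟶ F),
      Nonempty (Homotopy f 0)) (U : Subobject (separator C))
    (v : cokernel U.arrow ⟶ F.X 0) (hv : v ≫ F.d 0 1 = 0) :
    ∃ v' : cokernel U.arrow ⟶ F.X (-1), v' ≫ F.d (-1) 0 = v := by
  let s : CoverState.{w} F 0 :=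
    { src := quotIndex U
      tgt := zeroIndex C
      f := 0
      ψ := (quotIndexIso U).hom ≫ v
      hψ := fun j => by
        have hj : v ≫ F.d 0 j = 0 := by
          by_cases hj : j = 1
          · subst hj; exact hv
          · rw [F.shape _ _ (by simp; omega), comp_zero]
        change _ ≫ ((quotIndexIso U).hom ≫ v) ≫ F.d 0 j = 0
        rw [Category.assoc, hj, comp_zero, comp_zero] }
  have hs : s.ψ ≫ F.d 0 1 = 0 := by
    change ((quotIndexIso U).hom ≫ v) ≫ F.d 0 1 = 0
    rw [Category.assoc, hv, comp_zero]
  obtain ⟨H⟩ := h (s.complexIndex hF) (s.acyclic hF isZero_coverObj_zeroIndex) (s.hom hF hs)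
  have h₀ := H.comm 0
  -- The differential of the resolution that leaves degree zero is zero, so only the component `H 0
  -- (-1)` of the homotopy contributes.
  have h₁ : dNext 0 H.hom = 0 := by
    rw [dNext_eq H.hom (show (ComplexShape.up ℤ).Rel 0 1 by simp)]
    exact (congrArg (fun t => t ≫ H.hom 1 0) (CochainComplex.of_d
      (fun i => coverObj (CoverState.index hF s i)) (CoverState.diff hF s) 0)).trans zero_comp
  rw [h₁, prevD_eq H.hom (show (ComplexShape.up ℤ).Rel (-1) 0 by simp), zero_add, zero_f,
    add_zero] at h₀
  let H' : coverObj (quotIndex.{w} U) ⟶ F.X (-1) := H.hom 0 (-1)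
  have h₂ : (quotIndexIso.{w} U).hom ≫ v = H' ≫ F.d (-1) 0 := h₀
  exact ⟨(quotIndexIso U).inv ≫ H', by rw [Category.assoc, ← h₂, Iso.inv_hom_id_assoc]⟩

lemma Fibrant.exists_lift {F : CochainComplex C ℤ} (hF : Fibrant.{w} F) (hF' : F.Acyclic)
    (U : Subobject (separator C)) (p q : ℤ) (hpq : p + 1 = q)
    (v : cokernel U.arrow ⟶ F.X q) (hv : v ≫ F.d q (q + 1) = 0) :
    ∃ v' : cokernel U.arrow ⟶ F.X p, v' ≫ F.d p q = v := by
  obtain ⟨n, rfl⟩ : ∃ n, q = 0 + n := ⟨q, by omega⟩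
  obtain rfl : p = -1 + n := by omega
  -- The statement in degree zero is applied to the shift of `F` by `n`, whose differential carries
  -- the sign `(-1) ^ n`.
  have hv' : v ≫ (n.negOnePow • F.d (0 + n) (1 + n)) = 0 := by
    rw [show 1 + n = 0 + n + 1 by omega, Linear.comp_units_smul, hv, smul_zero]
  obtain ⟨v', hv'⟩ : ∃ v' : cokernel U.arrow ⟶ F.X (-1 + n),
      v' ≫ (n.negOnePow • F.d (-1 + n) (0 + n)) = v :=
    exists_lift_of_homotopy (acyclic_shift hF' n)
      (fun a ha f => hF.nonempty_homotopy n a ha f) U v hv'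
  refine ⟨n.negOnePow • v', ?_⟩
  rw [Linear.units_smul_comp, ← Linear.comp_units_smul]
  exact hv'

/-- Extend `f` to `g : G → F.X n` on the separator `G`, by injectivity of the terms. The obstruction
to landing in the cycles is `g ≫ d`, a cocycle on the quotient `G / U`. It is the boundary of some
`v'` on that quotient, and subtracting `v'` does not change the restriction to `U`. -/
lemma Fibrant.injective_cycles {F : CochainComplex C ℤ} (hF : Fibrant.{w} F) (hF' : F.Acyclic)
    (n : ℤ) : Injective (F.cycles n) := by
  apply injective_of_extends
  intro U f
  have := hF.injective n
  let g := Injective.factorThru (f ≫ F.iCycles n) U.arrow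
  have hg : U.arrow ≫ g = f ≫ F.iCycles n := Injective.comp_factorThru _ _
  obtain ⟨v', hv'⟩ := hF.exists_lift hF' U n (n + 1) rfl
    (cokernel.desc U.arrow (g ≫ F.d n (n + 1)) (by rw [reassoc_of% hg]; simp))
    (by simp [← cancel_epi (cokernel.π U.arrow)])
  refine ⟨F.liftCycles (g - cokernel.π _ ≫ v') (n + 1) (by simp) ?_, ?_⟩
  · rw [Preadditive.sub_comp, Category.assoc, hv', cokernel.π_desc, sub_self]
  · rw [← cancel_mono (F.iCycles n)]
    simp [Preadditive.comp_sub, hg]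

/-- Embed an acyclic `K` in a fibrant complex `Z` by a morphism of the left class. Then `Z` is again
acyclic, hence contractible, and every morphism from `K` to `I` factors through `Z`. -/
lemma Fibrant.isKInjective {I : CochainComplex C ℤ} (hI : Fibrant.{w} I) : I.IsKInjective where
  nonempty_homotopy_zero {K} f hK := by
    have := IsGrothendieckAbelian.enoughInjectives.{w} (C := C)
    let φ := MorphismProperty.factorizationData (acyclicGenerators.{w} C).rlp.llp
      (acyclicGenerators.{w} C).rlp (0 : K ⟶ 0)
    have hφ : QuasiIso φ.i := quasiIso_of_llp_rlp _ acyclicGenerators_spec _ φ.hi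
    have hZ : Fibrant.{w} φ.Z := by
      rw [Fibrant, show (0 : φ.Z ⟶ 0) = φ.p from (isZero_zero _).eq_of_tgt _ _]
      exact φ.hp
    have hZ' : φ.Z.Acyclic := fun n => by
      rw [exactAt_iff_isZero_homology]
      exact ((exactAt_iff_isZero_homology _ _).1 (hK n)).of_iso
        (asIso (homologyMap φ.i n)).symm
    obtain ⟨h⟩ := nonempty_contraction hZ' (hZ.injective_cycles hZ')
    obtain ⟨g, rfl⟩ := hI.exists_extension _ φ.hi f
    exact ⟨(Homotopy.ofEq (by simp)).trans (((h.compLeft φ.i).compRight g).trans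
      (Homotopy.ofEq (by simp)))⟩

/-- Every complex over a Grothendieck category has a K-injective resolution. -/
theorem exists_kInjective_resolution (K : CochainComplex C ℤ) :
    ∃ (I : CochainComplex C ℤ) (i : K ⟶ I), QuasiIso i ∧ I.IsKInjective := by
  have := IsGrothendieckAbelian.enoughInjectives.{w} (C := C)
  let φ := MorphismProperty.factorizationData (acyclicGenerators.{w} C).rlp.llp
    (acyclicGenerators.{w} C).rlp (0 : K ⟶ 0)
  have hZ : Fibrant.{w} φ.Z := by
    rw [Fibrant, show (0 : φ.Z ⟶ 0) = φ.p from (isZero_zero _).eq_of_tgt _ _]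
    exact φ.hp
  exact ⟨φ.Z, φ.i, quasiIso_of_llp_rlp _ acyclicGenerators_spec _ φ.hi, hZ.isKInjective⟩

end KInjectiveResolutions

/-! ### Koszul sign involutions. -/

section Signs

variable {k : Type*} {A : Type*} [CommRing k] [Ring A] [Algebra k A]
  (𝒜 : ℤ → Submodule k A) [GradedAlgebra 𝒜]

/-- Two linear maps which agree on homogeneous elements are equal. -/
lemma linearMap_ext_of_homogeneous {Y : Type*} [AddCommGroup Y] [Module k Y] {f g : A →ₗ[k] Y}
    (h : ∀ i, ∀ a ∈ 𝒜 i, f a = g a) : f = g := by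
  ext a
  induction a using DirectSum.Decomposition.inductionOn 𝒜 with
  | zero => simp
  | @homogeneous i m => exact h i m m.2
  | add m m' h h' => rw [map_add, map_add, h, h']

lemma koszulSign_mem (j : ℤ) {i : ℤ} {a : A} (ha : a ∈ 𝒜 i) : koszulSign 𝒜 j a ∈ 𝒜 i := by
  rw [koszulSign_of_mem 𝒜 j ha]
  exact zsmul_mem ha _

lemma koszulSign_add (j j' : ℤ) (a : A) :
    koszulSign 𝒜 (j + j') a = koszulSign 𝒜 j (koszulSign 𝒜 j' a) := by
  have : koszulSign 𝒜 (j + j') = koszulSign 𝒜 j ∘ₗ koszulSign 𝒜 j' := by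
    refine linearMap_ext_of_homogeneous 𝒜 fun i a ha => ?_
    rw [LinearMap.comp_apply, koszulSign_of_mem 𝒜 _ ha,
      koszulSign_of_mem 𝒜 j (koszulSign_mem 𝒜 _ ha), koszulSign_of_mem 𝒜 _ ha, smul_smul,
      add_mul, Int.negOnePow_add, Units.val_mul]
  exact LinearMap.congr_fun this a

lemma koszulSign_of_even {j : ℤ} (hj : Even j) (a : A) : koszulSign 𝒜 j a = a := by
  have : koszulSign 𝒜 j = LinearMap.id := by
    refine linearMap_ext_of_homogeneous 𝒜 fun i a ha => ?_
    rw [koszulSign_of_mem 𝒜 _ ha, Int.negOnePow_even _ (hj.mul_right i)]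
    simp
  rw [this, LinearMap.id_apply]

lemma koszulSign_one_mul (a b : A) :
    koszulSign 𝒜 1 (a * b) = koszulSign 𝒜 1 a * koszulSign 𝒜 1 b := by
  have : (LinearMap.mul k A).compr₂ (koszulSign 𝒜 1) =
      (LinearMap.mul k A).compl₁₂ (koszulSign 𝒜 1) (koszulSign 𝒜 1) := by
    refine linearMap_ext_of_homogeneous 𝒜 fun i a ha => ?_
    refine linearMap_ext_of_homogeneous 𝒜 fun j b hb => ?_
    simp only [LinearMap.compr₂_apply, LinearMap.mul_apply', LinearMap.compl₁₂_apply]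
    rw [koszulSign_of_mem 𝒜 1 (SetLike.mul_mem_graded ha hb), koszulSign_of_mem 𝒜 1 ha,
      koszulSign_of_mem 𝒜 1 hb, smul_mul_smul_comm]
    simp [Int.negOnePow_add]
  exact LinearMap.congr_fun₂ this a b

/-- The Hochschild sign in degree `2 - n` depends only on the parity of `n`, while the bar
construction produces it as `n` applications of the sign involution. -/
lemma koszulSign_pow (n : ℕ) (a : A) :
    koszulSign 𝒜 (2 - (n : ℤ)) a = ((koszulSign 𝒜 1) ^ n) a := by
  have h : ∀ n : ℕ, ((koszulSign 𝒜 1) ^ n) a = koszulSign 𝒜 n a := by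
    intro n
    induction n with
    | zero => simp [koszulSign_of_even 𝒜 (show Even (0 : ℤ) by simp)]
    | succ n ih =>
      rw [pow_succ', Module.End.mul_apply, ih, ← koszulSign_add]
      congr 2
      push_cast
      ring
  rw [h, show (2 : ℤ) - n = (2 - n - n) + n by ring, koszulSign_add, koszulSign_of_even]
  exact ⟨1 - n, by ring⟩

end Signs

namespace DGAlgebra

variable {k : Type t} [CommRing k] (B : DGAlgebra.{w} k)

/-- The sign involution of a DG-algebra. -/
def sgn : B.carrier →ₗ[k] B.carrier := koszulSign B.gr 1

lemma sgn_of_mem {i : ℤ} {a : B.carrier} (ha : a ∈ B.gr i) : B.sgn a = (i.negOnePow : ℤ) • a := by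
  rw [sgn, koszulSign_of_mem _ _ ha, one_mul]

lemma sgn_mem {i : ℤ} {a : B.carrier} (ha : a ∈ B.gr i) : B.sgn a ∈ B.gr i :=
  koszulSign_mem _ _ ha

@[simp] lemma sgn_sgn (a : B.carrier) : B.sgn (B.sgn a) = a := by
  rw [sgn, ← koszulSign_add, koszulSign_of_even _ (by decide)]

lemma sgn_mul (a b : B.carrier) : B.sgn (a * b) = B.sgn a * B.sgn b := koszulSign_one_mul _ a b

@[simp] lemma sgn_one : B.sgn 1 = 1 := by
  rw [B.sgn_of_mem SetLike.GradedOne.one_mem]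
  simp

lemma d_sgn (a : B.carrier) : B.d (B.sgn a) = -B.sgn (B.d a) := by
  have : B.d ∘ₗ B.sgn = -(B.sgn ∘ₗ B.d) := by
    refine linearMap_ext_of_homogeneous B.gr fun i a ha => ?_
    rw [LinearMap.comp_apply, LinearMap.neg_apply, LinearMap.comp_apply, B.sgn_of_mem ha,
      B.sgn_of_mem (B.d_mem ha), map_zsmul, Int.negOnePow_succ, Units.val_neg, neg_smul, neg_neg]
  exact LinearMap.congr_fun this a

lemma d_mul (a b : B.carrier) : B.d (a * b) = B.d a * b + B.sgn a * B.d b := by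
  induction a using DirectSum.Decomposition.inductionOn B.gr with
  | zero => simp
  | @homogeneous i m => rw [B.leibniz m.2, B.sgn_of_mem m.2, smul_mul_assoc]
  | add m m' h h' => rw [add_mul, map_add, h, h', map_add, map_add]; noncomm_ring

end DGAlgebra

/-! ### Induction and recursion on the first letter in a tensor algebra. -/

section TensorAlgebraRecursion

variable {k : Type*} [CommRing k] {V : Type*} [AddCommGroup V] [Module k V]

open TensorAlgebra

lemma tensorAlgebra_left_induction {p : TensorAlgebra k V → Prop} (one : p 1)
    (add : ∀ a b, p a → p b → p (a + b)) (smul : ∀ (c : k) a, p a → p (c • a))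
    (cons : ∀ x w, p w → p (ι k x * w)) (w : TensorAlgebra k V) : p w := by
  let S : Subalgebra k (TensorAlgebra k V) :=
    { carrier := {a | ∀ w, p w → p (a * w)}
      mul_mem' := fun {a b} ha hb w hw => by rw [mul_assoc]; exact ha _ (hb _ hw)
      add_mem' := fun {a b} ha hb w hw => by rw [add_mul]; exact add _ _ (ha _ hw) (hb _ hw)
      algebraMap_mem' := fun r w hw => by rw [← Algebra.smul_def]; exact smul _ _ hw }
  have hS : S = ⊤ := by
    rw [eq_top_iff, ← adjoin_range_ι, Algebra.adjoin_le_iff]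
    rintro _ ⟨x, rfl⟩ w hw
    exact cons x w hw
  have : w ∈ S := hS ▸ Algebra.mem_top
  simpa using this 1 one

variable {Y : Type*} [AddCommGroup Y] [Module k Y]

lemma tensorAlgebra_hom_ext {f g : TensorAlgebra k V →ₗ[k] Y} (one : f 1 = g 1)
    (cons : ∀ x w, f w = g w → f (ι k x * w) = g (ι k x * w)) : f = g := by
  ext w
  induction w using tensorAlgebra_left_induction with
  | one => exact one
  | add a b ha hb => rw [map_add, map_add, ha, hb]
  | smul c a ha => rw [map_smul, map_smul, ha]
  | cons x w hw => exact cons x w hw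

/-- The linear map on the tensor algebra with value `y` at `1` and
`r (x * w) = a x w + c x (r w)` for `x` in the module. -/
def tensorRec (y : Y) (a : V →ₗ[k] TensorAlgebra k V →ₗ[k] Y) (c : V →ₗ[k] Y →ₗ[k] Y) :
    TensorAlgebra k V →ₗ[k] Y :=
  -- A letter acts on pairs consisting of a word and the value at that word. The first component is
  -- what lets the term `a x w` see the rest of the word.
  LinearMap.snd k _ Y ∘ₗ (LinearMap.applyₗ ((1 : TensorAlgebra k V), y)) ∘ₗ
    (lift k (A := Module.End k (TensorAlgebra k V × Y))
      { toFun := fun x => LinearMap.prod (LinearMap.mulLeft k (ι k x) ∘ₗ LinearMap.fst k _ Y)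
          (LinearMap.coprod (a x) (c x))
        map_add' := fun x x' => by
          ext <;> simp [add_mul]
        map_smul' := fun r x => by
          ext <;> simp }).toLinearMap

lemma tensorRec_one (y : Y) (a : V →ₗ[k] TensorAlgebra k V →ₗ[k] Y) (c : V →ₗ[k] Y →ₗ[k] Y) :
    tensorRec y a c 1 = y := by
  simp [tensorRec]

lemma tensorRec_cons (y : Y) (a : V →ₗ[k] TensorAlgebra k V →ₗ[k] Y) (c : V →ₗ[k] Y →ₗ[k] Y)
    (x : V) (w : TensorAlgebra k V) :
    tensorRec y a c (ι k x * w) = a x w + c x (tensorRec y a c w) := by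
  have key : ∀ (g : V →ₗ[k] Module.End k (TensorAlgebra k V × Y)),
      (∀ x p, (g x p).1 = ι k x * p.1) → ∀ w, (lift k g w (1, y)).1 = w := by
    intro g hg w
    induction w using tensorAlgebra_left_induction with
    | one => simp
    | add a b ha hb => simp [ha, hb]
    | smul c a ha => simp [ha]
    | cons x w hw => simp [hg, hw]
  simp only [tensorRec, LinearMap.comp_apply, AlgHom.toLinearMap_apply, map_mul, lift_ι_apply,
    LinearMap.applyₗ_apply_apply, Module.End.mul_apply]
  refine congrArg (fun t => a x t + _) (key _ (by simp) w)

end TensorAlgebraRecursion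

/-! ### The bar differential, its twisted version, and curvature. -/

section BarOperators

open TensorAlgebra TensorProduct

variable {k : Type t} [CommRing k] (B : DGAlgebra.{w} k)

/-- The tensor algebra on the underlying module of a DG-algebra. -/
abbrev Bar : Type _ := TensorAlgebra k B.carrier

/-- Left multiplication with a letter. -/
def consMap : B.carrier →ₗ[k] Bar B →ₗ[k] Bar B := LinearMap.mul k (Bar B) ∘ₗ ι k

@[simp] lemma consMap_apply (x : B.carrier) (w : Bar B) : consMap B x w = ι k x * w := rfl

/-- Multiplication with the first letter of a word. -/
def firstMul : B.carrier →ₗ[k] Bar B →ₗ[k] Bar B :=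
  (tensorRec (0 : B.carrier →ₗ[k] Bar B)
    (LinearMap.mk₂ k (fun y w => LinearMap.mulRight k w ∘ₗ ι k ∘ₗ LinearMap.mulRight k y)
      (fun _ _ _ => by ext; simp [mul_add, add_mul]) (fun _ _ _ => by ext; simp)
      (fun _ _ _ => by ext; simp [mul_add]) (fun _ _ _ => by ext; simp)) 0).flip

@[simp] lemma firstMul_one (x : B.carrier) : firstMul B x 1 = 0 := by
  simp [firstMul, tensorRec_one]

@[simp] lemma firstMul_cons (x y : B.carrier) (w : Bar B) :
    firstMul B x (ι k y * w) = ι k (x * y) * w := by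
  simp [firstMul, tensorRec_cons]

lemma firstMul_firstMul (x y : B.carrier) (w : Bar B) :
    firstMul B x (firstMul B y w) = firstMul B (x * y) w := by
  have : firstMul B x ∘ₗ firstMul B y = firstMul B (x * y) :=
    tensorAlgebra_hom_ext (by simp) (fun z w _ => by simp [mul_assoc])
  exact LinearMap.congr_fun this w

/-- The part of the bar differential which comes from the differential. -/
def barD₁ : Bar B →ₗ[k] Bar B := tensorRec 0 (-(consMap B ∘ₗ B.d)) (-(consMap B ∘ₗ B.sgn))

@[simp] lemma barD₁_one : barD₁ B 1 = 0 := tensorRec_one _ _ _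

lemma barD₁_cons (x : B.carrier) (w : Bar B) :
    barD₁ B (ι k x * w) = -(ι k (B.d x) * w) - ι k (B.sgn x) * barD₁ B w := by
  rw [barD₁, tensorRec_cons, sub_eq_add_neg]
  rfl

/-- The part of the bar differential which comes from the product. -/
def barD₂ : Bar B →ₗ[k] Bar B := tensorRec 0 (firstMul B ∘ₗ B.sgn) (-(consMap B ∘ₗ B.sgn))

@[simp] lemma barD₂_one : barD₂ B 1 = 0 := tensorRec_one _ _ _

lemma barD₂_cons (x : B.carrier) (w : Bar B) :
    barD₂ B (ι k x * w) = firstMul B (B.sgn x) w - ι k (B.sgn x) * barD₂ B w := by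
  rw [barD₂, tensorRec_cons, sub_eq_add_neg]
  rfl

/-- The sign automorphism of the tensor algebra for letters of degree `|x| - 1`. -/
def barSgn : Bar B →ₐ[k] Bar B := lift k (-(ι k ∘ₗ B.sgn))

@[simp] lemma barSgn_ι (x : B.carrier) : barSgn B (ι k x) = -ι k (B.sgn x) := by
  simp [barSgn]

lemma barSgn_cons (x : B.carrier) (w : Bar B) :
    barSgn B (ι k x * w) = -(ι k (B.sgn x) * barSgn B w) := by
  rw [map_mul, barSgn_ι, neg_mul]

variable (E : DGAlgebra.{v} k)

/-- The free right module on the tensor algebra. -/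
abbrev BarTensor : Type _ := Bar B ⊗[k] E.carrier

/-- Left multiplication with a letter. -/
def consT : B.carrier →ₗ[k] BarTensor B E →ₗ[k] BarTensor B E :=
  LinearMap.rTensorHom E.carrier ∘ₗ consMap B

@[simp] lemma consT_tmul (x : B.carrier) (w : Bar B) (e : E.carrier) :
    consT B E x (w ⊗ₜ e) = (ι k x * w) ⊗ₜ e := rfl

/-- Multiplication with the first letter. -/
def firstMulT : B.carrier →ₗ[k] BarTensor B E →ₗ[k] BarTensor B E :=
  LinearMap.rTensorHom E.carrier ∘ₗ firstMul B

@[simp] lemma firstMulT_tmul (x : B.carrier) (w : Bar B) (e : E.carrier) :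
    firstMulT B E x (w ⊗ₜ e) = firstMul B x w ⊗ₜ e := rfl

/-- Right multiplication with an element of the coefficient algebra. -/
def rightT : E.carrier →ₗ[k] BarTensor B E →ₗ[k] BarTensor B E :=
  LinearMap.lTensorHom (Bar B) ∘ₗ (LinearMap.mul k E.carrier).flip

@[simp] lemma rightT_tmul (e : E.carrier) (w : Bar B) (e' : E.carrier) :
    rightT B E e (w ⊗ₜ e') = w ⊗ₜ (e' * e) := rfl

/-- The sign automorphism. -/
def sgnT : BarTensor B E →ₗ[k] BarTensor B E :=
  TensorProduct.map (barSgn B).toLinearMap E.sgn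

@[simp] lemma sgnT_tmul (w : Bar B) (e : E.carrier) :
    sgnT B E (w ⊗ₜ e) = barSgn B w ⊗ₜ E.sgn e := rfl

variable {B E}

lemma barTensor_induction {p : BarTensor B E → Prop} (one : ∀ e, p (1 ⊗ₜ e))
    (add : ∀ a b, p a → p b → p (a + b))
    (cons : ∀ x q, p q → p (consT B E x q)) (q : BarTensor B E) : p q := by
  induction q using TensorProduct.induction_on with
  | zero => simpa using one 0
  | add a b ha hb => exact add a b ha hb
  | tmul w e =>
    induction w using tensorAlgebra_left_induction generalizing e with
    | one => exact one e
    | add a b ha hb => rw [TensorProduct.add_tmul]; exact add _ _ (ha e) (hb e)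
    | smul c a ha => rw [TensorProduct.smul_tmul]; exact ha _
    | cons x w hw => exact cons x _ (hw e)

@[simp] lemma firstMulT_cons (x y : B.carrier) (q : BarTensor B E) :
    firstMulT B E x (consT B E y q) = consT B E (x * y) q := by
  induction q using TensorProduct.induction_on with
  | zero => simp
  | add a b ha hb => simp [ha, hb]
  | tmul w e => simp

@[simp] lemma firstMulT_one (x : B.carrier) (e : E.carrier) :
    firstMulT B E x (1 ⊗ₜ e) = 0 := by simp

lemma firstMulT_firstMulT (x y : B.carrier) (q : BarTensor B E) :
    firstMulT B E x (firstMulT B E y q) = firstMulT B E (x * y) q := by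
  induction q using TensorProduct.induction_on with
  | zero => simp
  | add a b ha hb => simp [ha, hb]
  | tmul w e => simp [firstMul_firstMul]

variable (τ : Bar B →ₗ[k] E.carrier)

/-- The extension of a linear map to the free right module. -/
def hatMap : BarTensor B E →ₗ[k] E.carrier :=
  TensorProduct.lift (LinearMap.mul k E.carrier ∘ₗ τ)

@[simp] lemma hatMap_tmul (w : Bar B) (e : E.carrier) : hatMap τ (w ⊗ₜ e) = τ w * e := rfl

/-- The differential on the free right module which is defined by a twisting cochain. -/
def twistedD : BarTensor B E →ₗ[k] BarTensor B E :=
  TensorProduct.lift (tensorRec (TensorProduct.mk k (Bar B) E.carrier 1 ∘ₗ E.d)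
    (LinearMap.mk₂ k (fun x w =>
      TensorProduct.mk k (Bar B) E.carrier (firstMul B (B.sgn x) w - ι k (B.d x) * w) +
        TensorProduct.mk k (Bar B) E.carrier 1 ∘ₗ LinearMap.mul k E.carrier (τ (ι k x * w)))
      (fun _ _ _ => by ext; simp [add_mul, TensorProduct.tmul_add]; abel)
      (fun _ _ _ => by ext; simp [← smul_sub])
      (fun _ _ _ => by ext; simp [mul_add, TensorProduct.tmul_add]; abel)
      (fun _ _ _ => by ext; simp [← smul_sub]))
    ((LinearMap.llcomp k E.carrier (BarTensor B E) (BarTensor B E) : _ →ₗ[k] _) ∘ₗ consT B E ∘ₗ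
    (-B.sgn)))

@[simp] lemma twistedD_one (e : E.carrier) : twistedD τ (1 ⊗ₜ e) = 1 ⊗ₜ E.d e := by
  simp [twistedD, tensorRec_one]

lemma twistedD_cons (x : B.carrier) (q : BarTensor B E) :
    twistedD τ (consT B E x q) = firstMulT B E (B.sgn x) q - consT B E (B.d x) q -
      consT B E (B.sgn x) (twistedD τ q) + 1 ⊗ₜ hatMap τ (consT B E x q) := by
  induction q using TensorProduct.induction_on with
  | zero => simp
  | add a b ha hb => simp only [map_add, ha, hb, TensorProduct.tmul_add]; abel
  | tmul w e =>
    simp [twistedD, tensorRec_cons]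
    abel

/-- This Leibniz rule for multiplication of the first letter, up to a term in the empty word, is
what later makes the action of `B` on the bar construction compatible with differentials. -/
lemma twistedD_firstMulT (x : B.carrier) (q : BarTensor B E) :
    twistedD τ (firstMulT B E x q) = firstMulT B E (B.sgn x) (twistedD τ q) -
      firstMulT B E (B.d x) q + 1 ⊗ₜ hatMap τ (firstMulT B E x q) := by
  induction q using barTensor_induction with
  | one e => simp
  | add a b ha hb => simp only [map_add, ha, hb, TensorProduct.tmul_add]; abel
  | cons y q hq =>
    simp only [firstMulT_cons, twistedD_cons, map_add, map_sub, firstMulT_one, firstMulT_firstMulT,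
      B.sgn_mul, B.d_mul, LinearMap.add_apply]
    abel

/-- The curvature of a cochain, on the free right module. -/
def curvT : BarTensor B E →ₗ[k] E.carrier := hatMap τ ∘ₗ twistedD τ + E.d ∘ₗ hatMap τ

lemma curvT_apply (q : BarTensor B E) :
    curvT τ q = hatMap τ (twistedD τ q) + E.d (hatMap τ q) := rfl

lemma curvT_twistedD (q : BarTensor B E) :
    curvT τ (twistedD τ q) = hatMap τ (twistedD τ (twistedD τ q)) + E.d (curvT τ q) := by
  simp [curvT_apply, E.d_d]

variable {τ}

/-- The bar terms cancel by associativity and the Leibniz rule in `B`. Only the terms in the empty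
word remain, and they assemble to the curvature: the twisted differential squares to zero exactly as
far as the Maurer-Cartan equation holds. -/
lemma twistedD_twistedD_cons (h₁ : τ 1 = 0) (x : B.carrier) (q : BarTensor B E) :
    twistedD τ (twistedD τ (consT B E x q)) =
      consT B E x (twistedD τ (twistedD τ q)) + 1 ⊗ₜ curvT τ (consT B E x q) := by
  have h : hatMap τ (1 ⊗ₜ hatMap τ (consT B E x q)) = 0 := by simp [h₁]
  rw [curvT_apply, twistedD_cons]
  simp only [map_add, map_sub, twistedD_cons, twistedD_firstMulT, B.d_sgn, B.d_d, B.sgn_sgn,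
    twistedD_one, h, map_zero, map_neg, LinearMap.neg_apply, LinearMap.zero_apply,
    TensorProduct.tmul_add, TensorProduct.tmul_sub, TensorProduct.tmul_zero]
  abel

lemma rightT_consT (e : E.carrier) (x : B.carrier) (q : BarTensor B E) :
    rightT B E e (consT B E x q) = consT B E x (rightT B E e q) := by
  induction q using TensorProduct.induction_on with
  | zero => simp
  | add a b ha hb => simp [ha, hb]
  | tmul w e => simp

lemma rightT_firstMulT (e : E.carrier) (x : B.carrier) (q : BarTensor B E) :
    rightT B E e (firstMulT B E x q) = firstMulT B E x (rightT B E e q) := by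
  induction q using TensorProduct.induction_on with
  | zero => simp
  | add a b ha hb => simp [ha, hb]
  | tmul w e => simp

lemma sgnT_consT (x : B.carrier) (q : BarTensor B E) :
    sgnT B E (consT B E x q) = -consT B E (B.sgn x) (sgnT B E q) := by
  induction q using TensorProduct.induction_on with
  | zero => simp
  | add a b ha hb => simp only [map_add, ha, hb]; abel
  | tmul w e => simp [barSgn_cons, TensorProduct.neg_tmul]

lemma hatMap_rightT (e : E.carrier) (q : BarTensor B E) :
    hatMap τ (rightT B E e q) = hatMap τ q * e := by
  induction q using TensorProduct.induction_on with
  | zero => simp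
  | add a b ha hb => simp [ha, hb, add_mul]
  | tmul w e => simp [mul_assoc]

/-- The twisted differential is a derivation over `E.d`. This reduces computations to elements `w ⊗
1`, and it shows which term must be added to obtain a right linear operator. -/
lemma twistedD_right (q : BarTensor B E) (e : E.carrier) :
    twistedD τ (rightT B E e q) =
      rightT B E e (twistedD τ q) + rightT B E (E.d e) (sgnT B E q) := by
  induction q using barTensor_induction with
  | one e' => simp [E.d_mul, TensorProduct.tmul_add]
  | add a b ha hb => simp only [map_add, ha, hb]; abel
  | cons x q hq =>
    rw [rightT_consT, twistedD_cons, hq, twistedD_cons]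
    simp only [map_add, map_sub, rightT_consT, rightT_firstMulT, sgnT_consT, map_neg, rightT_tmul,
      ← hatMap_rightT]
    abel

end BarOperators

/-! ### The grading by word length, the Bianchi identity, and the variation of the curvature. -/

section Length

open TensorAlgebra TensorProduct

variable {k : Type t} [CommRing k] (B : DGAlgebra.{w} k)

/-- The words of length `n`. -/
def barLen (n : ℕ) : Submodule k (Bar B) := LinearMap.range (ι k) ^ n

variable {B}

lemma one_mem_barLen : (1 : Bar B) ∈ barLen B 0 := by
  rw [barLen, pow_zero]
  exact Submodule.one_le.1 le_rfl

lemma ι_mem_barLen (x : B.carrier) : (ι k x : Bar B) ∈ barLen B 1 := by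
  rw [barLen, pow_one]
  exact ⟨x, rfl⟩

lemma cons_mem_barLen {n : ℕ} (x : B.carrier) {w : Bar B} (hw : w ∈ barLen B n) :
    ι k x * w ∈ barLen B (n + 1) := by
  rw [barLen, pow_succ']
  exact Submodule.mul_mem_mul ⟨x, rfl⟩ hw

lemma barLen_zero_induction {p : Bar B → Prop} (one : p 1) (smul : ∀ (c : k) a, p a → p (c • a))
    {w : Bar B} (hw : w ∈ barLen B 0) : p w := by
  rw [barLen, pow_zero, Submodule.mem_one] at hw
  obtain ⟨c, rfl⟩ := hw
  rw [Algebra.algebraMap_eq_smul_one]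
  exact smul _ _ one

lemma barLen_succ_induction {n : ℕ} {p : Bar B → Prop}
    (cons : ∀ (x : B.carrier), ∀ w ∈ barLen B n, p (ι k x * w))
    (add : ∀ a b, p a → p b → p (a + b)) {w : Bar B} (hw : w ∈ barLen B (n + 1)) : p w := by
  rw [barLen, pow_succ'] at hw
  refine Submodule.mul_induction_on hw ?_ add
  rintro _ ⟨x, rfl⟩ w hw
  exact cons x w hw

/-- A linear map preserves length if it does so recursively. -/
lemma barLen_map_le {f : Bar B →ₗ[k] Bar B} (one : f 1 ∈ barLen B 0)
    (cons : ∀ (n : ℕ) (x : B.carrier), ∀ w ∈ barLen B n, f w ∈ barLen B n →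
      f (ι k x * w) ∈ barLen B (n + 1)) {n : ℕ} {w : Bar B} (hw : w ∈ barLen B n) :
    f w ∈ barLen B n := by
  induction n generalizing w with
  | zero =>
    refine barLen_zero_induction (p := fun w => f w ∈ barLen B 0) one (fun c a ha => ?_) hw
    rw [map_smul]
    exact Submodule.smul_mem _ _ ha
  | succ n ih =>
    refine barLen_succ_induction (p := fun w => f w ∈ barLen B (n + 1))
      (fun x w hw => cons n x w hw (ih hw)) (fun a b ha hb => ?_) hw
    rw [map_add]
    exact add_mem ha hb

lemma barD₁_mem {n : ℕ} {w : Bar B} (hw : w ∈ barLen B n) : barD₁ B w ∈ barLen B n := by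
  refine barLen_map_le (by simp) (fun n x w hw h => ?_) hw
  rw [barD₁_cons]
  exact sub_mem (neg_mem (cons_mem_barLen _ hw)) (cons_mem_barLen _ h)

lemma firstMul_mem (x : B.carrier) {n : ℕ} {w : Bar B} (hw : w ∈ barLen B n) :
    firstMul B x w ∈ barLen B n := by
  refine barLen_map_le (by simp) (fun n y w hw h => ?_) hw
  rw [firstMul_cons]
  exact cons_mem_barLen _ hw

lemma barD₂_eq_zero {w : Bar B} (hw : w ∈ barLen B 0) : barD₂ B w = 0 :=
  barLen_zero_induction (p := fun w => barD₂ B w = 0) (by simp)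
    (fun c a ha => by rw [map_smul, ha, smul_zero]) hw

lemma barD₂_mem {n : ℕ} {w : Bar B} (hw : w ∈ barLen B (n + 1)) : barD₂ B w ∈ barLen B n := by
  induction n generalizing w with
  | zero =>
    refine barLen_succ_induction (p := fun w => barD₂ B w ∈ barLen B 0) (fun x w hw => ?_)
        (fun a b ha hb => ?_) hw
    · rw [barD₂_cons, barD₂_eq_zero hw, mul_zero, sub_zero]
      exact firstMul_mem _ hw
    · rw [map_add]; exact add_mem ha hb
  | succ n ih =>
    refine barLen_succ_induction (p := fun w => barD₂ B w ∈ barLen B (n + 1)) (fun x w hw => ?_)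
        (fun a b ha hb => ?_) hw
    · rw [barD₂_cons]
      exact sub_mem (firstMul_mem _ hw) (cons_mem_barLen _ (ih hw))
    · rw [map_add]; exact add_mem ha hb

variable {E : DGAlgebra.{v} k}

/-- A linear map vanishes on words of length `n`. -/
def VanishesOn (τ : Bar B →ₗ[k] E.carrier) (n : ℕ) : Prop := ∀ w ∈ barLen B n, τ w = 0

variable (B E) in
/-- The elements of the free right module of length less than `n`. -/
def lowT (n : ℕ) : Submodule k (BarTensor B E) :=
  Submodule.span k {q | ∃ i < n, ∃ w ∈ barLen B i, ∃ e : E.carrier, q = w ⊗ₜ e}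

lemma tmul_mem_lowT {n i : ℕ} (hi : i < n) {w : Bar B} (hw : w ∈ barLen B i) (e : E.carrier) :
    w ⊗ₜ e ∈ lowT B E n :=
  Submodule.subset_span ⟨i, hi, w, hw, e, rfl⟩

lemma consT_mem_lowT {n : ℕ} (x : B.carrier) {q : BarTensor B E} (hq : q ∈ lowT B E n) :
    consT B E x q ∈ lowT B E (n + 1) := by
  have : lowT B E n ≤ (lowT B E (n + 1)).comap (consT B E x) := by
    refine Submodule.span_le.2 ?_
    rintro _ ⟨i, hi, w, hw, e, rfl⟩
    exact tmul_mem_lowT (Nat.succ_lt_succ hi) (cons_mem_barLen x hw) e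
  exact this hq

lemma eq_zero_of_mem_lowT {Y : Type*} [AddCommGroup Y] [Module k Y] {f : BarTensor B E →ₗ[k] Y}
    {n : ℕ} (h : ∀ i < n, ∀ w ∈ barLen B i, ∀ e : E.carrier, f (w ⊗ₜ e) = 0)
    {q : BarTensor B E} (hq : q ∈ lowT B E n) : f q = 0 := by
  have : lowT B E n ≤ LinearMap.ker f := by
    refine Submodule.span_le.2 ?_
    rintro _ ⟨i, hi, w, hw, e, rfl⟩
    exact h i hi w hw e
  exact this hq

/-- The part of the twisted differential which comes from the twisting cochain. -/
def coprodT (τ : Bar B →ₗ[k] E.carrier) : Bar B →ₗ[k] BarTensor B E :=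
  tensorRec 0 ((consMap B).compr₂ (TensorProduct.mk k (Bar B) E.carrier 1 ∘ₗ τ))
    (consT B E ∘ₗ (-B.sgn))

@[simp] lemma coprodT_one (τ : Bar B →ₗ[k] E.carrier) : coprodT τ 1 = 0 := tensorRec_one _ _ _

lemma coprodT_cons (τ : Bar B →ₗ[k] E.carrier) (x : B.carrier) (w : Bar B) :
    coprodT τ (ι k x * w) = 1 ⊗ₜ τ (ι k x * w) - consT B E (B.sgn x) (coprodT τ w) := by
  rw [coprodT, tensorRec_cons, sub_eq_add_neg]
  simp

lemma coprodT_add (τ η : Bar B →ₗ[k] E.carrier) : coprodT (τ + η) = coprodT τ + coprodT η := by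
  refine tensorAlgebra_hom_ext (by simp) fun x w h => ?_
  simp only [LinearMap.add_apply, coprodT_cons, h, TensorProduct.tmul_add, map_add]
  abel

lemma coprodT_mem (τ : Bar B →ₗ[k] E.carrier) {n : ℕ} {w : Bar B} (hw : w ∈ barLen B n) :
    coprodT τ w ∈ lowT B E n := by
  induction n generalizing w with
  | zero =>
    refine barLen_zero_induction (p := fun w => coprodT τ w ∈ lowT B E 0) (by simp)
      (fun c a ha => ?_) hw
    rw [map_smul]; exact Submodule.smul_mem _ _ ha
  | succ n ih =>
    refine barLen_succ_induction (p := fun w => coprodT τ w ∈ lowT B E (n + 1))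
      (fun x w hw => ?_) (fun a b ha hb => ?_) hw
    · rw [coprodT_cons]
      exact sub_mem (tmul_mem_lowT (Nat.succ_pos n) one_mem_barLen _) (consT_mem_lowT _ (ih hw))
    · rw [map_add]; exact add_mem ha hb

/-- `coprodT τ w` sums `± w' ⊗ τ w''` over the factorisations `w = w' w''` with `w''` nonempty. Its
term with the longest prefix splits off the last letter alone. -/
lemma coprodT_snoc_mem (τ : Bar B →ₗ[k] E.carrier) (y : B.carrier) {n : ℕ} {w : Bar B}
    (hw : w ∈ barLen B n) :
    coprodT τ (w * ι k y) - barSgn B w ⊗ₜ τ (ι k y) ∈ lowT B E n := by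
  let f : Bar B →ₗ[k] BarTensor B E := coprodT τ ∘ₗ LinearMap.mulRight k (ι k y) -
    (TensorProduct.mk k (Bar B) E.carrier).flip (τ (ι k y)) ∘ₗ (barSgn B).toLinearMap
  change f w ∈ _
  induction n generalizing w with
  | zero =>
    refine barLen_zero_induction (p := fun w => f w ∈ lowT B E 0) ?_ (fun c a ha => ?_) hw
    · have := coprodT_cons τ y 1
      simp only [mul_one, coprodT_one, map_zero, sub_zero] at this
      simp [f, this]
    · rw [map_smul]; exact Submodule.smul_mem _ _ ha
  | succ n ih =>
    refine barLen_succ_induction (p := fun w => f w ∈ lowT B E (n + 1))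
      (fun x w hw => ?_) (fun a b ha hb => ?_) hw
    · have : f (ι k x * w) = 1 ⊗ₜ τ (ι k x * (w * ι k y)) - consT B E (B.sgn x) (f w) := by
        simp [f, mul_assoc, coprodT_cons, barSgn_cons]
        abel
      rw [this]
      exact sub_mem (tmul_mem_lowT (Nat.succ_pos n) one_mem_barLen _) (consT_mem_lowT _ (ih hw))
    · rw [map_add]; exact add_mem ha hb

lemma coprodT_eq_zero {η : Bar B →ₗ[k] E.carrier} {n : ℕ} (h : ∀ i ≤ n, VanishesOn η i) {w : Bar B}
    (hw : w ∈ barLen B n) : coprodT η w = 0 := by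
  induction n generalizing w with
  | zero =>
    refine barLen_zero_induction (p := fun w => coprodT η w = 0) (by simp)
      (fun c a ha => by rw [map_smul, ha, smul_zero]) hw
  | succ n ih =>
    refine barLen_succ_induction (p := fun w => coprodT η w = 0)
      (fun x w hw => ?_) (fun a b ha hb => by rw [map_add, ha, hb, add_zero]) hw
    rw [coprodT_cons, ih (fun i hi => h i (hi.trans n.le_succ)) hw,
      h (n + 1) le_rfl _ (cons_mem_barLen x hw)]
    simp

lemma hatMap_add (τ η : Bar B →ₗ[k] E.carrier) : hatMap (τ + η) = hatMap τ + hatMap η := by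
  ext; simp [add_mul]

lemma hatMap_eq_zero {η : Bar B →ₗ[k] E.carrier} {n : ℕ} (h : ∀ i < n, VanishesOn η i)
    {q : BarTensor B E} (hq : q ∈ lowT B E n) : hatMap η q = 0 :=
  eq_zero_of_mem_lowT (fun i hi w hw e => by rw [hatMap_tmul, h i hi w hw, zero_mul]) hq

lemma twistedD_tmul_one (τ : Bar B →ₗ[k] E.carrier) (w : Bar B) :
    twistedD τ (w ⊗ₜ 1) = (barD₁ B w + barD₂ B w) ⊗ₜ 1 + coprodT τ w := by
  let f := twistedD τ ∘ₗ (TensorProduct.mk k (Bar B) E.carrier).flip 1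
  let g := (TensorProduct.mk k (Bar B) E.carrier).flip 1 ∘ₗ (barD₁ B + barD₂ B) + coprodT τ
  have : f = g := by
    refine tensorAlgebra_hom_ext (by simp [f, g, E.d_one]) fun x w h => ?_
    have h' : f (ι k x * w) = twistedD τ (consT B E x (w ⊗ₜ 1)) := rfl
    have h'' : twistedD τ (w ⊗ₜ 1) = g w := h
    rw [h', twistedD_cons, h'']
    simp [g, barD₁_cons, barD₂_cons, coprodT_cons]
    abel
  exact LinearMap.congr_fun this w

/-- The curvature of a cochain. -/
def curv (τ : Bar B →ₗ[k] E.carrier) : Bar B →ₗ[k] E.carrier :=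
  curvT τ ∘ₗ (TensorProduct.mk k (Bar B) E.carrier).flip 1

lemma curvT_tmul_one (τ : Bar B →ₗ[k] E.carrier) (w : Bar B) : curvT τ (w ⊗ₜ 1) = curv τ w := rfl

lemma curv_apply (τ : Bar B →ₗ[k] E.carrier) (w : Bar B) :
    curv τ w = τ (barD₁ B w) + τ (barD₂ B w) + hatMap τ (coprodT τ w) + E.d (τ w) := by
  rw [← curvT_tmul_one, curvT_apply, twistedD_tmul_one]
  simp

lemma curv_one {τ : Bar B →ₗ[k] E.carrier} (h₁ : τ 1 = 0) : curv τ 1 = 0 := by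
  simp [curv_apply, h₁]

lemma curv_add (τ η : Bar B →ₗ[k] E.carrier) (w : Bar B) :
    curv (τ + η) w = curv τ w + η (barD₁ B w) + η (barD₂ B w) + E.d (η w) +
      hatMap τ (coprodT η w) + hatMap η (coprodT τ w) + hatMap η (coprodT η w) := by
  simp only [curv_apply, coprodT_add, hatMap_add, LinearMap.add_apply, map_add]
  abel

/-- The compatibility with signs of a cochain of odd degree. -/
def IsOdd (τ : Bar B →ₗ[k] E.carrier) : Prop := ∀ w, E.sgn (τ w) = -τ (barSgn B w)

/-- The extra term from `twistedD_right` cancels the sign term of the Leibniz rule for `E.d`,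
because `τ` is odd. The curvature on the free module is thus determined by `curv`. -/
lemma IsOdd.curvT_tmul {τ : Bar B →ₗ[k] E.carrier} (hτ : IsOdd τ) (w : Bar B) (e : E.carrier) :
    curvT τ (w ⊗ₜ e) = curv τ w * e := by
  have : w ⊗ₜ[k] e = rightT B E e (w ⊗ₜ 1) := by simp
  rw [this, curvT_apply, twistedD_right, ← curvT_tmul_one, curvT_apply, map_add, hatMap_rightT,
    hatMap_rightT, hatMap_rightT, E.d_mul]
  simp only [sgnT_tmul, E.sgn_one, hatMap_tmul, mul_one, hτ w]
  noncomm_ring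

lemma IsOdd.curvT_eq_zero {τ : Bar B →ₗ[k] E.carrier} (hτ : IsOdd τ) {n : ℕ}
    (h : ∀ i < n, VanishesOn (curv τ) i) {q : BarTensor B E} (hq : q ∈ lowT B E n) :
    curvT τ q = 0 :=
  eq_zero_of_mem_lowT (fun i hi w hw e => by rw [hτ.curvT_tmul, h i hi w hw, zero_mul]) hq

variable {τ : Bar B →ₗ[k] E.carrier}

lemma twistedD_twistedD_tmul_cons (h₁ : τ 1 = 0) (x : B.carrier) (w : Bar B) :
    twistedD τ (twistedD τ ((ι k x * w) ⊗ₜ 1)) =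
      consT B E x (twistedD τ (twistedD τ (w ⊗ₜ 1))) + 1 ⊗ₜ curv τ (ι k x * w) :=
  twistedD_twistedD_cons h₁ x (w ⊗ₜ 1)

/-- The square of the twisted differential on the shortest words with curvature. -/
lemma twistedD_twistedD_tmul (h₁ : τ 1 = 0) {n : ℕ} (h : ∀ i < n, VanishesOn (curv τ) i)
    {w : Bar B} (hw : w ∈ barLen B n) :
    twistedD τ (twistedD τ (w ⊗ₜ 1)) = 1 ⊗ₜ curv τ w := by
  let f : Bar B →ₗ[k] BarTensor B E := twistedD τ ∘ₗ twistedD τ ∘ₗ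
    (TensorProduct.mk k (Bar B) E.carrier).flip 1 - TensorProduct.mk k (Bar B) E.carrier 1 ∘ₗ curv τ
  suffices f w = 0 from sub_eq_zero.1 this
  induction n generalizing w with
  | zero =>
    refine barLen_zero_induction (p := fun w => f w = 0) ?_
      (fun c a ha => by rw [map_smul, ha, smul_zero]) hw
    simp [f, curv_one h₁, E.d_d]
  | succ n ih =>
    refine barLen_succ_induction (p := fun w => f w = 0) (fun x w hw => ?_)
      (fun a b ha hb => by rw [map_add, ha, hb, add_zero]) hw
    have h₀ : twistedD τ (twistedD τ (w ⊗ₜ 1)) = 0 := by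
      have : f w = 0 := ih (fun i hi => h i (hi.trans n.lt_succ_self)) hw
      simpa [f, h n n.lt_succ_self w hw] using this
    have := twistedD_twistedD_tmul_cons h₁ x w
    rw [h₀, map_zero, zero_add] at this
    simp [f, this]

/-- Evaluate `curvT_twistedD` at `w ⊗ 1`. The square of the twisted differential lies in the empty
word, where `τ` vanishes; the terms from products and from `τ` have shorter words, on which there is
no curvature. -/
lemma d_curv (h₁ : τ 1 = 0) (hτ : IsOdd τ) {n : ℕ} (h : ∀ i < n, VanishesOn (curv τ) i)
    {w : Bar B} (hw : w ∈ barLen B n) : E.d (curv τ w) = curv τ (barD₁ B w) := by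
  have key := curvT_twistedD τ (w ⊗ₜ 1)
  rw [twistedD_twistedD_tmul h₁ h hw, twistedD_tmul_one, map_add,
    hτ.curvT_eq_zero h (coprodT_mem τ hw), curvT_tmul_one, hatMap_tmul, h₁, zero_mul, zero_add,
    curvT_tmul_one, add_zero, map_add] at key
  have h₂ : curv τ (barD₂ B w) = 0 := by
    cases n with
    | zero => rw [barD₂_eq_zero hw, map_zero]
    | succ n => exact h n n.lt_succ_self _ (barD₂_mem hw)
  rw [← key, h₂, add_zero]

/-- The same evaluation one length higher. Two more terms survive: the square of the twisted
differential leaves the first letter in front of the curvature of the rest, and the longest-prefix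
term of `coprodT` leaves the last letter behind. These are the outer terms of the Hochschild
differential, and `barD₂` supplies the inner ones. -/
lemma bianchi (h₁ : τ 1 = 0) (hτ : IsOdd τ) {n : ℕ} (h : ∀ i < n, VanishesOn (curv τ) i)
    {v u' : Bar B} (hv : v ∈ barLen B n) (hu' : u' ∈ barLen B n) (x y : B.carrier)
    (hu : ι k x * v = u' * ι k y) :
    τ (ι k x) * curv τ v + E.d (curv τ (ι k x * v)) =
      curv τ (barD₁ B (ι k x * v)) + curv τ (barD₂ B (ι k x * v)) +
        curv τ (barSgn B u') * τ (ι k y) := by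
  have key := curvT_twistedD τ ((ι k x * v) ⊗ₜ 1)
  rw [twistedD_twistedD_tmul_cons h₁, twistedD_twistedD_tmul h₁ h hv, twistedD_tmul_one,
    map_add, map_add, consT_tmul, mul_one, hatMap_tmul, hatMap_tmul, h₁, zero_mul, add_zero,
    curvT_tmul_one, curvT_tmul_one, map_add] at key
  rw [← key]
  congr 1
  have := hτ.curvT_eq_zero h (coprodT_snoc_mem τ y hu')
  rw [map_sub, hτ.curvT_tmul, sub_eq_zero, ← hu] at this
  exact this

lemma curv_add_of_lt {η : Bar B →ₗ[k] E.carrier} {n : ℕ} (hη : ∀ i < n, VanishesOn η i) {i : ℕ}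
    (hi : i < n) {w : Bar B} (hw : w ∈ barLen B i) : curv (τ + η) w = curv τ w := by
  have h₂ : η (barD₂ B w) = 0 := by
    cases i with
    | zero => rw [barD₂_eq_zero hw, map_zero]
    | succ i => exact hη i (by omega) _ (barD₂_mem hw)
  have h₃ : hatMap η (coprodT τ w) = 0 :=
    hatMap_eq_zero (fun j hj => hη j (by omega)) (coprodT_mem τ hw)
  rw [curv_add, hη i hi _ (barD₁_mem hw), h₂, hη i hi _ hw,
    coprodT_eq_zero (fun j hj => hη j (by omega)) hw, h₃]
  simp

lemma coprodT_of_lt {η : Bar B →ₗ[k] E.carrier} {n : ℕ} (hn : n ≠ 0)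
    (hη : ∀ i < n, VanishesOn η i)
    {w : Bar B} (hw : w ∈ barLen B n) : coprodT η w = 1 ⊗ₜ η w := by
  obtain ⟨n, rfl⟩ := Nat.exists_eq_succ_of_ne_zero hn
  refine barLen_succ_induction (p := fun w => coprodT η w = 1 ⊗ₜ η w) (fun x w hw => ?_)
    (fun a b ha hb => by rw [map_add, ha, hb, map_add, TensorProduct.tmul_add]) hw
  rw [coprodT_cons, coprodT_eq_zero (fun j hj => hη j (by omega)) hw, map_zero, sub_zero]

/-- In the lowest length where `η` lives, all terms involving products raise the length, or contain
`τ 1`. The curvature changes only by the differential of `η` as a map of complexes. -/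
lemma curv_add_of_eq (h₁ : τ 1 = 0) {η : Bar B →ₗ[k] E.carrier} {n : ℕ} (hn : n ≠ 0)
    (hη : ∀ i < n, VanishesOn η i) {w : Bar B} (hw : w ∈ barLen B n) :
    curv (τ + η) w = curv τ w + η (barD₁ B w) + E.d (η w) := by
  have h₂ : η (barD₂ B w) = 0 := by
    cases n with
    | zero => rw [barD₂_eq_zero hw, map_zero]
    | succ i => exact hη i (by omega) _ (barD₂_mem hw)
  have h₃ : hatMap η (coprodT τ w) = 0 := hatMap_eq_zero hη (coprodT_mem τ hw)
  have h₄ : η 1 = 0 := hη 0 (by omega) _ one_mem_barLen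
  rw [curv_add, h₂, h₃, coprodT_of_lt hn hη hw]
  simp [h₁, h₄]

/-- One length above the support of `η`, the change of the curvature is the Hochschild differential
of `η` with coefficients acting through the values of `τ` on letters. The quadratic term drops
because `η` vanishes on letters, which uses `2 ≤ n`. -/
lemma curv_add_of_succ {η : Bar B →ₗ[k] E.carrier} {n : ℕ} (hn : 2 ≤ n)
    (hη : ∀ i, i ≠ n → VanishesOn η i) {v u' : Bar B} (hv : v ∈ barLen B n)
    (hu' : u' ∈ barLen B n) (x y : B.carrier) (hu : ι k x * v = u' * ι k y) :
    curv (τ + η) (ι k x * v) = curv τ (ι k x * v) + η (barD₂ B (ι k x * v)) -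
      τ (ι k (B.sgn x)) * η v + η (barSgn B u') * τ (ι k y) := by
  have h₃ : hatMap η (coprodT τ (ι k x * v)) = η (barSgn B u') * τ (ι k y) := by
    have := hatMap_eq_zero (fun i hi => hη i hi.ne) (coprodT_snoc_mem τ y hu')
    rwa [map_sub, sub_eq_zero, ← hu, hatMap_tmul] at this
  have h₄ : η (ι k x * v) = 0 := hη (n + 1) (by omega) _ (cons_mem_barLen x hv)
  have h₅ : coprodT η (ι k x * v) = -(ι k (B.sgn x) ⊗ₜ η v) := by
    rw [coprodT_cons, coprodT_of_lt (by omega) (fun i hi => hη i hi.ne) hv, h₄]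
    simp
  have h₆ : η (ι k (B.sgn x)) = 0 := hη 1 (by omega) _ (ι_mem_barLen _)
  rw [curv_add, h₃, h₅, h₄, hη (n + 1) (by omega) _ (barD₁_mem (cons_mem_barLen x hv))]
  simp [h₆]
  abel

end Length

/-! ### The cohomological degree on the bar construction. -/

section Degree

open TensorAlgebra TensorProduct

variable {k : Type t} [CommRing k] (B : DGAlgebra.{w} k)

/-- The products of homogeneous letters, with their degree, where a letter `x` has degree
`|x| - 1`. -/
inductive HomWord : ℤ → Bar B → Prop
  | one : HomWord 0 1
  | cons {e m : ℤ} {x : B.carrier} {w : Bar B} :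
      x ∈ B.gr e → HomWord m w → HomWord (e - 1 + m) (ι k x * w)

/-- The elements of degree `m` of the tensor algebra. -/
def barDeg (m : ℤ) : Submodule k (Bar B) := Submodule.span k {w | HomWord B m w}

variable {B}

lemma HomWord.exists_mem_barLen {m : ℤ} {w : Bar B} (hw : HomWord B m w) :
    ∃ n, w ∈ barLen B n := by
  induction hw with
  | one => exact ⟨0, one_mem_barLen⟩
  | cons _ _ ih => exact ⟨_, cons_mem_barLen _ ih.choose_spec⟩

lemma one_mem_barDeg : (1 : Bar B) ∈ barDeg B 0 := Submodule.subset_span .one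

lemma cons_mem_barDeg {e m n : ℤ} (hn : e - 1 + m = n) {x : B.carrier} (hx : x ∈ B.gr e)
    {w : Bar B} (hw : w ∈ barDeg B m) : ι k x * w ∈ barDeg B n := by
  subst hn
  have : barDeg B m ≤ (barDeg B (e - 1 + m)).comap (LinearMap.mulLeft k (ι k x)) :=
    Submodule.span_le.2 fun w hw => Submodule.subset_span (.cons hx hw)
  exact this hw

variable {Y : Type*} [AddCommGroup Y] [Module k Y]

lemma barDeg_map_le {𝒴 : ℤ → Submodule k Y} {f : Bar B →ₗ[k] Y} {s : ℤ} (one : f 1 ∈ 𝒴 s)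
    (cons : ∀ (e m : ℤ), ∀ x ∈ B.gr e, ∀ w ∈ barDeg B m, f w ∈ 𝒴 (m + s) →
      f (ι k x * w) ∈ 𝒴 (e - 1 + m + s)) {m n : ℤ} (hn : m + s = n) {w : Bar B}
    (hw : w ∈ barDeg B m) : f w ∈ 𝒴 n := by
  subst hn
  have : barDeg B m ≤ (𝒴 (m + s)).comap f := by
    clear hw
    refine Submodule.span_le.2 fun w hw => ?_
    induction hw with
    | one => rw [zero_add]; exact one
    | cons hx hw' ih => exact cons _ _ _ hx _ (Submodule.subset_span hw') ih
  exact this hw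

lemma barDeg_hom_ext {f g : Bar B →ₗ[k] Y} (h : ∀ m, ∀ w, HomWord B m w → f w = g w) : f = g := by
  have top : ∀ w : Bar B, w ∈ ⨆ m, barDeg B m := by
    intro w
    induction w using tensorAlgebra_left_induction with
    | one => exact Submodule.mem_iSup_of_mem 0 one_mem_barDeg
    | add a b ha hb => exact add_mem ha hb
    | smul c a ha => exact Submodule.smul_mem _ _ ha
    | cons x w hw =>
      induction x using DirectSum.Decomposition.inductionOn B.gr with
      | zero => simp
      | @homogeneous e x =>
        have : (⨆ m, barDeg B m) ≤ (⨆ m, barDeg B m).comap (LinearMap.mulLeft k (ι k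
            (x : B.carrier))) :=
          iSup_le fun m w hw => Submodule.mem_iSup_of_mem (e - 1 + m) (cons_mem_barDeg rfl x.2 hw)
        exact this hw
      | add x x' h h' => rw [map_add, add_mul]; exact add_mem h h'
  ext w
  have : (⨆ m, barDeg B m) ≤ LinearMap.eqLocus f g :=
    iSup_le fun m => Submodule.span_le.2 fun w hw => h m w hw
  exact this (top w)

lemma barD₁_mem_barDeg {m n : ℤ} (hn : m + 1 = n) {w : Bar B} (hw : w ∈ barDeg B m) :
    barD₁ B w ∈ barDeg B n := by
  refine barDeg_map_le (by simp) (fun e m x hx w hw h => ?_) hn hw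
  rw [barD₁_cons]
  exact sub_mem (neg_mem (cons_mem_barDeg (by omega) (B.d_mem hx) hw))
    (cons_mem_barDeg (by omega) (B.sgn_mem hx) h)

lemma firstMul_mem_barDeg {a m n : ℤ} (hn : m + a = n) {x : B.carrier} (hx : x ∈ B.gr a)
    {w : Bar B} (hw : w ∈ barDeg B m) : firstMul B x w ∈ barDeg B n := by
  refine barDeg_map_le (by simp) (fun e m y hy w hw h => ?_) hn hw
  rw [firstMul_cons]
  exact cons_mem_barDeg (by omega) (SetLike.mul_mem_graded hx hy) hw

lemma barD₂_mem_barDeg {m n : ℤ} (hn : m + 1 = n) {w : Bar B} (hw : w ∈ barDeg B m) :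
    barD₂ B w ∈ barDeg B n := by
  refine barDeg_map_le (by simp) (fun e m x hx w hw h => ?_) hn hw
  rw [barD₂_cons]
  exact sub_mem (firstMul_mem_barDeg (by omega) (B.sgn_mem hx) hw)
    (cons_mem_barDeg (by omega) (B.sgn_mem hx) h)

lemma barSgn_of_homWord {m : ℤ} {w : Bar B} (hw : HomWord B m w) :
    barSgn B w = (m.negOnePow : ℤ) • w := by
  induction hw with
  | one => simp
  | @cons e m x w hx hw ih =>
    rw [barSgn_cons, ih, B.sgn_of_mem hx, map_zsmul, smul_mul_smul_comm, Int.negOnePow_add,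
      Int.negOnePow_sub]
    simp

variable {E : DGAlgebra.{v} k}

/-- A cochain has degree `s`. -/
def HasDegree (τ : Bar B →ₗ[k] E.carrier) (s : ℤ) : Prop :=
  ∀ ⦃m n : ℤ⦄, m + s = n → ∀ w ∈ barDeg B m, τ w ∈ E.gr n

/-- The sign automorphism `barSgn` is `(-1) ^ m` in degree `m`, since a letter `x` has degree `|x| -
1`. -/
lemma HasDegree.isOdd {τ : Bar B →ₗ[k] E.carrier} (hτ : HasDegree τ 1) : IsOdd τ := by
  have : E.sgn ∘ₗ τ = -(τ ∘ₗ (barSgn B).toLinearMap) := by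
    refine barDeg_hom_ext fun m w hw => ?_
    have h := E.sgn_of_mem (hτ rfl w (Submodule.subset_span hw))
    rw [LinearMap.comp_apply, LinearMap.neg_apply, LinearMap.comp_apply, AlgHom.toLinearMap_apply,
      barSgn_of_homWord hw, map_zsmul, h, Int.negOnePow_succ, Units.val_neg, neg_smul]
  exact fun w => LinearMap.congr_fun this w

variable (B E) in
/-- The elements of degree `n` of the free right module. -/
def tDeg (n : ℤ) : Submodule k (BarTensor B E) :=
  Submodule.span k {q | ∃ m a, m + a = n ∧ ∃ w ∈ barDeg B m, ∃ e ∈ E.gr a, q = w ⊗ₜ e}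

lemma tmul_mem_tDeg {m a n : ℤ} (hn : m + a = n) {w : Bar B} (hw : w ∈ barDeg B m) {e : E.carrier}
    (he : e ∈ E.gr a) : w ⊗ₜ e ∈ tDeg B E n :=
  Submodule.subset_span ⟨m, a, hn, w, hw, e, he, rfl⟩

lemma tDeg_map_le {𝒴 : ℤ → Submodule k Y} {f : BarTensor B E →ₗ[k] Y} {s : ℤ}
    (h : ∀ m a, ∀ w ∈ barDeg B m, ∀ e ∈ E.gr a, f (w ⊗ₜ e) ∈ 𝒴 (m + a + s))
    {m n : ℤ} (hn : m + s = n) {q : BarTensor B E} (hq : q ∈ tDeg B E m) : f q ∈ 𝒴 n := by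
  subst hn
  have : tDeg B E m ≤ (𝒴 (m + s)).comap f := by
    refine Submodule.span_le.2 ?_
    rintro _ ⟨m, a, rfl, w, hw, e, he, rfl⟩
    exact h m a w hw e he
  exact this hq

lemma consT_mem_tDeg {e m n : ℤ} (hn : e - 1 + m = n) {x : B.carrier} (hx : x ∈ B.gr e)
    {q : BarTensor B E} (hq : q ∈ tDeg B E m) : consT B E x q ∈ tDeg B E n :=
  tDeg_map_le (s := e - 1) (fun m a w hw e he =>
    tmul_mem_tDeg (by omega) (cons_mem_barDeg rfl hx hw) he) (by omega) hq

lemma HasDegree.hatMap_mem {τ : Bar B →ₗ[k] E.carrier} {s : ℤ} (hτ : HasDegree τ s) {m n : ℤ}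
    (hn : m + s = n) {q : BarTensor B E} (hq : q ∈ tDeg B E m) : hatMap τ q ∈ E.gr n :=
  tDeg_map_le (s := s) (fun m a w hw e he => by
    rw [hatMap_tmul, show m + a + s = m + s + a by ring]
    exact SetLike.mul_mem_graded (hτ rfl w hw) he) hn hq

lemma HasDegree.coprodT_mem {τ : Bar B →ₗ[k] E.carrier} {s : ℤ} (hτ : HasDegree τ s) {m n : ℤ}
    (hn : m + s = n) {w : Bar B} (hw : w ∈ barDeg B m) : coprodT τ w ∈ tDeg B E n := by
  refine barDeg_map_le (by simp) (fun e m x hx w hw h => ?_) hn hw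
  rw [coprodT_cons]
  exact sub_mem (tmul_mem_tDeg (by omega) one_mem_barDeg (hτ rfl _ (cons_mem_barDeg rfl hx hw)))
    (consT_mem_tDeg (by omega) (B.sgn_mem hx) h)

lemma HasDegree.curv {τ : Bar B →ₗ[k] E.carrier} (hτ : HasDegree τ 1) :
    HasDegree (curv τ) 2 := by
  intro m n hn w hw
  rw [curv_apply]
  refine add_mem (add_mem (add_mem ?_ ?_) ?_) ?_
  · exact hτ (by omega) _ (barD₁_mem_barDeg rfl hw)
  · exact hτ (by omega) _ (barD₂_mem_barDeg rfl hw)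
  · exact hτ.hatMap_mem (by omega) (hτ.coprodT_mem rfl hw)
  · rw [show n = m + 1 + 1 by omega]
    exact E.d_mem (hτ rfl w hw)

lemma HasDegree.add {τ η : Bar B →ₗ[k] E.carrier} {s : ℤ} (hτ : HasDegree τ s)
    (hη : HasDegree η s) : HasDegree (τ + η) s :=
  fun _ _ h w hw => add_mem (hτ h w hw) (hη h w hw)

instance : GradedAlgebra (barLen B) := TensorAlgebra.gradedAlgebra

variable (B) in
/-- The projection to the words of length `n`. -/
def barProj (n : ℕ) : Bar B →ₗ[k] Bar B := GradedAlgebra.proj (barLen B) n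

lemma barProj_of_mem {n : ℕ} {w : Bar B} (hw : w ∈ barLen B n) : barProj B n w = w := by
  rw [barProj, GradedAlgebra.proj_apply]
  exact decompose_of_mem_same _ hw

lemma barProj_of_ne {m n : ℕ} (h : m ≠ n) {w : Bar B} (hw : w ∈ barLen B m) :
    barProj B n w = 0 := by
  rw [barProj, GradedAlgebra.proj_apply]
  exact decompose_of_mem_ne _ hw h

lemma barProj_mem_barDeg (n : ℕ) {m : ℤ} {w : Bar B} (hw : w ∈ barDeg B m) :
    barProj B n w ∈ barDeg B m := by
  have : barDeg B m ≤ (barDeg B m).comap (barProj B n) := by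
    refine Submodule.span_le.2 fun w hw => ?_
    obtain ⟨i, hi⟩ := hw.exists_mem_barLen
    change barProj B n w ∈ barDeg B m
    by_cases h : i = n
    · subst h; rw [barProj_of_mem hi]; exact Submodule.subset_span hw
    · rw [barProj_of_ne h hi]; exact zero_mem _
  exact this hw

end Degree

/-! ### Contraction of a DG-algebra over a field to its cohomology, and its extension to words. -/

section Contraction

variable {k : Type t} 

/-- A graded linear contraction of a DG-algebra to its cohomology. -/
structure Contraction [CommRing k] (X : DGAlgebra.{w} k) where
  p : X.carrier →ₗ[k] X.Cohomology
  j : X.Cohomology →ₗ[k] X.carrier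
  h : X.carrier →ₗ[k] X.carrier
  p_cocycle : ∀ z : X.cocycles, p z = X.proj z
  p_d : ∀ x, p (X.d x) = 0
  d_j : ∀ a, X.d (j a) = 0
  p_j : ∀ a, p (j a) = a
  homotopy : ∀ x, X.d (h x) + h (X.d x) = x - j (p x)
  p_mem : ∀ ⦃n : ℤ⦄ ⦃x : X.carrier⦄, x ∈ X.gr n → p x ∈ X.cohomologyGr n
  j_mem : ∀ ⦃n : ℤ⦄ ⦃a : X.Cohomology⦄, a ∈ X.cohomologyGr n → j a ∈ X.gr n
  h_mem : ∀ ⦃n : ℤ⦄ ⦃x : X.carrier⦄, x ∈ X.gr n → h x ∈ X.gr (n - 1)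

lemma exists_generalized_inverse [Field k] {V W : Type*} [AddCommGroup V] [Module k V]
    [AddCommGroup W] [Module k W] (f : V →ₗ[k] W) :
    ∃ g : W →ₗ[k] V, ∀ x, f (g (f x)) = f x := by
  obtain ⟨s, hs⟩ := f.rangeRestrict.exists_rightInverse_of_surjective f.range_rangeRestrict
  obtain ⟨g, hg⟩ := LinearMap.exists_extend s
  refine ⟨g, fun x => ?_⟩
  have h₁ : g (f x) = s ⟨f x, x, rfl⟩ := LinearMap.congr_fun hg ⟨f x, x, rfl⟩
  have h₂ := LinearMap.congr_fun hs ⟨f x, x, rfl⟩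
  rw [h₁]
  exact congrArg Subtype.val h₂

lemma exists_section [Field k] {V W : Type*} [AddCommGroup V] [Module k V]
    [AddCommGroup W] [Module k W] (f : V →ₗ[k] W) (hf : Function.Surjective f) :
    ∃ g : W →ₗ[k] V, ∀ y, f (g y) = y := by
  obtain ⟨g, hg⟩ := f.exists_rightInverse_of_surjective (LinearMap.range_eq_top.2 hf)
  exact ⟨g, LinearMap.congr_fun hg⟩

/-- The linear map with given restrictions to the homogeneous components. -/
def gradedLift [CommRing k] {A Y I : Type*} [DecidableEq I] [AddCommGroup A] [Module k A]
    [AddCommGroup Y] [Module k Y] (𝒜 : I → Submodule k A) [DirectSum.Decomposition 𝒜]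
    (f : ∀ n, 𝒜 n →ₗ[k] Y) : A →ₗ[k] Y :=
  DirectSum.toModule k I Y f ∘ₗ (DirectSum.decomposeLinearEquiv 𝒜).toLinearMap

lemma gradedLift_of_mem [CommRing k] {A Y I : Type*} [DecidableEq I] [AddCommGroup A] [Module k A]
    [AddCommGroup Y] [Module k Y] (𝒜 : I → Submodule k A) [DirectSum.Decomposition 𝒜]
    (f : ∀ n, 𝒜 n →ₗ[k] Y) {n : I} {a : A} (ha : a ∈ 𝒜 n) : gradedLift 𝒜 f a = f n ⟨a, ha⟩ := by
  have h : DirectSum.decomposeLinearEquiv 𝒜 a = DirectSum.lof k I (fun i => 𝒜 i) n ⟨a, ha⟩ :=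
    DirectSum.decompose_of_mem 𝒜 ha
  rw [gradedLift, LinearMap.comp_apply, LinearEquiv.coe_coe, h, DirectSum.toModule_lof]

/-- Over a field the differential has a graded generalised inverse `G` with `d G d = d`, and
cohomology classes have linear homogeneous representatives `j`. Then `id - G d` projects to cocycles
and defines `p`. -/
lemma nonempty_contraction_cohomology [Field k] (X : DGAlgebra.{w} k) :
    Nonempty (Contraction X) := by
  choose g hg using fun n : ℤ => exists_generalized_inverse (X.d ∘ₗ (X.gr n).subtype)
  let G : X.carrier →ₗ[k] X.carrier :=
    gradedLift X.gr fun n => (X.gr (n - 1)).subtype ∘ₗ g (n - 1) ∘ₗ (X.gr n).subtype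
  have hG {n : ℤ} {x : X.carrier} (hx : x ∈ X.gr n) : G x ∈ X.gr (n - 1) := by
    rw [gradedLift_of_mem X.gr _ hx]
    exact (g (n - 1) x).2
  have dGd (x : X.carrier) : X.d (G (X.d x)) = X.d x := by
    have : X.d ∘ₗ G ∘ₗ X.d = X.d := by
      refine linearMap_ext_of_homogeneous X.gr fun m x hx => ?_
      obtain ⟨n, rfl⟩ : ∃ n, m = n - 1 := ⟨m + 1, by omega⟩
      have hd : X.d x ∈ X.gr n := by simpa using X.d_mem hx
      simp only [LinearMap.comp_apply]
      rw [gradedLift_of_mem X.gr _ hd]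
      exact hg (n - 1) ⟨x, hx⟩
    exact LinearMap.congr_fun this x
  choose s hs using fun n => exists_section (X.projGr n) (X.projGr_surjective n)
  let j : X.Cohomology →ₗ[k] X.carrier := gradedLift X.cohomologyGr fun n =>
    X.cocycles.val.toLinearMap ∘ₗ (X.cocyclesGr n).subtype ∘ₗ s n
  let c : X.carrier →ₗ[k] X.cocycles :=
    LinearMap.codRestrict X.cocycles.toSubmodule (LinearMap.id - G ∘ₗ X.d)
      (fun x => by
        change X.d (x - G (X.d x)) = 0
        rw [map_sub, dGd, sub_self])
  have hc (x : X.carrier) : (c x : X.carrier) = x - G (X.d x) := rfl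
  let p : X.carrier →ₗ[k] X.Cohomology := X.proj.toLinearMap ∘ₗ c
  have hp (z : X.cocycles) : p z = X.proj z := by
    change X.proj (c z) = _
    congr 1
    ext
    rw [hc, X.mem_cocycles.1 z.2, map_zero, sub_zero]
  have hpd (x : X.carrier) : p (X.d x) = 0 := by
    refine (hp ⟨X.d x, X.d_d x⟩).trans ((X.proj_eq_zero_iff _).2 ⟨x, rfl⟩)
  have hdj (a : X.Cohomology) : X.d (j a) = 0 := by
    have : X.d ∘ₗ j = 0 := by
      refine linearMap_ext_of_homogeneous X.cohomologyGr fun n a ha => ?_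
      rw [LinearMap.comp_apply, gradedLift_of_mem _ _ ha]
      exact (s n ⟨a, ha⟩).1.2
    exact LinearMap.congr_fun this a
  have hpj (a : X.Cohomology) : p (j a) = a := by
    have : p ∘ₗ j = LinearMap.id := by
      refine linearMap_ext_of_homogeneous X.cohomologyGr fun n a ha => ?_
      rw [LinearMap.comp_apply, gradedLift_of_mem _ _ ha]
      exact (hp _).trans (congrArg Subtype.val (hs n ⟨a, ha⟩))
    exact LinearMap.congr_fun this a
  have hjm {n : ℤ} {a : X.Cohomology} (ha : a ∈ X.cohomologyGr n) : j a ∈ X.gr n := by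
    rw [gradedLift_of_mem _ _ ha]
    exact (s n ⟨a, ha⟩).2
  have hpm {n : ℤ} {x : X.carrier} (hx : x ∈ X.gr n) : p x ∈ X.cohomologyGr n := by
    refine X.proj_mem (X.mem_cocyclesGr.2 ?_)
    rw [hc]
    have : G (X.d x) ∈ X.gr n := by simpa using hG (X.d_mem hx)
    exact sub_mem hx this
  -- The homotopy first subtracts `G d x` and the representative `j (p x)`, which leaves a
  -- coboundary, and then applies `G`. On `d x` it reduces to `G d x`, the part subtracted above.
  refine ⟨⟨p, j, G ∘ₗ (LinearMap.id - G ∘ₗ X.d - j ∘ₗ p), hp, hpd, hdj, hpj, fun x => ?_, @hpm,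
    @hjm, fun n x hx => ?_⟩⟩
  · simp only [LinearMap.comp_apply, LinearMap.sub_apply, LinearMap.id_apply, X.d_d, hpd, map_zero,
      sub_zero]
    obtain ⟨y, hy⟩ : ∃ y, X.d y = x - G (X.d x) - j (p x) := by
      refine (X.proj_eq_zero_iff (c x - ⟨j (p x), hdj _⟩)).1 ?_
      rw [map_sub, ← hp ⟨j (p x), hdj _⟩, hpj]
      exact sub_self _
    rw [← hy, dGd, hy]
    abel
  · refine hG ?_
    have : G (X.d x) ∈ X.gr n := by simpa using hG (X.d_mem hx)
    exact sub_mem (sub_mem hx this) (hjm (hpm hx))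

namespace Contraction

open TensorAlgebra

variable [CommRing k] {X : DGAlgebra.{w} k} (c : Contraction X)

lemma p_sgn (x : X.carrier) : c.p (X.sgn x) = koszulSign X.cohomologyGr 1 (c.p x) := by
  have : c.p ∘ₗ X.sgn = koszulSign X.cohomologyGr 1 ∘ₗ c.p := by
    refine linearMap_ext_of_homogeneous X.gr fun n x hx => ?_
    rw [LinearMap.comp_apply, LinearMap.comp_apply, X.sgn_of_mem hx,
      koszulSign_of_mem _ _ (c.p_mem hx), one_mul, map_zsmul]
  exact LinearMap.congr_fun this x

lemma j_sgn (a : X.Cohomology) : c.j (koszulSign X.cohomologyGr 1 a) = X.sgn (c.j a) := by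
  have : c.j ∘ₗ koszulSign X.cohomologyGr 1 = X.sgn ∘ₗ c.j := by
    refine linearMap_ext_of_homogeneous X.cohomologyGr fun n a ha => ?_
    rw [LinearMap.comp_apply, LinearMap.comp_apply, X.sgn_of_mem (c.j_mem ha),
      koszulSign_of_mem _ _ ha, one_mul, map_zsmul]
  exact LinearMap.congr_fun this a

lemma h_sgn (x : X.carrier) : c.h (X.sgn x) = -X.sgn (c.h x) := by
  have : c.h ∘ₗ X.sgn = -(X.sgn ∘ₗ c.h) := by
    refine linearMap_ext_of_homogeneous X.gr fun n x hx => ?_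
    rw [LinearMap.comp_apply, LinearMap.neg_apply, LinearMap.comp_apply, X.sgn_of_mem hx,
      X.sgn_of_mem (c.h_mem hx), map_zsmul, Int.negOnePow_sub]
    simp
  exact LinearMap.congr_fun this x

/-- The projection on representatives, on words. -/
def barP : Bar X →ₐ[k] Bar X := lift k (ι k ∘ₗ c.j ∘ₗ c.p)

lemma barP_cons (x : X.carrier) (w : Bar X) :
    c.barP (ι k x * w) = ι k (c.j (c.p x)) * c.barP w := by
  simp [barP]

/-- The contracting homotopy on words. -/
def barH : Bar X →ₗ[k] Bar X :=
  tensorRec 0 (-(consMap X ∘ₗ c.h)) (-(consMap X ∘ₗ c.j ∘ₗ c.p ∘ₗ X.sgn))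

lemma barH_one : c.barH 1 = 0 := tensorRec_one _ _ _

lemma barH_cons (x : X.carrier) (w : Bar X) :
    c.barH (ι k x * w) = -(ι k (c.h x) * w) - ι k (c.j (c.p (X.sgn x))) * c.barH w := by
  rw [barH, tensorRec_cons, sub_eq_add_neg]
  rfl

lemma barP_barD₁ (w : Bar X) : c.barP (barD₁ X w) = 0 := by
  have : c.barP.toLinearMap ∘ₗ barD₁ X = 0 := by
    refine tensorAlgebra_hom_ext (by simp) fun x w h => ?_
    have h' : c.barP (barD₁ X w) = 0 := h
    simp [barD₁_cons, barP_cons, c.p_d, h']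
  exact LinearMap.congr_fun this w

lemma barD₁_barP (w : Bar X) : barD₁ X (c.barP w) = 0 := by
  have : barD₁ X ∘ₗ c.barP.toLinearMap = 0 := by
    refine tensorAlgebra_hom_ext (by simp) fun x w h => ?_
    have h' : barD₁ X (c.barP w) = 0 := h
    simp [barD₁_cons, barP_cons, c.d_j, h']
  exact LinearMap.congr_fun this w

/-- The tensor trick: the homotopy acts on one letter, with the projection `j p` on the letters
before it and the identity on those after it, so that the sum over positions telescopes. -/
lemma bar_homotopy (w : Bar X) : barD₁ X (c.barH w) + c.barH (barD₁ X w) = w - c.barP w := by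
  have : barD₁ X ∘ₗ c.barH + c.barH ∘ₗ barD₁ X = LinearMap.id - c.barP.toLinearMap := by
    refine tensorAlgebra_hom_ext (by simp [barH_one]) fun x w h => ?_
    have h₁ : barD₁ X (c.barH w) = w - c.barP w - c.barH (barD₁ X w) := eq_sub_of_add_eq h
    have h₂ := congrArg (ι k (M := X.carrier)) (eq_sub_of_add_eq (c.homotopy x))
    simp only [map_sub] at h₂
    simp only [LinearMap.add_apply, LinearMap.comp_apply, barH_cons, barD₁_cons, map_sub, map_neg,
      h₁, X.d_sgn, c.d_j, neg_zero, c.h_sgn, c.p_sgn, c.p_d, c.j_sgn, X.sgn_sgn,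
      LinearMap.sub_apply, h₂,
      LinearMap.id_apply, AlgHom.toLinearMap_apply, barP_cons, map_zero, zero_mul]
    noncomm_ring
  exact LinearMap.congr_fun this w

lemma barP_mem {n : ℕ} {w : Bar X} (hw : w ∈ barLen X n) : c.barP w ∈ barLen X n := by
  refine barLen_map_le (f := c.barP.toLinearMap) (by simpa using one_mem_barLen)
    (fun n x w hw h => ?_) hw
  rw [AlgHom.toLinearMap_apply, barP_cons]
  exact cons_mem_barLen _ h

lemma barH_mem {n : ℕ} {w : Bar X} (hw : w ∈ barLen X n) : c.barH w ∈ barLen X n := by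
  refine barLen_map_le (by simp [barH_one]) (fun n x w hw h => ?_) hw
  rw [barH_cons]
  exact sub_mem (neg_mem (cons_mem_barLen _ hw)) (cons_mem_barLen _ h)

lemma barP_mem_barDeg {m : ℤ} {w : Bar X} (hw : w ∈ barDeg X m) : c.barP w ∈ barDeg X m := by
  refine barDeg_map_le (f := c.barP.toLinearMap) (s := 0) (by simpa using one_mem_barDeg)
    (fun e m x hx w hw h => ?_) (add_zero m) hw
  rw [AlgHom.toLinearMap_apply, barP_cons]
  exact cons_mem_barDeg (by omega) (c.j_mem (c.p_mem hx)) h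

lemma barH_mem_barDeg {m n : ℤ} (hn : m + (-1) = n) {w : Bar X} (hw : w ∈ barDeg X m) :
    c.barH w ∈ barDeg X n := by
  refine barDeg_map_le (by simp [barH_one]) (fun e m x hx w hw h => ?_) hn hw
  rw [barH_cons]
  exact sub_mem (neg_mem (cons_mem_barDeg (by omega) (c.h_mem hx) hw))
    (cons_mem_barDeg (by omega) (c.j_mem (c.p_mem (X.sgn_mem hx))) h)

end Contraction

end Contraction

/-! ### Removal of curvature whose classes vanish. -/

section Kill

variable {k : Type t} [CommRing k] {B : DGAlgebra.{w} k} {E : DGAlgebra.{v} k}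

/-- A cochain whose curvature is exact on the shortest words where it does not vanish can be
corrected. -/
lemma exists_correction (cB : Contraction B) (cE : Contraction E) {τ : Bar B →ₗ[k] E.carrier}
    (h₁ : τ 1 = 0) (hτ : HasDegree τ 1) {n : ℕ} (hn : n ≠ 0)
    (h : ∀ i < n, VanishesOn (curv τ) i)
    (hex : ∀ w ∈ barLen B n, ∃ e, E.d e = curv τ (cB.barP w)) :
    ∃ ζ : Bar B →ₗ[k] E.carrier, HasDegree ζ 1 ∧ (∀ i, i ≠ n → VanishesOn ζ i) ∧
      ∀ i ≤ n, VanishesOn (curv (τ + ζ)) i := by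
  -- The term with `barH` replaces the curvature on `w` by that on the representative `barP w`. The
  -- term with `cE.h` is a primitive of the latter.
  let ζ : Bar B →ₗ[k] E.carrier :=
    -(cE.h ∘ₗ curv τ ∘ₗ cB.barP.toLinearMap + curv τ ∘ₗ cB.barH) ∘ₗ barProj B n
  have hζ : ∀ i, i ≠ n → VanishesOn ζ i := fun i hi w hw => by
    simp only [ζ, LinearMap.neg_apply, LinearMap.comp_apply, barProj_of_ne hi hw, map_zero,
      neg_zero]
  have hζn : ∀ w ∈ barLen B n, ζ w = -(cE.h (curv τ (cB.barP w)) + curv τ (cB.barH w)) := by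
    intro w hw
    simp [ζ, LinearMap.comp_apply, barProj_of_mem hw]
  refine ⟨ζ, ?_, hζ, ?_⟩
  · rintro m _ rfl w hw
    have hw' := barProj_mem_barDeg n hw
    simp only [ζ, LinearMap.comp_apply, LinearMap.neg_apply, LinearMap.add_apply]
    refine neg_mem (add_mem ?_ ?_)
    · have := cE.h_mem (hτ.curv rfl _ (cB.barP_mem_barDeg hw'))
      rwa [show m + 2 - 1 = m + 1 by ring] at this
    · exact hτ.curv (by omega) _ (cB.barH_mem_barDeg rfl hw')
  · intro i hi w hw
    obtain hi | rfl := hi.lt_or_eq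
    · rw [curv_add_of_lt (fun j hj => hζ j hj.ne) hi hw, h i hi w hw]
    · rw [curv_add_of_eq h₁ hn (fun j hj => hζ j hj.ne) hw, hζn _ hw, hζn _ (barD₁_mem hw),
        cB.barP_barD₁, map_zero, map_zero, map_neg, map_add,
        d_curv h₁ hτ.isOdd h (cB.barH_mem hw)]
      obtain ⟨e, he⟩ := hex w hw
      have h₂ := cE.homotopy (curv τ (cB.barP w))
      have h₃ : cE.p (curv τ (cB.barP w)) = 0 := by rw [← he, cE.p_d]
      have h₄ : E.d (curv τ (cB.barP w)) = 0 := by rw [← he, E.d_d]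
      rw [h₃, h₄, map_zero, map_zero, add_zero, sub_zero] at h₂
      have h₅ := congrArg (curv τ) (cB.bar_homotopy w)
      rw [map_add, map_sub] at h₅
      rw [h₂, sub_eq_iff_eq_add.1 h₅.symm]
      abel

end Kill

/-! ### Words given by tuples of letters, and the passage from bar signs to Hochschild signs. -/

section Tuples

open TensorAlgebra TensorProduct

variable {k : Type t} [CommRing k] (B : DGAlgebra.{w} k)

/-- The word with given letters. -/
abbrev word (n : ℕ) : MultilinearMap k (fun _ : Fin n => B.carrier) (Bar B) := tprod k B.carrier n

variable {B}

@[simp] lemma word_zero (x : Fin 0 → B.carrier) : word B 0 x = 1 := by simp [tprod_apply]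

lemma word_succ (n : ℕ) (x : Fin (n + 1) → B.carrier) :
    word B (n + 1) x = ι k (x 0) * word B n (Fin.tail x) := by
  rw [tprod_apply, tprod_apply, List.ofFn_succ, List.prod_cons]
  rfl

lemma word_succ_last (n : ℕ) (x : Fin (n + 1) → B.carrier) :
    word B (n + 1) x = word B n (Fin.init x) * ι k (x (Fin.last n)) := by
  rw [tprod_apply, tprod_apply, List.ofFn_succ_last, List.prod_append, List.prod_singleton]
  rfl

lemma word_mem_barLen {n : ℕ} (x : Fin n → B.carrier) : word B n x ∈ barLen B n := by
  induction n with
  | zero => rw [word_zero]; exact one_mem_barLen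
  | succ n ih => rw [word_succ]; exact cons_mem_barLen _ (ih _)

lemma barLen_word_induction {n : ℕ} {p : Bar B → Prop} (word : ∀ x, p (word B n x))
    (add : ∀ a b, p a → p b → p (a + b)) (smul : ∀ (c : k) a, p a → p (c • a)) (zero : p 0)
    {w : Bar B} (hw : w ∈ barLen B n) : p w := by
  have key : barLen B n ≤ Submodule.span k (Set.range (DGLift.word B n)) := by
    clear hw word
    intro w hw
    induction n generalizing w with
    | zero =>
      refine barLen_zero_induction (p := fun w => w ∈ Submodule.span k _) ?_
        (fun c a ha => Submodule.smul_mem _ _ ha) hw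
      exact Submodule.subset_span ⟨fun _ => 0, word_zero _⟩
    | succ n ih =>
      refine barLen_succ_induction (p := fun w => w ∈ Submodule.span k _) (fun x w hw => ?_)
        (fun a b ha hb => add_mem ha hb) hw
      have : Submodule.span k (Set.range (DGLift.word B n)) ≤
          (Submodule.span k (Set.range (DGLift.word B (n + 1)))).comap
            (LinearMap.mulLeft k (ι k x)) := by
        refine Submodule.span_le.2 ?_
        rintro _ ⟨y, rfl⟩
        refine Submodule.subset_span ⟨Fin.cons x y, ?_⟩
        rw [word_succ]
        rfl
      exact this (ih hw)
  refine Submodule.span_induction ?_ zero (fun a b _ _ => add a b) (fun c a _ => smul c a) (key hw)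
  rintro _ ⟨x, rfl⟩
  exact word x

lemma HomWord.exists_word {m : ℤ} {w : Bar B} (hw : HomWord B m w) :
    ∃ (n : ℕ) (e : Fin n → ℤ) (x : Fin n → B.carrier), (∀ i, x i ∈ B.gr (e i)) ∧
      m = (∑ i, e i) - n ∧ w = word B n x := by
  induction hw with
  | one => exact ⟨0, fun _ => 0, fun _ => 0, fun i => i.elim0, by simp, by simp⟩
  | @cons e m x w hx hw ih =>
    obtain ⟨n, e', x', hx', rfl, rfl⟩ := ih
    refine ⟨n + 1, Fin.cons e e', Fin.cons x x', fun i => ?_, ?_, ?_⟩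
    · induction i using Fin.cases with
      | zero => exact hx
      | succ i => exact hx' i
    · rw [Fin.sum_univ_succ]
      simp only [Fin.cons_zero, Fin.cons_succ]
      push_cast
      ring
    · rw [word_succ]; rfl

lemma word_mem_barDeg {n : ℕ} {e : Fin n → ℤ} {x : Fin n → B.carrier}
    (hx : ∀ i, x i ∈ B.gr (e i)) : word B n x ∈ barDeg B ((∑ i, e i) - n) := by
  induction n with
  | zero => simpa using one_mem_barDeg
  | succ n ih =>
    rw [word_succ]
    refine cons_mem_barDeg ?_ (hx 0) (ih (e := fun i => e i.succ) fun i => hx i.succ)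
    rw [Fin.sum_univ_succ]
    push_cast
    ring

lemma barD₁_word_eq_zero {n : ℕ} {x : Fin n → B.carrier} (hx : ∀ i, B.d (x i) = 0) :
    barD₁ B (word B n x) = 0 := by
  induction n with
  | zero => simp
  | succ n ih => rw [word_succ, barD₁_cons, hx 0, ih (x := Fin.tail x) (fun i => hx i.succ)]; simp

lemma barSgn_word {n : ℕ} (x : Fin n → B.carrier) :
    barSgn B (word B n x) = (-1 : ℤ) ^ n • word B n (fun i => B.sgn (x i)) := by
  induction n with
  | zero => simp
  | succ n ih =>
    rw [word_succ, barSgn_cons, ih, word_succ, mul_smul_comm, pow_succ, mul_neg_one, neg_smul]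
    rfl

lemma Contraction.barP_word (c : Contraction B) {n : ℕ} (x : Fin n → B.carrier) :
    c.barP (word B n x) = word B n (fun i => c.j (c.p (x i))) := by
  induction n with
  | zero => simp
  | succ n ih => rw [word_succ, barP_cons, ih, word_succ]; rfl

lemma sgn_pow_add_two (n : ℕ) : B.sgn ^ (n + 2) = B.sgn ^ n := by
  have : B.sgn ^ 2 = 1 := by
    ext x
    simp [pow_two]
  rw [pow_add, this, mul_one]

lemma sgn_pow_sgn_pow (n : ℕ) (x : B.carrier) : (B.sgn ^ n) ((B.sgn ^ n) x) = x := by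
  rw [← Module.End.mul_apply, ← pow_add]
  induction n with
  | zero => simp
  | succ n ih => rw [show n + 1 + (n + 1) = n + n + 2 by ring, sgn_pow_add_two, ih]

lemma sgn_pow_mul (n : ℕ) (x y : B.carrier) :
    (B.sgn ^ n) (x * y) = (B.sgn ^ n) x * (B.sgn ^ n) y := by
  induction n with
  | zero => simp
  | succ n ih => simp only [pow_succ', Module.End.mul_apply, ih, B.sgn_mul]

lemma sgn_pow_mem (n : ℕ) {e : ℤ} {x : B.carrier} (hx : x ∈ B.gr e) : (B.sgn ^ n) x ∈ B.gr e := by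
  induction n with
  | zero => simpa
  | succ n ih => rw [pow_succ', Module.End.mul_apply]; exact B.sgn_mem ih

lemma d_sgn_pow (n : ℕ) {x : B.carrier} (hx : B.d x = 0) : B.d ((B.sgn ^ n) x) = 0 := by
  induction n with
  | zero => simpa
  | succ n ih => rw [pow_succ', Module.End.mul_apply, B.d_sgn, ih, map_zero, neg_zero]

lemma Contraction.p_sgn_pow (c : Contraction B) (n : ℕ) (x : B.carrier) :
    c.p ((B.sgn ^ n) x) = ((koszulSign B.cohomologyGr 1) ^ n) (c.p x) := by
  induction n with
  | zero => simp
  | succ n ih => rw [pow_succ', Module.End.mul_apply, c.p_sgn, ih, pow_succ', Module.End.mul_apply]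

lemma Contraction.j_sgn_pow (c : Contraction B) (n : ℕ) (a : B.Cohomology) :
    c.j (((koszulSign B.cohomologyGr 1) ^ n) a) = (B.sgn ^ n) (c.j a) := by
  induction n with
  | zero => simp
  | succ n ih => rw [pow_succ', Module.End.mul_apply, c.j_sgn, ih, pow_succ', Module.End.mul_apply]

/-- The signs which are applied to the letters of a word. -/
def twist {n : ℕ} (z : Fin n → B.carrier) : Fin n → B.carrier :=
  fun i => (B.sgn ^ (n - (i.val + 1))) (z i)

variable (B) in
/-- The word with given letters and signs. -/
def twWord (n : ℕ) : MultilinearMap k (fun _ : Fin n => B.carrier) (Bar B) :=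
  (word B n).compLinearMap (fun i => B.sgn ^ (n - (i.val + 1)))

lemma twWord_apply {n : ℕ} (z : Fin n → B.carrier) : twWord B n z = word B n (twist z) := rfl

lemma twist_twist {n : ℕ} (z : Fin n → B.carrier) : twist (twist z) = z :=
  funext fun _ => sgn_pow_sgn_pow _ _

lemma twWord_succ (n : ℕ) (z : Fin (n + 1) → B.carrier) :
    twWord B (n + 1) z = ι k ((B.sgn ^ n) (z 0)) * twWord B n (Fin.tail z) := by
  rw [twWord_apply, word_succ, twWord_apply]
  congr 2
  funext i
  simp [Fin.tail, twist]

lemma twWord_mem_barLen {n : ℕ} (z : Fin n → B.carrier) : twWord B n z ∈ barLen B n :=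
  word_mem_barLen _

/-- Dropping the last letter lowers the length by one, which leaves each remaining letter with one
sign involution too many. The involution in `barSgn` compensates for it. -/
lemma barSgn_init_twist (n : ℕ) (z : Fin (n + 1) → B.carrier) :
    barSgn B (word B n (Fin.init (twist z))) = (-1 : ℤ) ^ n • twWord B n (Fin.init z) := by
  rw [barSgn_word, twWord_apply]
  congr 2
  funext i
  obtain ⟨m, hm⟩ : ∃ m, n = i.val + 1 + m := ⟨n - (i.val + 1), by omega⟩
  simp only [Fin.init, twist, Fin.val_castSucc]
  rw [← Module.End.mul_apply, ← pow_succ', show n + 1 - (i.val + 1) + 1 = m + 2 by omega,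
    sgn_pow_add_two, show n - (i.val + 1) = m by omega]

lemma contractNth_zero_mul {A : Type*} [Mul A] {n : ℕ} (z : Fin (n + 2) → A) :
    Fin.contractNth 0 (· * ·) z = Fin.cons (z 0 * z 1) (Fin.tail (Fin.tail z)) := by
  funext i
  induction i using Fin.cases with
  | zero => simp [Fin.contractNth]
  | succ i => simp [Fin.contractNth, Fin.tail]

lemma contractNth_succ_mul {A : Type*} [Mul A] {n : ℕ} (p : Fin (n + 1)) (z : Fin (n + 2) → A) :
    Fin.contractNth p.succ (· * ·) z =
      Fin.cons (z 0) (Fin.contractNth p (· * ·) (Fin.tail z)) := by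
  funext i
  induction i using Fin.cases with
  | zero => simp [Fin.contractNth]
  | succ i => 
    simp only [Fin.contractNth, Fin.val_succ, Fin.cons_succ, Fin.tail]
    grind

/-- The exponent `n - (i + 1)` counts the letters to the right of position `i`. With this choice the
involutions in `barD₂` match those required by the shorter words, and only the Hochschild signs
`(-1) ^ p` remain. -/
lemma barD₂_twWord (n : ℕ) (z : Fin (n + 1) → B.carrier) :
    barD₂ B (twWord B (n + 1) z) = ∑ p : Fin n, (-1 : ℤ) ^ p.val •
      twWord B n (Fin.contractNth p.castSucc (· * ·) z) := by
  induction n with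
  | zero => rw [twWord_succ, twWord_apply, word_zero, barD₂_cons]; simp
  | succ n ih =>
    rw [twWord_succ, barD₂_cons, ih, Fin.sum_univ_succ]
    have hs : B.sgn ((B.sgn ^ (n + 1)) (z 0)) = (B.sgn ^ n) (z 0) := by
      rw [← Module.End.mul_apply, ← pow_succ', sgn_pow_add_two]
    rw [hs, sub_eq_add_neg]
    congr 1
    · rw [twWord_succ, firstMul_cons, Fin.castSucc_zero, contractNth_zero_mul, twWord_succ]
      simp [sgn_pow_mul, Fin.tail]
    · rw [Finset.mul_sum, ← Finset.sum_neg_distrib]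
      refine Finset.sum_congr rfl fun p _ => ?_
      rw [← Fin.succ_castSucc, contractNth_succ_mul, twWord_succ, Fin.cons_zero, Fin.tail_cons,
        Fin.val_succ, pow_succ, mul_neg_one, neg_smul, mul_smul_comm]

variable {E : DGAlgebra.{v} k}

/-- The cochain which is supported on words of a given length. -/
def liftLen (n : ℕ) (G : MultilinearMap k (fun _ : Fin n => B.carrier) E.carrier) :
    Bar B →ₗ[k] E.carrier :=
  PiTensorProduct.lift G ∘ₗ DirectSum.component k ℕ (fun n => TensorPower k n B.carrier) n ∘ₗ
    (toDirectSum (R := k) (M := B.carrier)).toLinearMap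

lemma liftLen_word {n : ℕ} (G : MultilinearMap k (fun _ : Fin n => B.carrier) E.carrier)
    (x : Fin n → B.carrier) : liftLen n G (word B n x) = G x := by
  simp only [liftLen, LinearMap.comp_apply, AlgHom.toLinearMap_apply, toDirectSum_tensorPower_tprod]
  erw [DirectSum.component.of]
  simp

lemma liftLen_word_of_ne {m n : ℕ} (h : m ≠ n)
    (G : MultilinearMap k (fun _ : Fin n => B.carrier) E.carrier)
    (x : Fin m → B.carrier) : liftLen n G (word B m x) = 0 := by
  simp only [liftLen, LinearMap.comp_apply, AlgHom.toLinearMap_apply, toDirectSum_tensorPower_tprod]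
  erw [DirectSum.component.of]
  simp [h]

end Tuples

/-! ### The Hochschild obstruction and the inductive extension of twisting cochains. -/

section Obstruction

open TensorAlgebra TensorProduct

/-- The Hochschild differential for the bimodule given by a morphism of algebras. -/
def hochHom {k A R : Type*} [CommRing k] [Ring A] [Algebra k A] [Ring R] [Algebra k R]
    (𝒜 : ℤ → Submodule k A) [GradedAlgebra 𝒜] (φ : A →ₐ[k] R) (j : ℤ) (n : ℕ)
    (f : MultilinearMap k (fun _ : Fin n => A) R) (r : Fin (n + 1) → A) : R :=
  φ (koszulSign 𝒜 j (r 0)) * f (Fin.tail r) +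
    ∑ p : Fin n, (-1 : ℤ) ^ (p.val + 1) • f (Fin.contractNth p.castSucc (· * ·) r) +
    (-1 : ℤ) ^ (n + 1) • (f (Fin.init r) * φ (r (Fin.last n)))

variable {k : Type t} [CommRing k] {B : DGAlgebra.{w} k} {E : DGAlgebra.{v} k}

lemma Contraction.p_mul (c : Contraction E) {a b : E.carrier} (ha : E.d a = 0) (hb : E.d b = 0) :
    c.p (a * b) = c.p a * c.p b := by
  have h := c.p_cocycle ((⟨a, ha⟩ : E.cocycles) * ⟨b, hb⟩)
  rw [map_mul, ← c.p_cocycle, ← c.p_cocycle] at h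
  exact h

lemma Contraction.exists_d_eq (c : Contraction E) {a : E.carrier} (ha : E.d a = 0)
    (h : c.p a = 0) : ∃ b, E.d b = a := by
  have := c.p_cocycle ⟨a, ha⟩
  rw [h] at this
  exact (E.proj_eq_zero_iff ⟨a, ha⟩).1 this.symm

lemma d_eq_zero_of_contractNth {n : ℕ} (p : Fin n) {z : Fin (n + 1) → B.carrier}
    (hz : ∀ i, B.d (z i) = 0) (i : Fin n) :
    B.d (Fin.contractNth p.castSucc (· * ·) z i) = 0 := by
  unfold Fin.contractNth
  split_ifs
  · exact hz _
  · rw [B.d_mul, hz, hz]; simp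
  · exact hz _

lemma Contraction.p_contractNth (c : Contraction B) {n : ℕ} (p : Fin n)
    {z : Fin (n + 1) → B.carrier} (hz : ∀ i, B.d (z i) = 0) :
    (fun i => c.p (Fin.contractNth p.castSucc (· * ·) z i)) =
      Fin.contractNth p.castSucc (· * ·) (fun i => c.p (z i)) := by
  funext i
  unfold Fin.contractNth
  split_ifs
  · rfl
  · exact c.p_mul (hz _) (hz _)
  · rfl

lemma Contraction.p_twist (c : Contraction B) {n : ℕ} {z z' : Fin n → B.carrier}
    (h : ∀ i, c.p (z i) = c.p (z' i)) (i : Fin n) : c.p (twist z i) = c.p (twist z' i) := by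
  rw [twist, twist, c.p_sgn_pow, c.p_sgn_pow, h]

variable (cB : Contraction B) (cE : Contraction E)

/-- The cochain which is supported on words of length `n` and given by a cochain on cohomology. -/
def suppCochain {n : ℕ} (g : MultilinearMap k (fun _ : Fin n => B.Cohomology) E.Cohomology) :
    Bar B →ₗ[k] E.carrier :=
  liftLen n (cE.j.compMultilinearMap
    (g.compLinearMap (fun i => cB.p ∘ₗ B.sgn ^ (n - (i.val + 1)))))

section

variable {n : ℕ} (g : MultilinearMap k (fun _ : Fin n => B.Cohomology) E.Cohomology)

lemma suppCochain_word (x : Fin n → B.carrier) :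
    suppCochain cB cE g (word B n x) = cE.j (g fun i => cB.p (twist x i)) := by
  rw [suppCochain, liftLen_word]
  rfl

lemma suppCochain_twWord (z : Fin n → B.carrier) :
    suppCochain cB cE g (twWord B n z) = cE.j (g fun i => cB.p (z i)) := by
  rw [twWord_apply, suppCochain_word, twist_twist]

lemma suppCochain_vanishesOn {m : ℕ} (h : m ≠ n) : VanishesOn (suppCochain cB cE g) m := by
  intro w hw
  refine barLen_word_induction (p := fun w => suppCochain cB cE g w = 0)
    (fun x => liftLen_word_of_ne h _ x) (fun a b ha hb => by rw [map_add, ha, hb, add_zero])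
    (fun c a ha => by rw [map_smul, ha, smul_zero]) (map_zero _) hw

lemma d_suppCochain {w : Bar B} (hw : w ∈ barLen B n) : E.d (suppCochain cB cE g w) = 0 := by
  refine barLen_word_induction (p := fun w => E.d (suppCochain cB cE g w) = 0)
    (fun x => by rw [suppCochain_word, cE.d_j])
    (fun a b ha hb => by rw [map_add, map_add, ha, hb, add_zero])
    (fun c a ha => by rw [map_smul, map_smul, ha, smul_zero]) (by simp) hw

/-- The cochain sees letters only through `p`, so it is unchanged by `barP`, and `barP` annihilates
the image of `barD₁`. -/
lemma suppCochain_barD₁ {w : Bar B} (hw : w ∈ barLen B n) :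
    suppCochain cB cE g (barD₁ B w) = 0 := by
  have key : ∀ w ∈ barLen B n, suppCochain cB cE g w = suppCochain cB cE g (cB.barP w) := by
    intro w hw
    refine barLen_word_induction
      (p := fun w => suppCochain cB cE g w = suppCochain cB cE g (cB.barP w)) (fun x => ?_)
      (fun a b ha hb => by rw [map_add, map_add, map_add, ha, hb])
      (fun c a ha => by rw [map_smul, map_smul, map_smul, ha]) (by simp) hw
    rw [cB.barP_word, suppCochain_word, suppCochain_word]
    congr 2
    funext i
    exact cB.p_twist (fun i => (cB.p_j _).symm) i
  rw [key _ (barD₁_mem hw), cB.barP_barD₁, map_zero]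

lemma hasDegree_suppCochain (hg : g ∈ cochains B.cohomologyGr E.cohomologyGr n (1 - (n : ℤ))) :
    HasDegree (suppCochain cB cE g) 1 := by
  rintro m _ rfl w hw
  have : barDeg B m ≤ (E.gr (m + 1)).comap (suppCochain cB cE g) := by
    refine Submodule.span_le.2 fun w hw => ?_
    obtain ⟨i, e, x, hx, rfl, rfl⟩ := hw.exists_word
    change suppCochain cB cE g (word B i x) ∈ E.gr _
    by_cases hi : i = n
    · subst hi
      rw [suppCochain_word]
      refine cE.j_mem ?_
      rw [show (∑ t, e t) - (i : ℤ) + 1 = (∑ t, e t) + (1 - (i : ℤ)) by ring]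
      exact hg e _ fun t => cB.p_mem (sgn_pow_mem _ (hx t))
    · rw [suppCochain_vanishesOn cB cE g hi _ (word_mem_barLen x)]
      exact zero_mem _
  exact this hw

end

variable {cB cE}

/-- In length one, vanishing curvature says that `τ` anticommutes with the differentials, since
`barD₁` has a sign on letters. Hence `τ` sends cocycles to cocycles. -/
lemma d_letter {τ : Bar B →ₗ[k] E.carrier} (h₁ : τ 1 = 0) (h : VanishesOn (curv τ) 1)
    {z : B.carrier} (hz : B.d z = 0) : E.d (τ (ι k z)) = 0 := by
  have := h _ (ι_mem_barLen z)
  have h₂ : (ι k z : Bar B) = ι k z * 1 := (mul_one _).symm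
  rw [curv_apply] at this
  rw [h₂, barD₁_cons, barD₂_cons, coprodT_cons, hz] at this
  simpa [h₁] using this

/-- If `barD₁ w = 0`, then `w` and `barP w` differ by `barD₁ (barH w)`, and `d_curv` turns this
difference into a coboundary in `E`. -/
lemma p_curv_barP {τ : Bar B →ₗ[k] E.carrier} (h₁ : τ 1 = 0) (hτ : HasDegree τ 1) {n : ℕ}
    (h : ∀ i < n, VanishesOn (curv τ) i) {w : Bar B} (hw : w ∈ barLen B n)
    (hw' : barD₁ B w = 0) : cE.p (curv τ w) = cE.p (curv τ (cB.barP w)) := by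
  have h₁ := congrArg (fun w => cE.p (curv τ w)) (cB.bar_homotopy w)
  simp only [hw', map_zero, add_zero, map_sub] at h₁
  rw [← d_curv ‹_› hτ.isOdd h (cB.barH_mem hw), cE.p_d] at h₁
  exact (sub_eq_zero.1 h₁.symm)

variable (φ : B.Cohomology →ₐ[k] E.Cohomology)

/-- The cochain induces the given morphism on cohomology. -/
def Induces (cB : Contraction B) (cE : Contraction E) (φ : B.Cohomology →ₐ[k] E.Cohomology)
    (τ : Bar B →ₗ[k] E.carrier) : Prop :=
  ∀ z, B.d z = 0 → cE.p (τ (ι k z)) = φ (cB.p z)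

variable (cB cE) in
/-- The obstruction cochain. -/
def obstruction (τ : Bar B →ₗ[k] E.carrier) (n : ℕ) :
    MultilinearMap k (fun _ : Fin n => B.Cohomology) E.Cohomology :=
  (cE.p ∘ₗ curv τ).compMultilinearMap ((twWord B n).compLinearMap (fun _ => cB.j))

lemma obstruction_apply (τ : Bar B →ₗ[k] E.carrier) (n : ℕ) (r : Fin n → B.Cohomology) :
    obstruction cB cE τ n r = cE.p (curv τ (twWord B n fun i => cB.j (r i))) := rfl

lemma obstruction_mem {τ : Bar B →ₗ[k] E.carrier} (hτ : HasDegree τ 1) (n : ℕ) :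
    obstruction cB cE τ n ∈ cochains B.cohomologyGr E.cohomologyGr n (2 - (n : ℤ)) := by
  intro e r hr
  rw [obstruction_apply]
  refine cE.p_mem (hτ.curv ?_ _ (word_mem_barDeg (e := e) fun i =>
    sgn_pow_mem _ (cB.j_mem (hr i))))
  ring

/-- The class of the lowest curvature on a word of cocycles depends only on the classes of its
letters. This is needed because a product of chosen representatives is not itself a chosen
representative. -/
lemma obstruction_p {τ : Bar B →ₗ[k] E.carrier} (h₁ : τ 1 = 0) (hτ : HasDegree τ 1) {n : ℕ}
    (h : ∀ i < n, VanishesOn (curv τ) i) {z : Fin n → B.carrier} (hz : ∀ i, B.d (z i) = 0) :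
    cE.p (curv τ (twWord B n z)) = obstruction cB cE τ n (fun i => cB.p (z i)) := by
  rw [p_curv_barP (cB := cB) h₁ hτ h (twWord_mem_barLen z)
    (barD₁_word_eq_zero fun i => d_sgn_pow _ (hz i)), obstruction_apply, twWord_apply,
    cB.barP_word, twWord_apply]
  congr 3
  funext i
  rw [twist, twist, cB.p_sgn_pow, cB.j_sgn_pow]

/-- Take the Bianchi identity on a word of representatives and pass to cohomology. The internal
differentials disappear, and what remains is the Hochschild cocycle condition. -/
lemma hochHom_obstruction {τ : Bar B →ₗ[k] E.carrier} (h₁ : τ 1 = 0) (hτ : HasDegree τ 1) {n : ℕ}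
    (hn : 2 ≤ n) (h : ∀ i < n, VanishesOn (curv τ) i) (hφ : Induces cB cE φ τ)
    (r : Fin (n + 1) → B.Cohomology) :
    hochHom B.cohomologyGr φ (2 - (n : ℤ)) n (obstruction cB cE τ n) r = 0 := by
  let z : Fin (n + 1) → B.carrier := fun i => cB.j (r i)
  have hz : ∀ i, B.d (z i) = 0 := fun i => cB.d_j _
  have hpz : (fun i => cB.p (z i)) = r := funext fun i => cB.p_j _
  have hcurv : ∀ {w : Bar B}, w ∈ barLen B n → barD₁ B w = 0 → E.d (curv τ w) = 0 := by
    intro w hw hw'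
    rw [d_curv h₁ hτ.isOdd h hw, hw', map_zero]
  have hb : barD₁ B (twWord B (n + 1) z) = 0 := barD₁_word_eq_zero fun i => d_sgn_pow _ (hz i)
  have key := bianchi h₁ hτ.isOdd h (twWord_mem_barLen (Fin.tail z))
    (word_mem_barLen (Fin.init (twist z))) ((B.sgn ^ n) (z 0)) (twist z (Fin.last n))
    (by rw [← twWord_succ, twWord_apply, word_succ_last])
  rw [← twWord_succ, hb, barD₂_twWord, barSgn_init_twist, map_zero, zero_add] at key
  have hlast : twist z (Fin.last n) = z (Fin.last n) := by simp [twist]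
  rw [hlast] at key
  have key' := congrArg cE.p key
  have ht : barD₁ B (twWord B n (Fin.tail z)) = 0 :=
    barD₁_word_eq_zero fun i => d_sgn_pow _ (hz _)
  have hi : barD₁ B (twWord B n (Fin.init z)) = 0 :=
    barD₁_word_eq_zero fun i => d_sgn_pow _ (hz _)
  rw [map_add, cE.p_d, add_zero, map_add, cE.p_mul (d_letter h₁ (h 1 (by omega))
    (d_sgn_pow _ (hz 0))) (hcurv (twWord_mem_barLen _) ht), map_zsmul, smul_mul_assoc, map_zsmul,
    cE.p_mul (hcurv (twWord_mem_barLen _) hi) (d_letter h₁ (h 1 (by omega)) (hz _)),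
    hφ _ (d_sgn_pow _ (hz 0)), hφ _ (hz _),
    cB.p_sgn_pow, ← koszulSign_pow] at key'
  simp only [map_sum, map_zsmul] at key'
  have hc : ∀ p : Fin n, cE.p (curv τ (twWord B n (Fin.contractNth p.castSucc (· * ·) z))) =
      obstruction cB cE τ n (Fin.contractNth p.castSucc (· * ·) r) := fun p => by
    rw [obstruction_p (cB := cB) h₁ hτ h (d_eq_zero_of_contractNth p hz), cB.p_contractNth p hz,
      hpz]
  simp only [hc] at key'
  rw [cB.p_j, cB.p_j] at key'
  rw [hochHom]
  have e₁ : obstruction cB cE τ n (Fin.tail r) = cE.p (curv τ (twWord B n (Fin.tail z))) := rfl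
  have e₂ : obstruction cB cE τ n (Fin.init r) = cE.p (curv τ (twWord B n (Fin.init z))) := rfl
  rw [e₁, key', ← e₂]
  simp only [pow_succ, mul_neg_one, neg_smul, Finset.sum_neg_distrib]
  abel

/-- The freedom to change `τ` by a cocycle-valued cochain in length `n` moves the obstruction in
length `n + 1` by the coboundary of `g`. -/
lemma p_curv_add_suppCochain {τ : Bar B →ₗ[k] E.carrier} (h₁ : τ 1 = 0) {n : ℕ} (hn : 2 ≤ n)
    (h : VanishesOn (curv τ) 1) (hφ : Induces cB cE φ τ)
    (g : MultilinearMap k (fun _ : Fin n => B.Cohomology) E.Cohomology)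
    (r : Fin (n + 1) → B.Cohomology) :
    cE.p (curv (τ + suppCochain cB cE g) (twWord B (n + 1) fun i => cB.j (r i))) =
      obstruction cB cE τ (n + 1) r -
        hochHom B.cohomologyGr φ (2 - ((n + 1 : ℕ) : ℤ)) n g r := by
  let z : Fin (n + 1) → B.carrier := fun i => cB.j (r i)
  have hz : ∀ i, B.d (z i) = 0 := fun i => cB.d_j _
  have hpz : (fun i => cB.p (z i)) = r := funext fun i => cB.p_j _
  set η := suppCochain cB cE g with hη
  have key := curv_add_of_succ (τ := τ) hn (fun i hi => suppCochain_vanishesOn cB cE g hi)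
    (twWord_mem_barLen (Fin.tail z))
    (word_mem_barLen (Fin.init (twist z))) ((B.sgn ^ n) (z 0)) (twist z (Fin.last n))
    (by rw [← twWord_succ, twWord_apply, word_succ_last])
  have hlast : twist z (Fin.last n) = z (Fin.last n) := by simp [twist]
  rw [← twWord_succ, barD₂_twWord, barSgn_init_twist, hlast, ← hη, ← Module.End.mul_apply,
    ← pow_succ', map_zsmul, smul_mul_assoc] at key
  have hdη : ∀ w ∈ barLen B n, E.d (η w) = 0 := fun w hw => d_suppCochain cB cE g hw
  have hpη : ∀ y : Fin n → B.carrier, cE.p (η (twWord B n y)) = g (fun i => cB.p (y i)) :=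
    fun y => by rw [hη, suppCochain_twWord, cE.p_j]
  have key' := congrArg cE.p key
  rw [map_add, map_sub, map_add, map_zsmul,
    cE.p_mul (d_letter h₁ h (d_sgn_pow _ (hz 0))) (hdη _ (twWord_mem_barLen _)),
    cE.p_mul (hdη _ (twWord_mem_barLen _)) (d_letter h₁ h (hz _)),
    hφ _ (d_sgn_pow _ (hz 0)), hφ _ (hz _), cB.p_sgn_pow, ← koszulSign_pow, cB.p_j, cB.p_j] at key'
  simp only [map_sum, map_zsmul, hpη, cB.p_contractNth _ hz, hpz] at key'
  refine key'.trans ?_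
  rw [hochHom, obstruction_apply]
  have e₁ : (fun i => cB.p (Fin.tail z i)) = Fin.tail r := funext fun i => cB.p_j _
  have e₂ : (fun i => cB.p (Fin.init z i)) = Fin.init r := funext fun i => cB.p_j _
  rw [e₁, e₂]
  simp only [pow_succ, mul_neg_one, neg_smul, Finset.sum_neg_distrib]
  abel

/-- The curvature is exact on words of representatives once its classes vanish. -/
lemma exists_primitive_curv {τ : Bar B →ₗ[k] E.carrier} (h₁ : τ 1 = 0) (hτ : HasDegree τ 1) {n : ℕ}
    (h : ∀ i < n, VanishesOn (curv τ) i)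
    (h₀ : ∀ r : Fin n → B.Cohomology, cE.p (curv τ (twWord B n fun i => cB.j (r i))) = 0)
    {w : Bar B} (hw : w ∈ barLen B n) : ∃ e, E.d e = curv τ (cB.barP w) := by
  refine cE.exists_d_eq ?_ ?_
  · rw [d_curv h₁ hτ.isOdd h (cB.barP_mem hw), cB.barD₁_barP, map_zero]
  · refine barLen_word_induction (p := fun w => cE.p (curv τ (cB.barP w)) = 0) (fun x => ?_)
      (fun a b ha hb => by rw [map_add, map_add, map_add, ha, hb, add_zero])
      (fun c a ha => by rw [map_smul, map_smul, map_smul, ha, smul_zero]) (by simp) hw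
    have := h₀ (fun i => cB.p (twist x i))
    rw [cB.barP_word]
    convert this using 3
    rw [twWord_apply]
    congr 1
    funext i
    rw [twist, twist, cB.p_sgn_pow, cB.j_sgn_pow, sgn_pow_sgn_pow]

lemma Induces.add {φ : B.Cohomology →ₐ[k] E.Cohomology} {τ η : Bar B →ₗ[k] E.carrier}
    (h : Induces cB cE φ τ) (hη : VanishesOn η 1) : Induces cB cE φ (τ + η) := fun z hz => by
  rw [LinearMap.add_apply, hη _ (ι_mem_barLen z), add_zero, h z hz]

variable (cB cE) in
/-- A cochain of degree one which induces a given morphism, and whose curvature vanishes on words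
of length at most `n`. -/
structure IsPartialLift (φ : B.Cohomology →ₐ[k] E.Cohomology) (n : ℕ)
    (τ : Bar B →ₗ[k] E.carrier) : Prop where
  map_one : τ 1 = 0
  degree : HasDegree τ 1
  flat : ∀ i ≤ n, VanishesOn (curv τ) i
  induces : Induces cB cE φ τ

/-- The Hochschild cocycles which can occur as obstructions are coboundaries. -/
def Unobstructed (φ : B.Cohomology →ₐ[k] E.Cohomology) : Prop :=
  ∀ n : ℕ, 2 ≤ n → ∀ f ∈ cochains B.cohomologyGr E.cohomologyGr (n + 1) (2 - ((n + 1 : ℕ) : ℤ)),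
    (∀ r, hochHom B.cohomologyGr φ (2 - ((n + 1 : ℕ) : ℤ)) (n + 1) f r = 0) →
    ∃ g ∈ cochains B.cohomologyGr E.cohomologyGr n (2 - ((n + 1 : ℕ) : ℤ)),
      ∀ r, hochHom B.cohomologyGr φ (2 - ((n + 1 : ℕ) : ℤ)) n g r = f r

variable {φ}

/-- The correction has two parts: `suppCochain` of a Hochschild primitive in length `n`, which keeps
flatness in length `n` because it is closed, and then `ζ` in length `n + 1`. Lengths below `n` are
never touched, which gives convergence. -/
lemma IsPartialLift.exists_next (hu : Unobstructed φ) {n : ℕ} (hn : 2 ≤ n)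
    {τ : Bar B →ₗ[k] E.carrier} (h : IsPartialLift cB cE φ n τ) :
    ∃ η : Bar B →ₗ[k] E.carrier, IsPartialLift cB cE φ (n + 1) (τ + η) ∧
      ∀ i < n, VanishesOn η i := by
  have hlt : ∀ i < n + 1, VanishesOn (curv τ) i := fun i hi => h.flat i (by omega)
  -- The obstruction has arity `n + 1` and degree `2 - (n + 1) = 1 - n`, which is the degree a
  -- cochain of arity `n` needs in order to be added to `τ`.
  obtain ⟨g, hg, hg'⟩ := hu n hn _ (obstruction_mem h.degree (n + 1))
    (hochHom_obstruction φ h.map_one h.degree (by omega) hlt h.induces)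
  set η := suppCochain cB cE g with hη
  have hv : ∀ i, i ≠ n → VanishesOn η i := fun i hi => suppCochain_vanishesOn cB cE g hi
  have h₁ : (τ + η) 1 = 0 := by
    rw [LinearMap.add_apply, h.map_one, hv 0 (by omega) _ one_mem_barLen, add_zero]
  have hd : HasDegree (τ + η) 1 := h.degree.add (hasDegree_suppCochain cB cE g (by
    rw [show (1 : ℤ) - n = 2 - ((n + 1 : ℕ) : ℤ) by push_cast; ring]
    exact hg))
  have hlt' : ∀ i < n + 1, VanishesOn (curv (τ + η)) i := by
    intro i hi w hw
    obtain hi | rfl := (Nat.lt_succ_iff.1 hi).lt_or_eq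
    · rw [curv_add_of_lt (fun j hj => hv j hj.ne) hi hw, h.flat i hi.le w hw]
    · rw [curv_add_of_eq h.map_one (by omega) (fun j hj => hv j hj.ne) hw, h.flat i le_rfl w hw,
        hη, suppCochain_barD₁ cB cE g hw, d_suppCochain cB cE g hw]
      simp
  obtain ⟨ζ, hζ, hζ', hζ''⟩ := exists_correction cB cE h₁ hd n.succ_ne_zero hlt'
    (fun w hw => exists_primitive_curv h₁ hd hlt' (fun r => by
      rw [hη, p_curv_add_suppCochain φ h.map_one hn (h.flat 1 (by omega)) h.induces, hg',
        sub_self]) hw)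
  refine ⟨η + ζ, ⟨?_, ?_, ?_, ?_⟩, fun i hi w hw => ?_⟩
  · rw [← add_assoc, LinearMap.add_apply, h₁, hζ' 0 (by omega) _ one_mem_barLen, add_zero]
  · rw [← add_assoc]
    exact hd.add hζ
  · rw [← add_assoc]
    exact hζ''
  · rw [← add_assoc]
    exact (h.induces.add (hv 1 (by omega))).add (hζ' 1 (by omega))
  · rw [LinearMap.add_apply, hv i hi.ne w hw, hζ' i (by omega) w hw, add_zero]

/-- Start with `j φ p` on letters. Its curvature on two representatives is the failure of `j φ p` to
be multiplicative, whose class vanishes because `φ` and the projections to cohomology are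
multiplicative. -/
lemma exists_isPartialLift_two (hφ : ∀ ⦃n : ℤ⦄, ∀ a ∈ B.cohomologyGr n, φ a ∈ E.cohomologyGr n) :
    ∃ τ, IsPartialLift cB cE φ 2 τ := by
  let g : MultilinearMap k (fun _ : Fin 1 => B.Cohomology) E.Cohomology :=
    MultilinearMap.ofSubsingleton k B.Cohomology E.Cohomology (0 : Fin 1) φ.toLinearMap
  have hg : ∀ r, g r = φ (r 0) := fun r => rfl
  set η := suppCochain cB cE g with hη
  have hv : ∀ i, i ≠ 1 → VanishesOn η i := fun i hi => suppCochain_vanishesOn cB cE g hi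
  have h₁ : η 1 = 0 := hv 0 (by omega) _ one_mem_barLen
  have hl : ∀ x, η (ι k x) = cE.j (φ (cB.p x)) := fun x => by
    have := suppCochain_word cB cE g (fun _ => x)
    rw [word_succ, word_zero, mul_one, hg] at this
    simpa [twist] using this
  have hd : HasDegree η 1 := hasDegree_suppCochain cB cE g (fun e r hr => by
    rw [hg]
    simpa using hφ _ (hr 0))
  have hlt : ∀ i < 2, VanishesOn (curv η) i := by
    intro i hi w hw
    have h₀ : (0 : Bar B →ₗ[k] E.carrier) + η = η := zero_add η
    have hc : curv (0 : Bar B →ₗ[k] E.carrier) w = 0 := by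
      rw [curv_apply, coprodT_eq_zero (fun _ _ _ _ => rfl) hw]
      simp
    rw [← h₀]
    obtain hi | rfl := (Nat.lt_succ_iff.1 hi).lt_or_eq
    · rw [curv_add_of_lt (fun j hj => hv j hj.ne) hi hw, hc]
    · rw [curv_add_of_eq (by simp) (by omega) (fun j hj => hv j hj.ne) hw, hc,
        hη, suppCochain_barD₁ cB cE g hw, d_suppCochain cB cE g hw]
      simp
  have hi : Induces cB cE φ η := fun z hz => by rw [hl, cE.p_j]
  obtain ⟨ζ, hζ, hζ', hζ''⟩ := exists_correction cB cE h₁ hd two_ne_zero hlt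
    (fun w hw => exists_primitive_curv h₁ hd hlt (fun r => by
      set z : Fin 2 → B.carrier := fun i => cB.j (r i)
      have hz : ∀ i, B.d (z i) = 0 := fun i => cB.d_j _
      have e₁ : twWord B 2 z = ι k (B.sgn (z 0)) * (ι k (z 1) * 1) := by
        rw [twWord_succ, twWord_succ, twWord_apply, word_zero]
        simp [Fin.tail]
      have e₂ : η (ι k (B.sgn (z 0)) * (ι k (z 1) * 1)) = 0 :=
        hv 2 (by omega) _ (cons_mem_barLen _ (cons_mem_barLen _ one_mem_barLen))
      rw [e₁, curv_apply, e₂, barD₂_cons, barD₂_cons, coprodT_cons, coprodT_cons, e₂,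
        barD₁_cons, barD₁_cons, B.d_sgn, hz, hz, firstMul_cons]
      simp only [map_zero, neg_zero, mul_one, mul_zero, zero_mul, zero_sub, sub_zero, barD₁_one,
        barD₂_one, coprodT_one, B.sgn_sgn, map_neg, consT_tmul, hatMap_tmul, zero_add,
        TensorProduct.tmul_zero, firstMul_one, add_zero, map_add, hl]
      rw [cE.p_j, cB.p_mul (hz 0) (hz 1), map_mul, cE.p_mul (cE.d_j _) (cE.d_j _), cE.p_j, cE.p_j,
        add_neg_cancel]) hw)
  exact ⟨η + ζ, by rw [LinearMap.add_apply, h₁, hζ' 0 (by omega) _ one_mem_barLen, add_zero],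
    hd.add hζ, hζ'', hi.add (hζ' 1 (by omega))⟩

end Obstruction

/-! ### The limit of the partial twisting cochains. -/

section Limit

open TensorAlgebra

variable {k : Type t} [Field k] {B : DGAlgebra.{w} k} {E : DGAlgebra.{v} k}

/-- An unobstructed morphism on cohomology is induced by a twisting cochain. -/
theorem exists_twistingCochain {φ : B.Cohomology →ₐ[k] E.Cohomology}
    (hφ : ∀ ⦃n : ℤ⦄, ∀ a ∈ B.cohomologyGr n, φ a ∈ E.cohomologyGr n) (hu : Unobstructed φ) :
    ∃ τ : Bar B →ₗ[k] E.carrier, τ 1 = 0 ∧ HasDegree τ 1 ∧ curv τ = 0 ∧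
      ∀ (z : B.cocycles) (hz : E.d (τ (ι k z)) = 0), E.proj ⟨τ (ι k z), hz⟩ = φ (B.proj z) := by
  obtain ⟨cB⟩ := nonempty_contraction_cohomology B
  obtain ⟨cE⟩ := nonempty_contraction_cohomology E
  obtain ⟨τ₂, hτ₂⟩ := exists_isPartialLift_two (cB := cB) (cE := cE) hφ
  choose next hnext hnext' using fun (n : ℕ) (τ : {τ // IsPartialLift cB cE φ (n + 2) τ}) =>
    τ.2.exists_next hu (by omega)
  let seq : ∀ n : ℕ, {τ // IsPartialLift cB cE φ (n + 2) τ} := fun n =>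
    Nat.rec ⟨τ₂, hτ₂⟩ (fun n τ => ⟨τ.1 + next n τ, hnext n τ⟩) n
  have hseq : ∀ n, (seq (n + 1)).1 = (seq n).1 + next n (seq n) := fun n => rfl
  have stable : ∀ i n, i ≤ n → ∀ w ∈ barLen B i, (seq n).1 w = (seq i).1 w := by
    intro i n hin w hw
    induction n, hin using Nat.le_induction with
    | base => rfl
    | succ n hin ih =>
      rw [hseq, LinearMap.add_apply, hnext' n (seq n) i (by omega) w hw, add_zero, ih]
  -- The step from `seq n` changes only lengths at least `n + 2`, so on length `n` the value of `seq
  -- n` is already final.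
  let τ : Bar B →ₗ[k] E.carrier :=
    gradedLift (barLen B) fun n => (seq n).1 ∘ₗ (barLen B n).subtype
  have hτ : ∀ n, ∀ w ∈ barLen B n, τ w = (seq n).1 w := fun n w hw => gradedLift_of_mem _ _ hw
  have hcurv : ∀ n, VanishesOn (curv τ) n := by
    intro n w hw
    -- The curvature on length `n` involves the cochain only on lengths at most `n`.
    have h : ∀ i < n + 1, VanishesOn (τ - (seq n).1) i := fun i hi w hw => by
      rw [LinearMap.sub_apply, hτ i w hw, stable i n (by omega) w hw, sub_self]
    have := curv_add_of_lt (τ := (seq n).1) h n.lt_succ_self hw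
    rw [add_sub_cancel] at this
    rw [this]
    exact (seq n).2.flat n (by omega) w hw
  refine ⟨τ, ?_, ?_, ?_, fun z hz => ?_⟩
  · rw [hτ 0 _ one_mem_barLen]
    exact (seq 0).2.map_one
  · rintro m _ rfl w hw
    have : barDeg B m ≤ (E.gr (m + 1)).comap τ := by
      refine Submodule.span_le.2 fun w hw => ?_
      obtain ⟨i, hi⟩ := hw.exists_mem_barLen
      change τ w ∈ E.gr _
      rw [hτ i w hi]
      exact (seq i).2.degree rfl w (Submodule.subset_span hw)
    exact this hw
  · refine barDeg_hom_ext fun m w hw => ?_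
    obtain ⟨i, hi⟩ := hw.exists_mem_barLen
    rw [hcurv i w hi, LinearMap.zero_apply]
  · rw [← cE.p_cocycle, ← cB.p_cocycle]
    change cE.p (τ (ι k z)) = _
    rw [hτ 1 _ (ι_mem_barLen _)]
    exact (seq 1).2.induces z z.2

end Limit

/-! ### Cochains of all degrees between two complexes, as one module with composition and
differential. -/

section TotalHom

open CochainComplex CochainComplex.HomComplex

variable (k : Type t) [CommRing k] {C : Type u} [Category.{v} C] [Preadditive C] [Linear k C]

/-- The direct sum of the cochains of all degrees between two complexes. -/
abbrev Tot (K L : CochainComplex C ℤ) : Type v := ⨁ n : ℤ, Cochain K L n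

variable {K L M P : CochainComplex C ℤ}

/-- The inclusion of the cochains of degree `n`. -/
def tot (n : ℤ) : Cochain K L n →ₗ[k] Tot K L := DirectSum.lof k ℤ (fun n => Cochain K L n) n

lemma tot_injective (n : ℤ) : Function.Injective (tot k n : Cochain K L n →ₗ[k] Tot K L) :=
  DirectSum.of_injective (β := fun n => Cochain K L n) n

variable {k}

lemma tot_hom_ext {Y : Type*} [AddCommMonoid Y] [Module k Y] {f g : Tot K L →ₗ[k] Y}
    (h : ∀ n (z : Cochain K L n), f (tot k n z) = g (tot k n z)) : f = g :=
  DirectSum.linearMap_ext k fun n => LinearMap.ext (h n)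

/-- The linear map on the direct sum with given components. -/
def totLift {Y : Type*} [AddCommMonoid Y] [Module k Y] (f : ∀ n, Cochain K L n →ₗ[k] Y) :
    Tot K L →ₗ[k] Y :=
  DirectSum.toModule k ℤ Y f

@[simp] lemma totLift_tot {Y : Type*} [AddCommMonoid Y] [Module k Y]
    (f : ∀ n, Cochain K L n →ₗ[k] Y) (n : ℤ) (z : Cochain K L n) :
    totLift f (tot k n z) = f n z :=
  DirectSum.toModule_lof k n z

/-- The composition of cochains on the direct sums, as a biadditive map. -/
def totCompAdd : Tot K L →+ Tot L M →+ Tot K M :=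
  DirectSum.toAddMonoid fun a => AddMonoidHom.flip
    (DirectSum.toAddMonoid fun b => AddMonoidHom.flip
      (AddMonoidHom.mk' (fun x => (DirectSum.of (fun n => Cochain K M n) (a + b)).comp
        (AddMonoidHom.mk' (fun y => Cochain.comp x y rfl) fun _ _ => Cochain.comp_add _ _ _ _))
        fun x x' => by
          ext y : 1
          simp [Cochain.add_comp]))

lemma totCompAdd_tot {a b c : ℤ} (h : a + b = c) (x : Cochain K L a) (y : Cochain L M b) :
    totCompAdd (tot k a x) (tot k b y) = tot k c (x.comp y h) := by
  subst h
  simp only [totCompAdd, tot, DirectSum.lof_eq_of, DirectSum.toAddMonoid_of]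
  rw [AddMonoidHom.flip_apply, DirectSum.toAddMonoid_of]
  rfl

variable (k) in
lemma tot_induction {p : Tot K L → Prop} (x : Tot K L) (zero : p 0)
    (tot : ∀ n z, p (tot k n z)) (add : ∀ x y, p x → p y → p (x + y)) : p x := by
  induction x using DirectSum.induction_on with
  | zero => exact zero
  | of n z => exact tot n z
  | add x y hx hy => exact add x y hx hy

variable (k) in
/-- The composition of cochains on the direct sums. -/
def totComp : Tot K L →ₗ[k] Tot L M →ₗ[k] Tot K M :=
  LinearMap.mk₂ k (fun x y => totCompAdd x y)
    (fun x x' y => by rw [map_add, AddMonoidHom.add_apply])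
    (fun c x y => by
      induction x using tot_induction (k := k) (C := C) with
      | zero => simp
      | add x x' h h' => simp only [map_add, smul_add, AddMonoidHom.add_apply, h, h']
      | tot a x =>
        induction y using tot_induction (k := k) (C := C) with
        | zero => simp
        | add y y' h h' => simp only [map_add, smul_add, h, h']
        | tot b y =>
          rw [← map_smul, totCompAdd_tot rfl, totCompAdd_tot rfl, ← map_smul, Cochain.smul_comp])
    (fun x y y' => map_add _ _ _)
    (fun c x y => by
      induction x using tot_induction (k := k) (C := C) with
      | zero => simp
      | add x x' h h' => simp only [map_add, smul_add, AddMonoidHom.add_apply, h, h']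
      | tot a x =>
        induction y using tot_induction (k := k) (C := C) with
        | zero => simp
        | add y y' h h' => simp only [map_add, smul_add, h, h']
        | tot b y =>
          rw [← map_smul, totCompAdd_tot rfl, totCompAdd_tot rfl, ← map_smul, Cochain.comp_smul])

lemma totComp_tot {a b c : ℤ} (h : a + b = c) (x : Cochain K L a) (y : Cochain L M b) :
    totComp k (tot k a x) (tot k b y) = tot k c (x.comp y h) :=
  totCompAdd_tot h x y

lemma totComp_assoc (x : Tot K L) (y : Tot L M) (z : Tot M P) :
    totComp k (totComp k x y) z = totComp k x (totComp k y z) := by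
  induction x using tot_induction (k := k) (C := C) with
  | zero => simp
  | add x x' h h' => simp only [map_add, LinearMap.add_apply, h, h']
  | tot a x =>
    induction y using tot_induction (k := k) (C := C) with
    | zero => simp
    | add y y' h h' => simp only [map_add, LinearMap.add_apply, h, h']
    | tot b y =>
      induction z using tot_induction (k := k) (C := C) with
      | zero => simp
      | add z z' h h' => simp only [map_add, h, h']
      | tot c z =>
        rw [totComp_tot rfl, totComp_tot rfl, totComp_tot rfl, totComp_tot (add_assoc a b c).symm,
          Cochain.comp_assoc _ _ _ rfl rfl rfl]

variable (k) in
/-- The identity cochain. -/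
def totOne (K : CochainComplex C ℤ) : Tot K K := tot k 0 (Cochain.ofHom (𝟙 K))

@[simp] lemma totComp_one (x : Tot K L) : totComp k x (totOne k L) = x := by
  induction x using tot_induction (k := k) (C := C) with
  | zero => simp
  | add x x' h h' => simp only [map_add, LinearMap.add_apply, h, h']
  | tot a x => rw [totOne, totComp_tot (add_zero a), Cochain.comp_id]

@[simp] lemma totOne_comp (x : Tot K L) : totComp k (totOne k K) x = x := by
  induction x using tot_induction (k := k) (C := C) with
  | zero => simp
  | add x x' h h' => simp only [map_add, h, h']
  | tot a x => rw [totOne, totComp_tot (zero_add a), Cochain.id_comp]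

variable (k) in
/-- The sign involution on the direct sum of the cochains. -/
def totSgn : Tot K L →ₗ[k] Tot K L := totLift fun n => ((n.negOnePow : ℤ)) • tot k n

@[simp] lemma totSgn_tot (n : ℤ) (x : Cochain K L n) :
    totSgn k (tot k n x) = (n.negOnePow : ℤ) • tot k n x := by
  simp [totSgn]

variable (k) in
/-- The differential on the direct sum of the cochains. -/
def totD : Tot K L →ₗ[k] Tot K L := totLift fun n => tot k (n + 1) ∘ₗ δ_hom k K L n (n + 1)

lemma totD_tot {n m : ℤ} (h : n + 1 = m) (x : Cochain K L n) :
    totD k (tot k n x) = tot k m (δ n m x) := by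
  subst h
  simp [totD]

variable (k) in
/-- The differential of a complex, as a cochain of degree one. -/
def totDiff (K : CochainComplex C ℤ) : Tot K K := tot k 1 (Cochain.diff K)

/-- Writing the differential as a graded commutator with the differentials of the complexes turns
later statements about chain maps and homotopies into algebra in `Tot`. -/
lemma totD_eq (x : Tot K L) :
    totD k x = totComp k x (totDiff k L) - totComp k (totDiff k K) (totSgn k x) := by
  induction x using tot_induction (k := k) (C := C) with
  | zero => simp
  | add x x' h h' =>
    simp only [map_add, LinearMap.add_apply, h, h']
    abel
  | tot a x =>
    rw [totD_tot rfl, totSgn_tot, totDiff, totDiff, map_zsmul, totComp_tot rfl,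
      totComp_tot (add_comm 1 a), ← map_zsmul, ← map_sub]
    congr 1
    ext p q hpq
    rw [δ_v a (a + 1) rfl x p q hpq (q - 1) (p + 1) rfl rfl]
    rw [Cochain.sub_v, Cochain.comp_v x (Cochain.diff L) rfl p (q - 1) q (by omega) (by omega),
      Cochain.smul_v, Cochain.comp_v (Cochain.diff K) x _ p (p + 1) q rfl (by omega),
      Cochain.diff_v,
      Cochain.diff_v, Int.negOnePow_succ, Units.neg_smul, ← sub_eq_add_neg, Units.smul_def]

lemma totD_totD (x : Tot K L) : totD k (totD k x) = 0 := by
  induction x using tot_induction (k := k) (C := C) with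
  | zero => simp
  | add x x' h h' => simp only [map_add, h, h', add_zero]
  | tot a x => rw [totD_tot rfl, totD_tot rfl, δ_δ, map_zero]

@[simp] lemma totDiff_totDiff (K : CochainComplex C ℤ) :
    totComp k (totDiff k K) (totDiff k K) = 0 := by
  rw [totDiff, totComp_tot rfl]
  rw [show (Cochain.diff K).comp (Cochain.diff K) (rfl : (1 : ℤ) + 1 = 1 + 1) = 0 from ?_, map_zero]
  ext p q hpq
  rw [Cochain.comp_v _ _ _ p (p + 1) q rfl (by omega)]
  simp

end TotalHom

/-! ### The endomorphism DG-algebra of a complex. -/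

section EndDG

open CochainComplex CochainComplex.HomComplex

variable (k : Type t) [CommRing k] {C : Type u} [Category.{v} C] [Preadditive C] [Linear k C]
  (I : CochainComplex C ℤ)

/-- The endomorphisms of a complex form a ring, where the product is the composition in the
functional order. -/
instance : Ring (Tot I I) :=
  { (inferInstance : AddCommGroup (Tot I I)) with
    mul := fun x y => totCompAdd y x
    one := DirectSum.of (fun n => Cochain I I n) 0 (Cochain.ofHom (𝟙 I))
    left_distrib := fun x y z => by
      change totCompAdd (y + z) x = totCompAdd y x + totCompAdd z x
      rw [map_add, AddMonoidHom.add_apply]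
    right_distrib := fun x y z => map_add (totCompAdd z) x y
    zero_mul := fun x => map_zero (totCompAdd x)
    mul_zero := fun x => by
      change totCompAdd 0 x = 0
      rw [map_zero, AddMonoidHom.zero_apply]
    mul_assoc := fun x y z => (totComp_assoc (k := ℤ) z y x).symm
    one_mul := fun x => totComp_one (k := ℤ) x
    mul_one := fun x => totOne_comp (k := ℤ) x }

variable {I} in
lemma tot_mul (x y : Tot I I) : x * y = totComp k y x := rfl

lemma tot_one : (1 : Tot I I) = totOne k I := rfl

instance : Algebra k (Tot I I) :=
  Algebra.ofModule
    (fun c x y => map_smul (totComp k y) c x)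
    (fun c x y => by rw [tot_mul k, tot_mul k, map_smul, LinearMap.smul_apply])

/-- The endomorphisms of degree `n` of a complex. -/
def endGr (n : ℤ) : Submodule k (Tot I I) :=
  LinearMap.range (tot k n : Cochain I I n →ₗ[k] Tot I I)

instance : SetLike.GradedMonoid (endGr k I) where
  one_mem := ⟨Cochain.ofHom (𝟙 I), rfl⟩
  mul_mem := by
    rintro i j _ _ ⟨x, rfl⟩ ⟨y, rfl⟩
    exact ⟨y.comp x (add_comm j i), (totComp_tot (add_comm j i) y x).symm⟩

instance : DirectSum.Decomposition (endGr k I) :=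
  DirectSum.Decomposition.ofLinearMap _
    (totLift fun n => DirectSum.lof k ℤ (fun n => endGr k I n) n ∘ₗ
      (tot k n : Cochain I I n →ₗ[k] Tot I I).codRestrict (endGr k I n) fun z => ⟨z, rfl⟩)
    (tot_hom_ext fun n z => by
      rw [LinearMap.comp_apply, totLift_tot, LinearMap.comp_apply, DirectSum.coeLinearMap_lof]
      rfl)
    (DirectSum.linearMap_ext k fun n => by
      ext ⟨_, z, rfl⟩ : 1
      rw [LinearMap.comp_apply, LinearMap.comp_apply, DirectSum.coeLinearMap_lof, totLift_tot]
      rfl)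

instance : GradedAlgebra (endGr k I) where

/-- The DG-algebra of endomorphisms of a complex. -/
abbrev endDG : DGAlgebra.{v} k where
  carrier := Tot I I
  gr := endGr k I
  d := totD k (K := I) (L := I)
  d_mem := by
    rintro n _ ⟨x, rfl⟩
    exact ⟨δ n (n + 1) x, (totD_tot rfl x).symm⟩
  d_d := totD_totD
  leibniz := by
    rintro n _ ⟨x, rfl⟩ y
    change totD k (totComp k (K := I) (L := I) (M := I) y (tot k n x)) =
      totComp k (K := I) (L := I) (M := I) y (totD k (tot k n x)) +
        (n.negOnePow : ℤ) • totComp k (K := I) (L := I) (M := I) (totD k y) (tot k n x)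
    induction y using tot_induction (k := k) (C := C) with
    | zero => simp
    | add y y' h h' =>
      simp only [map_add, LinearMap.add_apply, h, h', smul_add]
      abel
    | tot m y =>
      rw [totComp_tot rfl, totD_tot rfl, totD_tot rfl, totD_tot rfl,
          totComp_tot (by omega : m + (n + 1) = m + n + 1),
        totComp_tot (by omega : m + 1 + n = m + n + 1),
        δ_comp y x rfl (m + 1) (n + 1) (m + n + 1) rfl rfl rfl,
        ← map_zsmul, ← map_add, Units.smul_def]

lemma endDG_sgn (x : (endDG k I).carrier) :
    (endDG k I).sgn x = totSgn k (K := I) (L := I) x := by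
  induction x using tot_induction (k := k) (C := C) with
  | zero => exact (map_zero _).trans (map_zero (totSgn k (K := I) (L := I))).symm
  | add x y hx hy => exact (map_add _ _ _).trans ((congrArg₂ _ hx hy).trans (map_add (totSgn k
      (K := I) (L := I)) _ _).symm)
  | tot n x =>
    refine ((endDG k I).sgn_of_mem (i := n) ⟨x, rfl⟩).trans (totSgn_tot n x).symm

end EndDG

/-! ### Coproducts of shifted copies of a graded object. -/

section Copower

open CochainComplex CochainComplex.HomComplex Limits

variable {C : Type u} [Category.{v} C] [Preadditive C] {S : Type w} [HasCoproductsOfShape S C]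
  (I : CochainComplex C ℤ) (deg : S → ℤ)

lemma XIsoOfEq_hom_comp_v {K L : CochainComplex C ℤ} {n : ℤ} (z : Cochain K L n) {p p' q : ℤ}
    (h : p = p') (hq : p' + n = q) :
    (HomologicalComplex.XIsoOfEq K h).hom ≫ z.v p' q hq = z.v p q (h ▸ hq) := by
  subst h
  simp

/-- The coproduct of shifted copies of a graded object, with zero differential. -/
abbrev copower : CochainComplex C ℤ where
  X p := ∐ fun u : S => I.X (p - deg u)
  d _ _ := 0

/-- The inclusion of a summand of a coproduct of shifted copies. -/
def copowerι (u : S) : Cochain I (copower I deg) (deg u) :=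
  Cochain.mk fun p q h =>
    (HomologicalComplex.XIsoOfEq I (by omega : p = q - deg u)).hom ≫
      Sigma.ι (fun u : S => I.X (q - deg u)) u

variable {I deg} {Y : CochainComplex C ℤ}

/-- The cochain on a coproduct of shifted copies with given components. -/
def copowerDesc {n : ℤ} (f : ∀ u, Cochain I Y (deg u + n)) : Cochain (copower I deg) Y n :=
  Cochain.mk fun p q h => Sigma.desc fun u => (f u).v (p - deg u) q (by omega)

lemma copowerι_desc {n : ℤ} (f : ∀ u, Cochain I Y (deg u + n)) (u : S) :
    (copowerι I deg u).comp (copowerDesc f) rfl = f u := by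
  ext p q h
  rw [Cochain.comp_v _ _ _ p (p + deg u) q rfl (by omega)]
  simp only [copowerι, copowerDesc, Cochain.mk_v]
  rw [Category.assoc, Sigma.ι_desc, XIsoOfEq_hom_comp_v]

lemma copower_hom_ext {n : ℤ} {Φ Ψ : Cochain (copower I deg) Y n}
    (h : ∀ u, (copowerι I deg u).comp Φ rfl = (copowerι I deg u).comp Ψ rfl) : Φ = Ψ := by
  ext p q hpq u
  have := Cochain.congr_v (h u) (p - deg u) q (by omega)
  rw [Cochain.comp_v _ _ _ (p - deg u) p q (by omega) (by omega),
    Cochain.comp_v _ _ _ (p - deg u) p q (by omega) (by omega)] at this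
  simpa [copowerι, Category.assoc] using this

end Copower

/-! ### Words in a homogeneous basis as a basis of the tensor algebra. -/

section WordBasis

open TensorAlgebra Module

variable {k : Type t} [Field k] (B : DGAlgebra.{w} k)

/-- The index set of a basis of homogeneous elements. -/
abbrev Letter : Type w := Σ n : ℤ, Basis.ofVectorSpaceIndex k (B.gr n)

/-- A basis of homogeneous elements. -/
def letterBasis : Basis (Letter B) k B.carrier :=
  (DirectSum.Decomposition.isInternal B.gr).collectedBasis fun n => Basis.ofVectorSpace k (B.gr n)

lemma letterBasis_mem (s : Letter B) : letterBasis B s ∈ B.gr s.1 :=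
  DirectSum.IsInternal.collectedBasis_mem _ _ _

lemma mem_span_letterBasis {n : ℤ} {x : B.carrier} (hx : x ∈ B.gr n) :
    x ∈ Submodule.span k (letterBasis B '' {s | s.1 = n}) := by
  have h := (Basis.ofVectorSpace k (B.gr n)).mem_span (⟨x, hx⟩ : B.gr n)
  have h' := Submodule.mem_map_of_mem (f := (B.gr n).subtype) h
  rw [Submodule.map_span, ← Set.range_comp] at h'
  refine Submodule.span_mono ?_ h'
  rintro _ ⟨s, rfl⟩
  refine ⟨(⟨n, s⟩ : Σ n : ℤ, Basis.ofVectorSpaceIndex k (B.gr n)), rfl, ?_⟩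
  rw [letterBasis, DirectSum.IsInternal.collectedBasis_coe]
  rfl

/-- The basis of the tensor algebra which consists of the words in a homogeneous basis. -/
def wordBasis : Basis (FreeMonoid (Letter B)) k (Bar B) := (letterBasis B).tensorAlgebra

lemma wordBasis_apply (u : FreeMonoid (Letter B)) :
    wordBasis B u = FreeMonoid.lift (fun s => ι k (letterBasis B s)) u := by
  let φ : FreeMonoid (Letter B) →* Bar B :=
    (((equivFreeAlgebra (letterBasis B)).symm.toMulEquiv.toMonoidHom).comp
      (FreeAlgebra.equivMonoidAlgebraFreeMonoid (R := k)).symm.toMulEquiv.toMonoidHom).comp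
        (MonoidAlgebra.of k (FreeMonoid (Letter B)))
  have : φ = FreeMonoid.lift (fun s => ι k (letterBasis B s)) := by
    refine FreeMonoid.hom_eq fun s => ?_
    simp [φ, FreeAlgebra.equivMonoidAlgebraFreeMonoid]
  exact DFunLike.congr_fun this u

/-- The degree of a word, where a letter `x` has degree `|x| - 1`. -/
def wordDeg : FreeMonoid (Letter B) →* Multiplicative ℤ :=
  FreeMonoid.lift fun s => Multiplicative.ofAdd (s.1 - 1)

lemma homWord_wordBasis (u : FreeMonoid (Letter B)) :
    HomWord B (wordDeg B u).toAdd (wordBasis B u) := by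
  rw [wordBasis_apply]
  induction u using FreeMonoid.inductionOn' with
  | one => simpa using HomWord.one
  | of_mul s u hu =>
    rw [map_mul (wordDeg B), toAdd_mul, map_mul (FreeMonoid.lift _), FreeMonoid.lift_eval_of,
        wordDeg, FreeMonoid.lift_eval_of]
    exact HomWord.cons (letterBasis_mem B s) hu

lemma mem_span_wordBasis {m : ℤ} {w : Bar B} (hw : w ∈ barDeg B m) :
    w ∈ Submodule.span k (wordBasis B '' {u | (wordDeg B u).toAdd = m}) := by
  refine (Submodule.span_le.2 fun w hw => ?_ :
    barDeg B m ≤ Submodule.span k (wordBasis B '' {u | (wordDeg B u).toAdd = m})) hw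
  clear * - hw
  induction hw with
  | one => exact Submodule.subset_span ⟨1, by simp, by simp [wordBasis_apply]⟩
  | @cons e m x w hx _ ih =>
    have h := Submodule.mul_mem_mul
      (Submodule.mem_map_of_mem (f := ι k) (mem_span_letterBasis B hx)) ih
    rw [Submodule.map_span, Submodule.span_mul_span] at h
    refine Submodule.span_mono ?_ h
    rintro _ ⟨_, ⟨_, ⟨s, rfl, rfl⟩, rfl⟩, _, ⟨u, rfl, rfl⟩, rfl⟩
    exact ⟨FreeMonoid.of s * u, by simp [wordDeg], by simp [wordBasis_apply]⟩

end WordBasis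

/-! ### The graded object that underlies the bar construction, by its universal property. -/

section Free

open CochainComplex CochainComplex.HomComplex Limits TensorAlgebra

variable {k : Type t} [Field k] {B : DGAlgebra.{w} k}
  {C : Type u} [Category.{v} C] [Preadditive C] [Linear k C]

/-- `N`, with the linear family of cochains `ϑ`, is the tensor product of the reduced tensor algebra
with the graded object which underlies `I`,
where the first letter of a word `x` has degree `|x|`. -/
structure IsFree {I N : CochainComplex C ℤ} (ϑ : Bar B →ₗ[k] Tot I N) : Prop where
  map_one : ϑ 1 = 0
  mem : ∀ ⦃m n : ℤ⦄, m + 1 = n → ∀ w ∈ barDeg B m, ϑ w ∈ LinearMap.range (tot k n)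
  hom_ext : ∀ ⦃Y : CochainComplex C ℤ⦄ ⦃n : ℤ⦄ ⦃Φ Ψ : Cochain N Y n⦄,
    (∀ w, totComp k (ϑ w) (tot k n Φ) = totComp k (ϑ w) (tot k n Ψ)) → Φ = Ψ
  exists_desc : ∀ ⦃Y : CochainComplex C ℤ⦄ (n : ℤ) (α : Bar B →ₗ[k] Tot I Y), α 1 = 0 →
    (∀ m, ∀ w ∈ barDeg B m, α w ∈ LinearMap.range (tot k (m + 1 + n))) →
    ∃ Φ : Cochain N Y n, ∀ w, totComp k (ϑ w) (tot k n Φ) = α w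

variable (B)

/-- Take the coproduct of shifted copies of `I` indexed by the nonempty words in a homogeneous basis
of `B`. The universal property frees everything that follows from the choice of basis. -/
lemma exists_isFree [HasCoproducts.{w} C] (I : CochainComplex C ℤ) :
    ∃ (N : CochainComplex C ℤ) (ϑ : Bar B →ₗ[k] Tot I N), IsFree ϑ := by
  classical
  let W := {u : FreeMonoid (Letter B) // u ≠ 1}
  -- The added one shifts the degree of the first letter back from `|x| - 1` to `|x|`: this letter
  -- is the factor `B` on which `B` acts.
  let deg : W → ℤ := fun u => (wordDeg B u.1).toAdd + 1
  let ϑ : Bar B →ₗ[k] Tot I (copower I deg) := (wordBasis B).constr k fun u =>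
    if h : u ≠ 1 then tot k _ (copowerι I deg ⟨u, h⟩) else 0
  have hϑ : ∀ u : W, ϑ (wordBasis B u) = tot k _ (copowerι I deg u) := fun u => by
    simp only [ϑ, Module.Basis.constr_basis, dif_pos u.2]
    rfl
  have hone : wordBasis B 1 = 1 := by simp [wordBasis_apply]
  have hϑ₁ : ϑ 1 = 0 := by
    rw [← hone]
    simp only [ϑ, Module.Basis.constr_basis]
    simp
  refine ⟨_, ϑ, hϑ₁, ?_, ?_, ?_⟩
  · rintro m _ rfl w hw
    have := mem_span_wordBasis B hw
    refine (Submodule.span_le.2 ?_ : _ ≤ Submodule.comap ϑ (LinearMap.range (tot k (m + 1)))) this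
    rintro _ ⟨u, rfl, rfl⟩
    by_cases h : u = 1
    · subst h
      simp [hone, hϑ₁]
    · exact ⟨_, (hϑ ⟨u, h⟩).symm⟩
  · intro Y n Φ Ψ h
    refine copower_hom_ext fun u => tot_injective k _ ?_
    rw [← totComp_tot, ← totComp_tot, ← hϑ, h]
  · intro Y n α hα₁ hα
    choose f hf using fun u : W => hα _ _ (Submodule.subset_span (homWord_wordBasis B u.1))
    refine ⟨copowerDesc f, fun w => ?_⟩
    have : (totComp k).flip (tot k n (copowerDesc f)) ∘ₗ ϑ = α := by
      refine (wordBasis B).ext fun u => ?_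
      by_cases h : u = 1
      · subst h
        simp [hone, hϑ₁, hα₁]
      · have := hϑ ⟨u, h⟩
        rw [LinearMap.comp_apply, this, LinearMap.flip_apply, totComp_tot rfl, copowerι_desc, hf]
    exact LinearMap.congr_fun this w

end Free

/-! ### Signs, degrees and the square of the twisted differential for a flat cochain. -/

section TwistedOperators

open TensorAlgebra TensorProduct

variable {k : Type t} [CommRing k] {B : DGAlgebra.{w} k} {E : DGAlgebra.{v} k}
  {τ : Bar B →ₗ[k] E.carrier}

lemma sgnT_firstMulT (x : B.carrier) (q : BarTensor B E) :
    sgnT B E (firstMulT B E x q) = firstMulT B E (B.sgn x) (sgnT B E q) := by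
  induction q using barTensor_induction with
  | one e => simp
  | add a b ha hb => simp only [map_add, ha, hb]
  | cons y q hq => simp only [firstMulT_cons, sgnT_consT, B.sgn_mul, map_neg]

lemma sgnT_sgnT (q : BarTensor B E) : sgnT B E (sgnT B E q) = q := by
  induction q using barTensor_induction with
  | one e => simp [E.sgn_sgn]
  | add a b ha hb => simp only [map_add, ha, hb]
  | cons y q hq => simp only [sgnT_consT, map_neg, B.sgn_sgn, hq, neg_neg]

lemma sgnT_rightT (e : E.carrier) (q : BarTensor B E) :
    sgnT B E (rightT B E e q) = rightT B E (E.sgn e) (sgnT B E q) := by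
  induction q using TensorProduct.induction_on with
  | zero => simp
  | add a b ha hb => simp only [map_add, ha, hb]
  | tmul w e' => simp [E.sgn_mul]

lemma rightT_rightT (e e' : E.carrier) (q : BarTensor B E) :
    rightT B E e (rightT B E e' q) = rightT B E (e' * e) q := by
  induction q using TensorProduct.induction_on with
  | zero => simp
  | add a b ha hb => simp only [map_add, ha, hb]
  | tmul w e' => simp [mul_assoc]

lemma IsOdd.hatMap_sgnT (hτ : IsOdd τ) (q : BarTensor B E) :
    hatMap τ (sgnT B E q) = -E.sgn (hatMap τ q) := by
  induction q using TensorProduct.induction_on with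
  | zero => simp
  | add a b ha hb => simp only [map_add, ha, hb, neg_add]
  | tmul w e => simp [E.sgn_mul, hτ w]

lemma IsOdd.twistedD_sgnT (hτ : IsOdd τ) (q : BarTensor B E) :
    twistedD τ (sgnT B E q) = -sgnT B E (twistedD τ q) := by
  induction q using barTensor_induction with
  | one e => simp [E.d_sgn, TensorProduct.tmul_neg]
  | add a b ha hb => simp only [map_add, ha, hb, neg_add]
  | cons x q hq =>
    have h : (1 : Bar B) ⊗ₜ[k] hatMap τ (consT B E (B.sgn x) (sgnT B E q)) =
        sgnT B E (1 ⊗ₜ hatMap τ (consT B E x q)) := by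
      rw [sgnT_tmul, ← neg_neg (E.sgn _), ← hτ.hatMap_sgnT, sgnT_consT]
      simp
    rw [sgnT_consT, map_neg, twistedD_cons, twistedD_cons, h, hq]
    simp only [map_add, map_sub, sgnT_firstMulT, sgnT_consT, B.sgn_sgn, B.d_sgn, map_neg,
      LinearMap.neg_apply]

lemma IsOdd.curvT_eq_zero_of_curv (hτ : IsOdd τ) (h : curv τ = 0) (q : BarTensor B E) :
    curvT τ q = 0 := by
  induction q using TensorProduct.induction_on with
  | zero => simp
  | add a b ha hb => simp [ha, hb]
  | tmul w e => simp [hτ.curvT_tmul, h]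

lemma IsOdd.twistedD_twistedD (hτ : IsOdd τ) (h₁ : τ 1 = 0) (h : curv τ = 0) (q : BarTensor B E) :
    twistedD τ (twistedD τ q) = 0 := by
  induction q using barTensor_induction with
  | one e => simp [E.d_d]
  | add a b ha hb => simp [ha, hb]
  | cons x q hq =>
    rw [twistedD_twistedD_cons h₁, hq, hτ.curvT_eq_zero_of_curv h]
    simp

lemma firstMulT_mem_tDeg {a m n : ℤ} (hn : m + a = n) {x : B.carrier} (hx : x ∈ B.gr a)
    {q : BarTensor B E} (hq : q ∈ tDeg B E m) : firstMulT B E x q ∈ tDeg B E n :=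
  tDeg_map_le (s := a) (fun m b w hw e he => by
    rw [firstMulT_tmul]
    exact tmul_mem_tDeg (by omega) (firstMul_mem_barDeg rfl hx hw) he) hn hq

lemma rightT_mem_tDeg {a m n : ℤ} (hn : m + a = n) {e : E.carrier} (he : e ∈ E.gr a)
    {q : BarTensor B E} (hq : q ∈ tDeg B E m) : rightT B E e q ∈ tDeg B E n :=
  tDeg_map_le (s := a) (fun m b w hw e' he' => by
    rw [rightT_tmul]
    exact tmul_mem_tDeg (by omega) hw (SetLike.mul_mem_graded he' he)) hn hq

lemma barSgn_mem_barDeg {m : ℤ} {w : Bar B} (hw : w ∈ barDeg B m) : barSgn B w ∈ barDeg B m := by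
  refine (Submodule.span_le.2 fun w hw => ?_ :
    barDeg B m ≤ (barDeg B m).comap (barSgn B).toLinearMap) hw
  change barSgn B w ∈ barDeg B m
  rw [barSgn_of_homWord hw]
  exact zsmul_mem (Submodule.subset_span hw) _

lemma sgnT_mem_tDeg {m : ℤ} {q : BarTensor B E} (hq : q ∈ tDeg B E m) :
    sgnT B E q ∈ tDeg B E m :=
  tDeg_map_le (s := 0) (fun m b w hw e' he' => by
    rw [sgnT_tmul]
    exact tmul_mem_tDeg (by omega) (barSgn_mem_barDeg hw) (E.sgn_mem he')) (add_zero m) hq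

lemma HasDegree.twistedD_mem (hτ : HasDegree τ 1) {m n : ℤ} (hn : m + 1 = n) {q : BarTensor B E}
    (hq : q ∈ tDeg B E m) : twistedD τ q ∈ tDeg B E n := by
  refine tDeg_map_le (s := 1) (fun m a w hw e he => ?_) hn hq
  refine barDeg_map_le (f := twistedD τ ∘ₗ (TensorProduct.mk k (Bar B) E.carrier).flip e)
    (𝒴 := tDeg B E) (s := a + 1) ?_ ?_ (by omega) hw
  · rw [LinearMap.comp_apply, LinearMap.flip_apply, TensorProduct.mk_apply, twistedD_one]
    exact tmul_mem_tDeg (by omega) one_mem_barDeg (E.d_mem he)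
  · intro b m x hx w hw h
    have hx' := B.sgn_mem hx
    have hq := tmul_mem_tDeg rfl hw he
    change twistedD τ (consT B E x (w ⊗ₜ e)) ∈ _
    rw [twistedD_cons]
    refine add_mem (sub_mem (sub_mem ?_ ?_) ?_) ?_
    · exact firstMulT_mem_tDeg (by omega) hx' hq
    · exact consT_mem_tDeg (by omega) (B.d_mem hx) hq
    · exact consT_mem_tDeg (by omega) hx' h
    · exact tmul_mem_tDeg (zero_add _) one_mem_barDeg
        (hτ.hatMap_mem (by omega) (consT_mem_tDeg rfl hx hq))

end TwistedOperators

/-! ### Right linear operators on the free module and cochains on the bar construction. -/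

section FreeExtension

open CochainComplex CochainComplex.HomComplex Limits TensorAlgebra TensorProduct

variable {k : Type t} [Field k] {B : DGAlgebra.{w} k}
  {C : Type u} [Category.{v} C] [Preadditive C] [Linear k C] {I N Y : CochainComplex C ℤ}

/-- The extension of a linear map to the free right module over the endomorphisms of `I`. -/
def extendT (ϑ : Bar B →ₗ[k] Tot I N) : BarTensor B (endDG k I) →ₗ[k] Tot I N :=
  TensorProduct.lift ((totComp k).flip ∘ₗ ϑ)

@[simp] lemma extendT_tmul (ϑ : Bar B →ₗ[k] Tot I N) (w : Bar B) (e : Tot I I) :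
    extendT ϑ (w ⊗ₜ e) = totComp k e (ϑ w) := rfl

lemma extendT_rightT (ϑ : Bar B →ₗ[k] Tot I N) (e : Tot I I) (q : BarTensor B (endDG k I)) :
    extendT ϑ (rightT B (endDG k I) e q) = totComp k e (extendT ϑ q) := by
  induction q using TensorProduct.induction_on with
  | zero => simp
  | add a b ha hb => simp only [map_add, ha, hb]
  | tmul w e' => exact totComp_assoc (k := k) e e' (ϑ w)

lemma totDiff_mem (I : CochainComplex C ℤ) : totDiff k I ∈ endGr k I 1 := ⟨_, rfl⟩

lemma endDG_d (e : Tot I I) :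
    (endDG k I).d e = totDiff k I * e - (endDG k I).sgn e * totDiff k I :=
  (totD_eq e).trans (by rw [endDG_sgn]; rfl)

variable (τ : Bar B →ₗ[k] Tot I I)

/-- The right linear differential on the free right module. -/
def linearD : BarTensor B (endDG k I) →ₗ[k] BarTensor B (endDG k I) :=
  twistedD (E := endDG k I) τ + rightT B (endDG k I) (totDiff k I) ∘ₗ sgnT B (endDG k I)

lemma linearD_apply (q : BarTensor B (endDG k I)) :
    linearD τ q = twistedD (E := endDG k I) τ q +
      rightT B (endDG k I) (totDiff k I) (sgnT B (endDG k I) q) := rfl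

/-- Since `E.d` is the graded commutator with the differential of `I`, adding right multiplication
by that differential cancels the derivation term of `twistedD_right`. Right linear operators are the
ones that come from cochains on `N`. -/
lemma linearD_rightT (e : Tot I I) (q : BarTensor B (endDG k I)) :
    linearD τ (rightT B (endDG k I) e q) = rightT B (endDG k I) e (linearD τ q) := by
  rw [linearD_apply, linearD_apply, twistedD_right, sgnT_rightT, rightT_rightT, map_add,
    rightT_rightT, endDG_d, map_sub, LinearMap.sub_apply]
  abel

lemma linearD_cons (x : B.carrier) (q : BarTensor B (endDG k I)) :
    linearD τ (consT B (endDG k I) x q) = firstMulT B (endDG k I) (B.sgn x) q -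
      consT B (endDG k I) (B.d x) q - consT B (endDG k I) (B.sgn x) (linearD τ q) +
        1 ⊗ₜ hatMap (E := endDG k I) τ (consT B (endDG k I) x q) := by
  rw [linearD_apply, linearD_apply, twistedD_cons, sgnT_consT, map_neg, rightT_consT, map_add]
  abel

lemma linearD_firstMulT (x : B.carrier) (q : BarTensor B (endDG k I)) :
    linearD τ (firstMulT B (endDG k I) x q) = firstMulT B (endDG k I) (B.sgn x) (linearD τ q) -
      firstMulT B (endDG k I) (B.d x) q +
        1 ⊗ₜ hatMap (E := endDG k I) τ (firstMulT B (endDG k I) x q) := by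
  rw [linearD_apply, linearD_apply, twistedD_firstMulT, sgnT_firstMulT, rightT_firstMulT, map_add]
  abel

variable {τ}

lemma linearD_linearD (hτ : IsOdd (E := endDG k I) τ) (h₁ : τ 1 = 0)
    (h : curv (E := endDG k I) τ = 0) (q : BarTensor B (endDG k I)) :
    linearD τ (linearD τ q) = 0 := by
  have hdd : totDiff k I * totDiff k I = 0 := (tot_mul k _ _).trans (totDiff_totDiff I)
  rw [linearD_apply τ q, map_add, linearD_rightT, linearD_apply, linearD_apply,
    hτ.twistedD_twistedD h₁ h, hτ.twistedD_sgnT, sgnT_sgnT, map_add, map_neg, rightT_rightT, hdd]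
  simp

lemma linearD_mem (hτ : HasDegree (E := endDG k I) τ 1) {m n : ℤ} (hn : m + 1 = n)
    {q : BarTensor B (endDG k I)} (hq : q ∈ tDeg B (endDG k I) m) :
    linearD τ q ∈ tDeg B (endDG k I) n :=
  add_mem (hτ.twistedD_mem hn hq) (rightT_mem_tDeg hn (totDiff_mem I) (sgnT_mem_tDeg hq))

variable {ϑ : Bar B →ₗ[k] Tot I N}

lemma IsFree.extendT_one (hϑ : IsFree ϑ) (e : Tot I I) :
    extendT ϑ (1 ⊗ₜ e : BarTensor B (endDG k I)) = 0 := by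
  rw [extendT_tmul, hϑ.map_one, map_zero]

lemma IsFree.extendT_mem (hϑ : IsFree ϑ) {m n : ℤ} (hn : m + 1 = n)
    {q : BarTensor B (endDG k I)} (hq : q ∈ tDeg B (endDG k I) m) :
    extendT ϑ q ∈ LinearMap.range (tot k n : Cochain I N n →ₗ[k] _) := by
  refine tDeg_map_le (𝒴 := fun n => LinearMap.range (tot k n : Cochain I N n →ₗ[k] _)) (s := 1)
    (fun m a w hw e he => ?_) hn hq
  obtain ⟨x, hx⟩ := hϑ.mem rfl w hw
  obtain ⟨y, rfl⟩ := he
  exact ⟨y.comp x (by omega), by rw [extendT_tmul, ← hx, totComp_tot]⟩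

lemma IsFree.extendT_hom_ext (hϑ : IsFree ϑ) {n : ℤ} {Φ Ψ : Cochain N Y n}
    (h : ∀ q, totComp k (extendT ϑ q) (tot k n Φ) = totComp k (extendT ϑ q) (tot k n Ψ)) :
    Φ = Ψ :=
  hϑ.hom_ext fun w => by
    have := h (w ⊗ₜ totOne k I)
    rwa [extendT_tmul, totOne_comp] at this

/-- A right linear map is determined by its values on the elements `w ⊗ 1`, and these are the data
in the universal property. The condition on the empty word appears because `N` contains only
nonempty words. -/
lemma IsFree.exists_extendT_desc (hϑ : IsFree ϑ) (n : ℤ)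
    (α : BarTensor B (endDG k I) →ₗ[k] Tot I Y) (h₁ : α (1 ⊗ₜ totOne k I) = 0)
    (hr : ∀ e q, α (rightT B (endDG k I) e q) = totComp k e (α q))
    (hα : ∀ m q, q ∈ tDeg B (endDG k I) m → α q ∈ LinearMap.range (tot k (m + 1 + n))) :
    ∃ Φ : Cochain N Y n, ∀ q, totComp k (extendT ϑ q) (tot k n Φ) = α q := by
  obtain ⟨Φ, hΦ⟩ := hϑ.exists_desc n
    (α ∘ₗ (TensorProduct.mk k (Bar B) (endDG k I).carrier).flip (totOne k I)) h₁
    (fun m w hw => hα m _ (tmul_mem_tDeg (add_zero m) hw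
      (SetLike.GradedOne.one_mem (A := (endDG k I).gr))))
  refine ⟨Φ, fun q => ?_⟩
  induction q using TensorProduct.induction_on with
  | zero => simp
  | add a b ha hb => simp only [map_add, LinearMap.add_apply, ha, hb]
  | tmul w e =>
    rw [extendT_tmul, totComp_assoc, hΦ]
    refine (hr e _).symm.trans ?_
    refine congrArg α ((rightT_tmul B (endDG k I) e w _).trans ?_)
    rw [← tot_one, one_mul]

end FreeExtension

/-! ### Replacement of the differential of a complex. -/

section NewDifferential

open CochainComplex CochainComplex.HomComplex

variable {C : Type u} [Category.{v} C] [Preadditive C]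

/-- The complex with the same objects as `N`, and a given differential. -/
abbrev withDiff (N : CochainComplex C ℤ) (Φ : Cochain N N 1)
    (hΦ : Φ.comp Φ rfl = (0 : Cochain N N 2)) : CochainComplex C ℤ where
  X := N.X
  d i j := if h : i + 1 = j then Φ.v i j h else 0
  shape i j h := dif_neg h
  d_comp_d' i j l hij hjl := by
    simp only [ComplexShape.up_Rel] at hij hjl
    rw [dif_pos hij, dif_pos hjl]
    have := Cochain.congr_v hΦ i l (by omega)
    rwa [Cochain.comp_v _ _ _ i j l hij hjl] at this

variable {N : CochainComplex C ℤ} {Φ : Cochain N N 1} (hΦ : Φ.comp Φ rfl = (0 : Cochain N N 2))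

/-- The identity, as a cochain from a complex to the complex with a new differential. -/
def toWithDiff : Cochain N (withDiff N Φ hΦ) 0 :=
  Cochain.ofHoms (G := withDiff N Φ hΦ) fun p => 𝟙 (N.X p)

/-- The identity, as a cochain from the complex with a new differential. -/
def ofWithDiff : Cochain (withDiff N Φ hΦ) N 0 :=
  Cochain.ofHoms (F := withDiff N Φ hΦ) fun p => 𝟙 (N.X p)

lemma toWithDiff_ofWithDiff :
    (toWithDiff hΦ).comp (ofWithDiff hΦ) (add_zero 0) = Cochain.ofHom (𝟙 N) := by
  rw [toWithDiff, ofWithDiff, Cochain.ofHoms_comp]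
  ext p
  simp

lemma ofWithDiff_toWithDiff :
    (ofWithDiff hΦ).comp (toWithDiff hΦ) (add_zero 0) = Cochain.ofHom (𝟙 (withDiff N Φ hΦ)) := by
  rw [toWithDiff, ofWithDiff, Cochain.ofHoms_comp]
  ext p
  simp

lemma toWithDiff_diff :
    (toWithDiff hΦ).comp (Cochain.diff (withDiff N Φ hΦ)) (zero_add 1) =
      Φ.comp (toWithDiff hΦ) (add_zero 1) := by
  ext p q hpq
  simp [toWithDiff, hpq]

end NewDifferential

/-! ### The twisted bar construction as a DG-module homotopy equivalent to `I`. -/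

section TwistedModule

open CochainComplex CochainComplex.HomComplex Limits TensorAlgebra TensorProduct

variable {k : Type t} [Field k] {B : DGAlgebra.{w} k}
  {C : Type u} [Category.{v} C] [Preadditive C] [Linear k C] {I N Y : CochainComplex C ℤ}

lemma IsFree.comp_of_inverse {N' : CochainComplex C ℤ} {ϑ : Bar B →ₗ[k] Tot I N} (hϑ : IsFree ϑ)
    {a : Cochain N N' 0} {b : Cochain N' N 0}
    (hab : a.comp b (add_zero 0) = Cochain.ofHom (𝟙 N))
    (hba : b.comp a (add_zero 0) = Cochain.ofHom (𝟙 N')) :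
    IsFree ((totComp k).flip (tot k 0 a) ∘ₗ ϑ) where
  map_one := by simp [hϑ.map_one]
  mem := by
    intro m n hn w hw
    obtain ⟨x, hx⟩ := hϑ.mem hn w hw
    exact ⟨x.comp a (add_zero n), by
      rw [LinearMap.comp_apply, LinearMap.flip_apply, ← hx, totComp_tot]⟩
  hom_ext := by
    intro Y n Φ Ψ h
    have : a.comp Φ (zero_add n) = a.comp Ψ (zero_add n) := hϑ.hom_ext fun w => by
      have := h w
      rw [LinearMap.comp_apply, LinearMap.flip_apply, totComp_assoc, totComp_assoc,
        totComp_tot (zero_add n), totComp_tot (zero_add n)] at this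
      exact this
    have := congrArg (fun z => b.comp z (zero_add n)) this
    simpa [← Cochain.comp_assoc_of_first_is_zero_cochain, hba] using this
  exists_desc := by
    intro Y n α h₁ hα
    obtain ⟨Φ, hΦ⟩ := hϑ.exists_desc n α h₁ hα
    refine ⟨b.comp Φ (zero_add n), fun w => ?_⟩
    rw [LinearMap.comp_apply, LinearMap.flip_apply, totComp_assoc, totComp_tot (zero_add n),
      ← Cochain.comp_assoc_of_first_is_zero_cochain, hab, Cochain.id_comp, hΦ]

/-- The operator `linearD` descends to `N`: it sends the empty word to the empty word, which `ϑ`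
annihilates. With the minus sign, multiplication on the first letter satisfies the Leibniz rule
without further signs, as `IsFree.act_d` requires. -/
lemma exists_isFree_differential [HasCoproducts.{w} C] {τ : Bar B →ₗ[k] Tot I I} (h₁ : τ 1 = 0)
    (hτ : HasDegree (E := endDG k I) τ 1) (h : curv (E := endDG k I) τ = 0) :
    ∃ (N : CochainComplex C ℤ) (ϑ : Bar B →ₗ[k] Tot I N), IsFree ϑ ∧
      ∀ q, totComp k (extendT ϑ q) (totDiff k N) = -extendT ϑ (linearD τ q) := by
  obtain ⟨N, ϑ, hϑ⟩ := exists_isFree B I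
  obtain ⟨Φ, hΦ⟩ := hϑ.exists_extendT_desc 1 (-(extendT ϑ ∘ₗ linearD τ))
    (by
      rw [LinearMap.neg_apply, LinearMap.comp_apply, linearD_apply, map_add, twistedD_one,
          hϑ.extendT_one,
        sgnT_tmul, rightT_tmul, map_one, hϑ.extendT_one]
      simp)
    (fun e q => by
      simp only [LinearMap.neg_apply, LinearMap.comp_apply]
      rw [linearD_rightT, extendT_rightT, map_neg])
    (fun m q hq => neg_mem (hϑ.extendT_mem (by omega) (linearD_mem hτ rfl hq)))
  have hΦΦ : Φ.comp Φ rfl = (0 : Cochain N N 2) := hϑ.extendT_hom_ext fun q => by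
    rw [← totComp_tot (k := k) (rfl : (1 : ℤ) + 1 = 2), ← totComp_assoc, hΦ]
    simp only [LinearMap.neg_apply, LinearMap.comp_apply, map_neg, hΦ,
      linearD_linearD hτ.isOdd h₁ h]
    simp
  refine ⟨withDiff N Φ hΦΦ, _,
    hϑ.comp_of_inverse (toWithDiff_ofWithDiff hΦΦ) (ofWithDiff_toWithDiff hΦΦ), fun q => ?_⟩
  have key : ∀ q, extendT ((totComp k).flip (tot k 0 (toWithDiff hΦΦ)) ∘ₗ ϑ) q =
      totComp k (extendT ϑ q) (tot k 0 (toWithDiff hΦΦ)) := fun q => by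
    induction q using TensorProduct.induction_on with
    | zero => simp
    | add a b ha hb => simp only [map_add, LinearMap.add_apply, ha, hb]
    | tmul w e => rw [extendT_tmul, extendT_tmul, totComp_assoc]; rfl
  rw [key, key, totComp_assoc, totDiff, totComp_tot (zero_add 1), toWithDiff_diff,
    ← totComp_tot (k := k), ← totComp_assoc, hΦ]
  simp

variable {τ : Bar B →ₗ[k] Tot I I} {ϑ : Bar B →ₗ[k] Tot I N}

/-- The compatibility of the differential of `N` with the twisted differential. -/
def IsTwisted (τ : Bar B →ₗ[k] Tot I I) (ϑ : Bar B →ₗ[k] Tot I N) : Prop :=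
  ∀ q, totComp k (extendT ϑ q) (totDiff k N) = -extendT ϑ (linearD τ q)

lemma IsTwisted.totComp_δ (hN : IsTwisted τ ϑ) {n m : ℤ} (hm : n + 1 = m) (Φ : Cochain N Y n)
    (q : BarTensor B (endDG k I)) :
    totComp k (extendT ϑ q) (tot k m (δ n m Φ)) =
      totComp k (totComp k (extendT ϑ q) (tot k n Φ)) (totDiff k Y) +
        (n.negOnePow : ℤ) • totComp k (extendT ϑ (linearD τ q)) (tot k n Φ) := by
  rw [← totD_tot (k := k) hm, totD_eq, map_sub, totComp_assoc, ← totComp_assoc _ (totDiff k N), hN,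
    totSgn_tot, map_zsmul, map_neg, LinearMap.neg_apply, smul_neg, sub_neg_eq_add]

lemma IsFree.exists_act (hϑ : IsFree ϑ) {n : ℤ} (x : B.gr n) :
    ∃ Φ : Cochain N N n, ∀ q, totComp k (extendT ϑ q) (tot k n Φ) =
      extendT ϑ (firstMulT B (endDG k I) x q) :=
  hϑ.exists_extendT_desc n (extendT ϑ ∘ₗ firstMulT B (endDG k I) x)
    (by rw [LinearMap.comp_apply, firstMulT_one, map_zero])
    (fun e q => by
      rw [LinearMap.comp_apply, LinearMap.comp_apply, ← rightT_firstMulT, extendT_rightT])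
    (fun m q hq => hϑ.extendT_mem (by omega) (firstMulT_mem_tDeg rfl x.2 hq))

/-- The action of `B` on the twisted tensor product. -/
def IsFree.act (hϑ : IsFree ϑ) (n : ℤ) : B.gr n →ₗ[k] Cochain N N n where
  toFun x := (hϑ.exists_act x).choose
  map_add' x y := hϑ.extendT_hom_ext fun q => by
    rw [(hϑ.exists_act _).choose_spec, map_add, map_add, (hϑ.exists_act _).choose_spec,
      (hϑ.exists_act _).choose_spec, Submodule.coe_add, map_add, LinearMap.add_apply, map_add]
  map_smul' c x := hϑ.extendT_hom_ext fun q => by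
    rw [(hϑ.exists_act _).choose_spec, RingHom.id_apply, map_smul, map_smul,
      (hϑ.exists_act _).choose_spec, Submodule.coe_smul, map_smul, LinearMap.smul_apply, map_smul]

lemma IsFree.totComp_act (hϑ : IsFree ϑ) {n : ℤ} (x : B.gr n) (q : BarTensor B (endDG k I)) :
    totComp k (extendT ϑ q) (tot k n (hϑ.act n x)) = extendT ϑ (firstMulT B (endDG k I) x q) :=
  (hϑ.exists_act x).choose_spec q

/-- Multiplying the first letter by `1` is the projection that removes the empty word. It is not the
identity, but no map that vanishes on the empty word can tell the difference. -/
lemma eq_firstMulT_one {V : Type*} [AddCommGroup V] [Module k V]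
    {f : BarTensor B (endDG k I) →ₗ[k] V} (hf : ∀ e, f (1 ⊗ₜ e) = 0)
    (q : BarTensor B (endDG k I)) : f (firstMulT B (endDG k I) 1 q) = f q := by
  induction q using barTensor_induction with
  | one e => rw [firstMulT_one, map_zero, hf]
  | add a b ha hb => simp only [map_add, ha, hb]
  | cons x q _ => rw [firstMulT_cons, one_mul]

lemma IsFree.act_one (hϑ : IsFree ϑ) :
    hϑ.act 0 ⟨1, SetLike.GradedOne.one_mem⟩ = Cochain.ofHom (𝟙 N) :=
  hϑ.extendT_hom_ext fun q => by
    rw [hϑ.totComp_act, eq_firstMulT_one hϑ.extendT_one]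
    exact (totComp_one (k := k) _).symm

lemma IsFree.act_mul (hϑ : IsFree ϑ) {i j n : ℤ} (h : i + j = n) (a : B.gr i) (b : B.gr j) :
    hϑ.act n ⟨a * b, h ▸ SetLike.GradedMul.mul_mem a.2 b.2⟩ =
      (hϑ.act j b).comp (hϑ.act i a) ((add_comm j i).trans h) :=
  hϑ.extendT_hom_ext fun q => by
    rw [hϑ.totComp_act, ← totComp_tot, ← totComp_assoc, hϑ.totComp_act, hϑ.totComp_act,
      firstMulT_firstMulT]

lemma IsFree.act_d (hϑ : IsFree ϑ) (hN : IsTwisted τ ϑ) {n m : ℤ} (h : n + 1 = m) (b : B.gr n) :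
    hϑ.act m ⟨B.d b, h ▸ B.d_mem b.2⟩ = δ n m (hϑ.act n b) :=
  hϑ.extendT_hom_ext fun q => by
    rw [hϑ.totComp_act, hN.totComp_δ h, hϑ.totComp_act, hϑ.totComp_act, hN, linearD_firstMulT,
      map_add, map_sub, hϑ.extendT_one, B.sgn_of_mem b.2, map_zsmul, LinearMap.smul_apply,
      map_zsmul]
    abel

/-- The projection from the twisted tensor product. -/
lemma IsFree.exists_counit (hϑ : IsFree ϑ) (hN : IsTwisted τ ϑ) (h₁ : τ 1 = 0)
    (hτ : HasDegree (E := endDG k I) τ 1) (h : curv (E := endDG k I) τ = 0) :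
    ∃ ε : N ⟶ I, ∀ q, totComp k (extendT ϑ q) (tot k 0 (Cochain.ofHom ε)) =
      hatMap (E := endDG k I) τ q := by
  obtain ⟨Φ, hΦ⟩ := hϑ.exists_extendT_desc 0 (hatMap (E := endDG k I) τ)
    (by rw [hatMap_tmul, h₁, zero_mul])
    (fun e q => hatMap_rightT e q)
    (fun m q hq => hτ.hatMap_mem (add_zero _).symm hq)
  -- That the map given by `τ` commutes with the differentials is exactly the vanishing of the
  -- curvature.
  have hδ : δ 0 1 Φ = 0 := hϑ.extendT_hom_ext fun q => by
    rw [hN.totComp_δ (zero_add 1), hΦ, hΦ, linearD_apply, map_add, hatMap_rightT,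
      hτ.isOdd.hatMap_sgnT]
    have := hτ.isOdd.curvT_eq_zero_of_curv h q
    rw [curvT_apply, endDG_d] at this
    simp only [Int.negOnePow_zero, Units.val_one, one_smul, map_zero]
    rw [← this, tot_mul k, tot_mul k, tot_mul k, map_neg]
    abel
  exact ⟨Cocycle.homOf (Cocycle.mk Φ 1 (zero_add 1) hδ), by simpa using hΦ⟩

/-- Insertion of the letter `1` commutes with the differentials because `B.d 1 = 0`, and the
remaining terms of the twisted differential on one letter lie in the empty word. -/
lemma IsFree.exists_unit (hϑ : IsFree ϑ) (hN : IsTwisted τ ϑ) :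
    ∃ s : I ⟶ N, tot k 0 (Cochain.ofHom s) = ϑ (ι k 1) := by
  obtain ⟨Φ, hΦ⟩ := hϑ.mem (by omega : -1 + 1 = 0) (ι k 1) (by
    have := cons_mem_barDeg (by omega : 0 - 1 + 0 = -1)
      (SetLike.GradedOne.one_mem (A := B.gr)) (one_mem_barDeg (B := B))
    rwa [mul_one] at this)
  have hδ : δ 0 1 Φ = 0 := by
    apply tot_injective k 1
    have h := hN (consT B (endDG k I) 1 (1 ⊗ₜ totOne k I))
    have h' : ∀ e : Tot I I, extendT ϑ (consT B (endDG k I) 1 (1 ⊗ₜ e)) = totComp k e (ϑ (ι k 1)) :=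
      fun e => by rw [consT_tmul, mul_one, extendT_tmul]
    rw [linearD_cons, linearD_apply, twistedD_one, sgnT_tmul, rightT_tmul, ← tot_one,
      DGAlgebra.d_one, DGAlgebra.d_one, DGAlgebra.sgn_one, DGAlgebra.sgn_one,
      _root_.map_one (barSgn B), one_mul,
      tmul_zero, zero_add, firstMulT_one, map_zero, LinearMap.zero_apply, sub_self, zero_sub,
      map_add, map_neg, hϑ.extendT_one, add_zero, neg_neg, h', h', tot_one k, totOne_comp] at h
    rw [← totD_tot (k := k) (zero_add 1), totD_eq, totSgn_tot, hΦ, h]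
    simp
  exact ⟨Cocycle.homOf (Cocycle.mk Φ 1 (zero_add 1) hδ), by simpa using hΦ⟩

variable {ε : N ⟶ I} {s : I ⟶ N}

lemma IsFree.nonempty_homotopy (hϑ : IsFree ϑ) (hN : IsTwisted τ ϑ) (h₁ : τ 1 = 0)
    (hε : ∀ q, totComp k (extendT ϑ q) (tot k 0 (Cochain.ofHom ε)) =
      hatMap (E := endDG k I) τ q)
    (hs : tot k 0 (Cochain.ofHom s) = ϑ (ι k 1)) : Nonempty (Homotopy (ε ≫ s) (𝟙 N)) := by
  -- The bar homotopy inserts `1` in front of a word. The factor `firstMulT 1` removes the empty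
  -- word beforehand, since the map has to vanish there.
  obtain ⟨Φ, hΦ⟩ := hϑ.exists_extendT_desc (-1)
    (extendT ϑ ∘ₗ consT B (endDG k I) 1 ∘ₗ firstMulT B (endDG k I) 1)
    (by rw [LinearMap.comp_apply, LinearMap.comp_apply, firstMulT_one, map_zero, map_zero])
    (fun e q => by
      simp only [LinearMap.comp_apply]
      rw [← rightT_firstMulT, ← rightT_consT, extendT_rightT])
    (fun m q hq => hϑ.extendT_mem (by omega)
      (consT_mem_tDeg (by omega : 0 - 1 + m = m - 1) (SetLike.GradedOne.one_mem (A := B.gr))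
        (firstMulT_mem_tDeg (add_zero m) (SetLike.GradedOne.one_mem (A := B.gr)) hq)))
  refine ⟨(Cochain.equivHomotopy _ _).symm ⟨Φ, hϑ.extendT_hom_ext fun q => ?_⟩⟩
  have hτ₁ : hatMap (E := endDG k I) τ (firstMulT B (endDG k I) 1 q) =
      hatMap (E := endDG k I) τ q :=
    eq_firstMulT_one (fun e => by rw [hatMap_tmul, h₁, zero_mul]) q
  have h' : ∀ e : Tot I I, extendT ϑ (consT B (endDG k I) 1 (1 ⊗ₜ e)) = totComp k e (ϑ (ι k 1)) :=
    fun e => by rw [consT_tmul, mul_one, extendT_tmul]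
  rw [map_add, map_add, hN.totComp_δ (by omega), hΦ, hΦ]
  simp only [LinearMap.comp_apply]
  -- Multiplying the inserted `1` into the first letter gives the identity. The term of the
  -- differential in the empty word, with `1` put in front of it, is `ε` followed by `s`.
  rw [hN, linearD_cons, linearD_firstMulT, B.d_one, B.sgn_one, firstMulT_firstMulT, mul_one,
    Cochain.ofHom_comp, ← totComp_tot (k := k), ← totComp_assoc, hε, hs]
  simp only [map_zero, LinearMap.zero_apply, sub_zero, map_add, map_sub, hϑ.extendT_one, hτ₁, h',
    eq_firstMulT_one hϑ.extendT_one]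
  rw [show tot k 0 (Cochain.ofHom (𝟙 N)) = totOne k N from rfl, totComp_one]
  simp
  abel

/-- Insert the letter `1`, multiply it by `x`, and apply `τ`. This recovers the linear part of the
A∞-morphism as the action of `B` seen on `I`. -/
lemma IsFree.unit_act_counit (hϑ : IsFree ϑ)
    (hε : ∀ q, totComp k (extendT ϑ q) (tot k 0 (Cochain.ofHom ε)) =
      hatMap (E := endDG k I) τ q)
    (hs : tot k 0 (Cochain.ofHom s) = ϑ (ι k 1)) {n : ℤ} (x : B.gr n) :
    tot k n (((Cochain.ofHom s).comp (hϑ.act n x) (zero_add n)).comp (Cochain.ofHom ε)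
      (add_zero n)) = τ (ι k (x : B.carrier)) := by
  have h : ϑ (ι k 1) = extendT ϑ ((ι k 1 : Bar B) ⊗ₜ totOne k I : BarTensor B (endDG k I)) := by
    rw [extendT_tmul, totOne_comp]
  have h' : firstMul B x (ι k 1) = ι k (x : B.carrier) := by
    simpa using firstMul_cons B (x : B.carrier) 1 1
  rw [← totComp_tot (k := k), ← totComp_tot (k := k), hs, h, hϑ.totComp_act, hε, firstMulT_tmul,
    hatMap_tmul, h', ← tot_one, mul_one]

end TwistedModule

/-! ### Transport of actions along isomorphisms, and the associated algebra morphism. -/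

section GradedTransport

variable {k : Type*} [CommRing k] {A : Type*} [Ring A] [Algebra k A]
  {𝒜 : ℤ → Submodule k A} [GradedAlgebra 𝒜]
  {T : Type*} [Category T] [Preadditive T] [Linear k T] [HasShift T ℤ]

lemma comp_decompose_of_mem {R : Type*} [Semiring R] [Algebra k R] (g : (⨁ i, 𝒜 i) →ₐ[k] R) {n : ℤ}
    {a : A} (ha : a ∈ 𝒜 n) :
    g.comp (DirectSum.decomposeAlgEquiv 𝒜).toAlgHom a = g (DirectSum.of (fun i => 𝒜 i) n ⟨a, ha⟩) :=
  congrArg g (DirectSum.decompose_of_mem 𝒜 ha)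

namespace GradedObj

/-- The transport of the structure along an isomorphism. -/
def transport (X : GradedObj 𝒜 T) {Y : T} (e : X.obj ≅ Y) : GradedObj 𝒜 T where
  obj := Y
  act n := Linear.rightComp k _ (e.hom⟦n⟧') ∘ₗ Linear.leftComp k _ e.inv ∘ₗ X.act n
  act_one := by
    change (e.inv ≫ X.act 0 _) ≫ _ = _
    rw [X.act_one, ShiftedHom.mk₀, ShiftedHom.mk₀, Category.assoc, Category.assoc,
      ← NatTrans.naturality]
    simp
  act_mul {i j n} h a b := by
    change (e.inv ≫ X.act n _) ≫ _ = ShiftedHom.comp ((e.inv ≫ X.act j _) ≫ _)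
      ((e.inv ≫ X.act i _) ≫ _) h
    rw [X.act_mul h, ShiftedHom.comp, ShiftedHom.comp]
    simp only [Category.assoc, Functor.map_comp]
    rw [e.map_hom_inv_id_assoc]
    congr 3
    exact ((shiftFunctorAdd' T i j n h).inv.naturality e.hom).symm

lemma transport_act (X : GradedObj 𝒜 T) {Y : T} (e : X.obj ≅ Y) (n : ℤ) (a : 𝒜 n) :
    (X.transport e).act n a = (e.inv ≫ X.act n a) ≫ e.hom⟦n⟧' := rfl

variable [∀ n : ℤ, (shiftFunctor T n).Additive] [∀ n : ℤ, (shiftFunctor T n).Linear k]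

lemma toAlgHom_of_mem (X : GradedObj 𝒜 T) {n : ℤ} {a : A} (ha : a ∈ 𝒜 n) :
    X.toAlgHom a = DirectSum.lof k ℤ (fun n => ShiftedHom X.obj X.obj n) n (X.act n ⟨a, ha⟩) := by
  exact (comp_decompose_of_mem (R := GradedEnd X.obj) _ ha).trans
    (DirectSum.toAddMonoid_of (fun i => (DirectSum.lof k ℤ (fun n => ShiftedHom X.obj X.obj n) i ∘ₗ
      X.act i).toAddMonoidHom) n ⟨a, ha⟩)

lemma component_toAlgHom (X : GradedObj 𝒜 T) (a : A) (n : ℤ) :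
    DirectSum.component k ℤ (fun n => ShiftedHom X.obj X.obj n) n (X.toAlgHom a) =
      X.act n (DirectSum.decompose 𝒜 a n) := by
  induction a using DirectSum.Decomposition.inductionOn 𝒜 with
  | zero =>
    rw [DirectSum.decompose_zero, DirectSum.zero_apply, map_zero (X.act n)]
    exact (congrArg _ (map_zero X.toAlgHom)).trans (map_zero _)
  | add a b ha hb =>
    rw [DirectSum.decompose_add, DirectSum.add_apply, map_add (X.act n), ← ha, ← hb]
    exact (congrArg _ (map_add X.toAlgHom _ _)).trans (map_add _ _ _)
  | @homogeneous m a =>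
    rw [X.toAlgHom_of_mem a.2, DirectSum.decompose_coe]
    by_cases h : m = n
    · subst h
      rw [DirectSum.component.lof_self, DirectSum.of_eq_same]
    · rw [DirectSum.of_eq_of_ne _ _ _ (Ne.symm h), map_zero]
      exact DirectSum.of_eq_of_ne (β := fun n => ShiftedHom X.obj X.obj n) _ _ _ (Ne.symm h)

lemma toAlgHom_bijective (X : GradedObj 𝒜 T) (h : ∀ n, Function.Bijective (X.act n)) :
    Function.Bijective X.toAlgHom := by
  refine ⟨(injective_iff_map_eq_zero _).2 fun a ha => ?_, fun f => ?_⟩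
  · refine (DirectSum.decompose 𝒜).injective (DFinsupp.ext fun n => (h n).1 ?_)
    rw [← X.component_toAlgHom a n, ha, DirectSum.decompose_zero, DirectSum.zero_apply,
      map_zero (X.act n)]
    exact map_zero _
  · induction f using DirectSum.induction_on with
    | zero => exact ⟨0, map_zero _⟩
    | add f g hf hg =>
      obtain ⟨a, ha⟩ := hf
      obtain ⟨b, hb⟩ := hg
      exact ⟨a + b, by rw [map_add, ha, hb]; rfl⟩
    | of n f =>
      obtain ⟨a, rfl⟩ := (h n).2 f
      exact ⟨a, X.toAlgHom_of_mem a.2⟩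

end GradedObj

end GradedTransport

/-! ### Morphisms to a K-injective complex in the derived category. -/

section KInjective

open CochainComplex CochainComplex.HomComplex DerivedCategory

variable {C : Type u} [Category.{v} C] [Abelian C] [HasDerivedCategory.{s} C]
  (K L : CochainComplex C ℤ) (n : ℤ)

/-- For a K-injective target, morphisms in the homotopy category and in the derived category agree,
and the former are cohomology classes of the Hom complex. -/
lemma bijective_shiftedHom_of_isKInjective [L.IsKInjective] :
    Function.Bijective fun x : CohomologyClass K L n =>
      (quotientCompQhIso C).inv.app K ≫ Qh.map (CohomologyClass.toHom x) ≫
        (quotientCompQhIso C).hom.app (L⟦n⟧) ≫ (Q.commShiftIso n).hom.app L :=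
  (Iso.homCongr ((quotientCompQhIso C).app K)
      ((quotientCompQhIso C).app (L⟦n⟧) ≪≫ (Q.commShiftIso n).app L)).bijective.comp
    ((CochainComplex.IsKInjective.Qh_map_bijective _ _).comp
      (CohomologyClass.toHom_bijective K L n))

variable {K L n}

lemma shiftedHom_map_eq (x : Cocycle K L n) :
    ShiftedHom.map (Cocycle.equivHomShift.symm x) Q =
      (quotientCompQhIso C).inv.app K ≫ Qh.map (CohomologyClass.toHom (.mk x)) ≫
        (quotientCompQhIso C).hom.app (L⟦n⟧) ≫ (Q.commShiftIso n).hom.app L := by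
  simp [CohomologyClass.toHom_mk, ShiftedHom.map]

lemma exists_cocycle_of_isKInjective [L.IsKInjective] (f : ShiftedHom (Q.obj K) (Q.obj L) n) :
    ∃ x : Cocycle K L n, ShiftedHom.map (Cocycle.equivHomShift.symm x) Q = f := by
  obtain ⟨x, hx⟩ := (bijective_shiftedHom_of_isKInjective K L n).2 f
  obtain ⟨x, rfl⟩ := x.mk_surjective
  exact ⟨x, (shiftedHom_map_eq x).trans hx⟩

lemma mem_coboundaries_of_isKInjective [L.IsKInjective] (x : Cocycle K L n)
    (hx : ShiftedHom.map
        (Cocycle.equivHomShift.symm x) Q = 0) : x ∈ HomComplex.coboundaries K L n := by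
  rw [← CohomologyClass.mk_eq_zero_iff]
  refine (bijective_shiftedHom_of_isKInjective K L n).1 ?_
  refine (shiftedHom_map_eq x).symm.trans (hx.trans ?_)
  simp

end KInjective

/-! ### The cohomology of the endomorphism DG-algebra as the graded Ext algebra. -/

section Tautological

open CochainComplex CochainComplex.HomComplex DerivedCategory

variable (k : Type t) [CommRing k] {C : Type u} [Category.{v} C] [Abelian C] [Linear k C]
  (I : CochainComplex C ℤ)

/-- The cochain which corresponds to a homogeneous element of the endomorphism algebra. -/
def endGrEquiv (n : ℤ) : endGr k I n ≃ₗ[k] Cochain I I n :=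
  (LinearEquiv.ofInjective (tot k n) (tot_injective k n)).symm

@[simp] lemma tot_endGrEquiv {n : ℤ} (x : endGr k I n) : tot k n (endGrEquiv k I n x) = x :=
  congrArg Subtype.val ((LinearEquiv.ofInjective (tot k n) (tot_injective k n)).apply_symm_apply x)

/-- A complex as a DG-module over its endomorphisms. -/
def tautological : DGModule (endDG k I) C where
  complex := I
  act n := (endGrEquiv k I n).toLinearMap
  act_one := tot_injective k 0 (tot_endGrEquiv k I _)
  act_mul h a b := tot_injective k _ (by
    refine (tot_endGrEquiv k I _).trans ?_
    refine Eq.trans ?_ (totComp_tot _ _ _)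
    exact (congrArg₂ (totComp k · ·) (tot_endGrEquiv k I b) (tot_endGrEquiv k I a)).symm)
  act_d h b := tot_injective k _ (by
    refine (tot_endGrEquiv k I _).trans ?_
    refine Eq.trans ?_ (totD_tot h _)
    exact (congrArg (totD k) (tot_endGrEquiv k I b)).symm)

lemma tautological_cocycleAct {n : ℤ} (x : Cocycle I I n) (z : (endDG k I).cocyclesGr n)
    (hz : (z.1.1 : Tot I I) = tot k n x.1) :
    (tautological k I).cocycleAct n z = Cocycle.equivHomShift.symm x := by
  rw [DGModule.cocycleAct]
  congr 1
  ext1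
  exact tot_injective k n ((tot_endGrEquiv k I _).trans hz)

/-- Regarding `I` as a DG-module over its own endomorphisms turns the comparison of `H^*(E)` with
`Ext^*` into a case of the action on cohomology, so its multiplicativity needs no separate proof. -/
lemma tautological_bijective [HasDerivedCategory.{s} C] [I.IsKInjective] (n : ℤ) :
    Function.Bijective ((tautological k I).cohomologyAct n) := by
  refine ⟨(injective_iff_map_eq_zero _).2 fun a ha => ?_, fun f => ?_⟩
  · obtain ⟨z, rfl⟩ := (endDG k I).projGr_surjective n a
    obtain ⟨x, hx⟩ := z.2
    have hxδ : δ n (n + 1) x = 0 := tot_injective k (n + 1) (by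
      rw [← totD_tot rfl, hx, map_zero]
      exact z.1.2)
    rw [DGModule.cohomologyAct_projGr, DGModule.derivedAct_apply,
      tautological_cocycleAct k I (Cocycle.mk x (n + 1) rfl hxδ) z hx.symm] at ha
    obtain ⟨m, hm, y, hy⟩ := mem_coboundaries_of_isKInjective (K := I) (L := I) _ ha
    refine Subtype.ext (((endDG k I).proj_eq_zero_iff z.1).2 ⟨tot k m y, ?_⟩)
    refine (totD_tot hm y).trans ?_
    rw [hy]
    exact hx
  · obtain ⟨x, rfl⟩ := exists_cocycle_of_isKInjective (L := I) f
    have hx : totD k (tot k n x.1) = 0 := by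
      rw [totD_tot rfl, x.δ_eq_zero, map_zero]
    let z : (endDG k I).cocyclesGr n := ⟨⟨tot k n x.1, hx⟩, ⟨x.1, rfl⟩⟩
    refine ⟨(endDG k I).projGr n z, ?_⟩
    rw [DGModule.cohomologyAct_projGr, DGModule.derivedAct_apply,
      tautological_cocycleAct k I x z rfl]
    rfl

end Tautological

/-! ### From the vanishing of Hochschild cohomology to unobstructed morphisms. -/

section Obstructions

variable {k : Type t} [CommRing k] {B : DGAlgebra.{w} k} {E : DGAlgebra.{v} k}
  {T : Type*} [Category T] [Preadditive T] [Linear k T] [HasShift T ℤ]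
  [∀ n : ℤ, (shiftFunctor T n).Additive] [∀ n : ℤ, (shiftFunctor T n).Linear k]
  {M : GradedObj B.cohomologyGr T}

lemma map_hochHom {R : Type*} [Ring R] [Algebra k R] (Ψ : R →ₐ[k] M.ExtStar)
    {φ : B.Cohomology →ₐ[k] R} (hφ : ∀ a, Ψ (φ a) = M.toAlgHom a) (j : ℤ) (n : ℕ)
    (f : MultilinearMap k (fun _ : Fin n => B.Cohomology) R) (r : Fin (n + 1) → B.Cohomology) :
    Ψ (hochHom B.cohomologyGr φ j n f r) =
      hochschildD B.cohomologyGr M.ExtStar j n (Ψ.toLinearMap.compMultilinearMap f) r := by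
  rw [hochschildD_apply, hochHom, map_add, map_add, map_mul, hφ, map_sum, map_zsmul, map_mul, hφ]
  simp only [map_zsmul]
  rfl

/-- The isomorphism `Ψ` identifies the coefficients in `H^*(E)`, with bimodule structure through
`φ`, with the bimodule `Ext^*(M, M)`. The arity here is `n + 1`, so `2 ≤ n` corresponds to the range
from three on. -/
lemma unobstructed_of_subsingleton (Ψ : E.Cohomology ≃ₐ[k] M.ExtStar)
    (hΨ : ∀ n a, Ψ a ∈ M.extGr n ↔ a ∈ E.cohomologyGr n)
    {φ : B.Cohomology →ₐ[k] E.Cohomology} (hφ : ∀ a, Ψ (φ a) = M.toAlgHom a)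
    (hM : ∀ n : ℕ, 3 ≤ n → Subsingleton (HH B.cohomologyGr M.extGr n (-(n : ℤ) + 2))) :
    Unobstructed φ := by
  intro n hn f hf hf'
  have := hM (n + 1) (by omega)
  rw [neg_add_eq_sub] at this
  have hF : Ψ.toAlgHom.toLinearMap.compMultilinearMap f ∈
      cocycles B.cohomologyGr M.extGr (n + 1) (2 - ((n + 1 : ℕ) : ℤ)) := by
    refine ⟨fun e r hr => (hΨ _ _).2 (hf e r hr), ?_⟩
    refine LinearMap.mem_ker.2 ?_
    ext r
    rw [← map_hochHom Ψ.toAlgHom hφ, hf', map_zero]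
    rfl
  obtain ⟨G, hG, hGF⟩ := (Submodule.Quotient.mk_eq_zero _).1 (Subsingleton.elim
    (Submodule.Quotient.mk ⟨_, hF⟩ : HH B.cohomologyGr M.extGr (n + 1) (2 - ((n + 1 : ℕ) : ℤ))) 0)
  refine ⟨Ψ.symm.toLinearMap.compMultilinearMap G,
    fun e r hr => (hΨ _ _).1 ?_, fun r => Ψ.injective ?_⟩
  · change Ψ (Ψ.symm (G r)) ∈ _
    rw [Ψ.apply_symm_apply]
    exact hG e r hr
  · refine (map_hochHom Ψ.toAlgHom hφ _ _ _ r).trans ?_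
    have h : Ψ.toAlgHom.toLinearMap.compMultilinearMap
        (Ψ.symm.toLinearMap.compMultilinearMap G) = G := by
      ext r
      exact Ψ.apply_symm_apply _
    rw [h, hGF]
    rfl

lemma GradedObj.toAlgHom_mem_extGr (X : GradedObj E.cohomologyGr T)
    (hX : ∀ n, Function.Bijective (X.act n)) (n : ℤ) (a : E.Cohomology) :
    X.toAlgHom a ∈ X.extGr n ↔ a ∈ E.cohomologyGr n := by
  refine ⟨fun ⟨f, hf⟩ => ?_, fun ha => ⟨X.act n ⟨a, ha⟩, (X.toAlgHom_of_mem ha).symm⟩⟩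
  obtain ⟨b, rfl⟩ := (hX n).2 f
  rw [← (X.toAlgHom_bijective hX).1 ((X.toAlgHom_of_mem b.2).trans hf)]
  exact b.2

/-- If the endomorphisms of `M` in `T` are the cohomology of `E`, then the action on `M` is given by
an unobstructed morphism. -/
lemma exists_unobstructed (X : GradedObj E.cohomologyGr T) (hX : ∀ n, Function.Bijective (X.act n))
    (e : X.obj ≅ M.obj)
    (hM : ∀ n : ℕ, 3 ≤ n → Subsingleton (HH B.cohomologyGr M.extGr n (-(n : ℤ) + 2))) :
    ∃ φ : B.Cohomology →ₐ[k] E.Cohomology,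
      (∀ ⦃n : ℤ⦄, ∀ a ∈ B.cohomologyGr n, φ a ∈ E.cohomologyGr n) ∧ Unobstructed φ ∧
      ∀ (n : ℤ) (a : B.cohomologyGr n) (ha : φ a ∈ E.cohomologyGr n),
        X.act n ⟨φ a, ha⟩ ≫ e.hom⟦n⟧' = e.hom ≫ M.act n a := by
  have hX' : ∀ n, Function.Bijective ((X.transport e).act n) := fun n =>
    ⟨fun a b h => (hX n).1 ((cancel_epi e.inv).1 ((cancel_mono (e.hom⟦n⟧')).1 h)),
      fun (f : M.obj ⟶ M.obj⟦n⟧) => by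
      obtain ⟨a, ha⟩ := (hX n).2 (e.hom ≫ f ≫ e.inv⟦n⟧')
      exact ⟨a, by
        rw [GradedObj.transport_act, ha, e.inv_hom_id_assoc]
        exact (Category.assoc _ _ _).trans
          ((congrArg (f ≫ ·) (e.map_inv_hom_id _)).trans (Category.comp_id f))⟩⟩
  let Ψ : E.Cohomology ≃ₐ[k] M.ExtStar :=
    AlgEquiv.ofBijective (X.transport e).toAlgHom ((X.transport e).toAlgHom_bijective hX')
  have hΨ : ∀ n a, Ψ a ∈ M.extGr n ↔ a ∈ E.cohomologyGr n :=
    (X.transport e).toAlgHom_mem_extGr hX'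
  -- The action on `M`, read in the cohomology of `E`.
  let φ : B.Cohomology →ₐ[k] E.Cohomology := Ψ.symm.toAlgHom.comp M.toAlgHom
  have hφ : ∀ a, Ψ (φ a) = M.toAlgHom a := fun a => Ψ.apply_symm_apply _
  refine ⟨φ, fun n a ha => ?_, unobstructed_of_subsingleton Ψ hΨ hφ hM, fun n a ha => ?_⟩
  · rw [← hΨ, hφ]
    exact ⟨M.act n ⟨a, ha⟩, (M.toAlgHom_of_mem ha).symm⟩
  · have h : (X.transport e).act n ⟨φ a, ha⟩ = M.act n a :=
      DirectSum.of_injective (β := fun n => ShiftedHom M.obj M.obj n) n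
          (((X.transport e).toAlgHom_of_mem ha).symm.trans
        ((hφ a).trans (M.toAlgHom_of_mem a.2)))
    rw [← h, GradedObj.transport_act]
    simp

end Obstructions

lemma DGAlgebra.exists_d_eq_sub_one {k : Type t} [CommRing k] {A : Type*} [Ring A] [Algebra k A]
    (E : DGAlgebra.{v} k) (φ : A →ₐ[k] E.Cohomology) {x : E.cocycles} (hx : E.proj x = φ 1)
    (h₀ : x.1 ∈ E.gr 0) : ∃ b ∈ E.gr (-1), E.d b = x.1 - 1 := by
  have h : x - 1 ∈ E.cocyclesGr (-1 + 1) := sub_mem h₀ (SetLike.GradedOne.one_mem (A := E.gr))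
  exact (E.proj_eq_zero_iff_of_mem h).1 (by rw [map_sub, hx, map_one, map_one, sub_self])

lemma comp_shift_eq_of_retract {T : Type*} [Category T] [HasShift T ℤ] {X Y Z : T} {n : ℤ}
    {p : X ⟶ Y} {s : Y ⟶ X} {e : Y ⟶ Z} {a : X ⟶ X⟦n⟧} {b : Z ⟶ Z⟦n⟧} (hp : p ≫ s = 𝟙 X)
    (h : (s ≫ a ≫ p⟦n⟧') ≫ e⟦n⟧' = e ≫ b) : a ≫ (p ≫ e)⟦n⟧' = (p ≫ e) ≫ b := by
  rw [Category.assoc, ← h, Functor.map_comp]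
  simp only [Category.assoc]
  rw [reassoc_of% hp]

/-! ### Construction of the DG-module and comparison with `M`. -/

section Lifting

open CochainComplex CochainComplex.HomComplex DerivedCategory TensorAlgebra

variable {k : Type t} [Field k] {B : DGAlgebra.{w} k}
  {C : Type u} [Category.{v} C] [Abelian C] [Linear k C] {I : CochainComplex C ℤ}

/-- The DG-module which is defined by a twisting cochain. -/
theorem exists_dgModule [Limits.HasCoproducts.{w} C] {τ : Bar B →ₗ[k] Tot I I} (h₁ : τ 1 = 0)
    (hτ : HasDegree (E := endDG k I) τ 1) (h : curv (E := endDG k I) τ = 0) :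
    ∃ (N : DGModule B C) (ε : N.complex ⟶ I) (s : I ⟶ N.complex),
      Nonempty (Homotopy (ε ≫ s) (𝟙 N.complex)) ∧ ∀ (n : ℤ) (x : B.gr n),
        tot k n (((Cochain.ofHom s).comp (N.act n x) (zero_add n)).comp (Cochain.ofHom ε)
          (add_zero n)) = τ (ι k (x : B.carrier)) := by
  obtain ⟨N, ϑ, hϑ, hN⟩ := exists_isFree_differential h₁ hτ h
  obtain ⟨ε, hε⟩ := hϑ.exists_counit hN h₁ hτ h
  obtain ⟨s, hs⟩ := hϑ.exists_unit hN
  exact ⟨{ complex := N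
           act := hϑ.act
           act_one := hϑ.act_one
           act_mul := hϑ.act_mul
           act_d := hϑ.act_d hN }, ε, s, hϑ.nonempty_homotopy hN h₁ hε hs,
    fun n x => hϑ.unit_act_counit hε hs x⟩

variable {N : DGModule B C} {ε : N.complex ⟶ I} {s : I ⟶ N.complex}

lemma cocycleAct_eq {n : ℤ} (z : B.cocyclesGr n) (z' : (endDG k I).cocyclesGr n)
    (hz : tot k n (((Cochain.ofHom s).comp (N.act n (B.toGr n z)) (zero_add n)).comp
      (Cochain.ofHom ε) (add_zero n)) = z'.1.1) :
    s ≫ N.cocycleAct n z ≫ ε⟦n⟧' = (tautological k I).cocycleAct n z' := by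
  have h : ((Cochain.ofHom s).comp (N.act n (B.toGr n z)) (zero_add n)).comp (Cochain.ofHom ε)
      (add_zero n) = (tautological k I).act n ((endDG k I).toGr n z') :=
    tot_injective k n (hz.trans (tot_endGrEquiv k I ((endDG k I).toGr n z')).symm)
  ext p
  have hp := Cochain.congr_v h p (p + n) rfl
  rw [Cochain.comp_zero_cochain_v, Cochain.zero_cochain_comp_v, Cochain.ofHom_v, Cochain.ofHom_v,
    Category.assoc] at hp
  rw [HomologicalComplex.comp_f, HomologicalComplex.comp_f, DGModule.cocycleAct_f,
    DGModule.cocycleAct_f]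
  exact hp

variable [HasDerivedCategory.{s} C]

lemma derivedAct_eq {n : ℤ} (z : B.cocyclesGr n) (z' : (endDG k I).cocyclesGr n)
    (hz : tot k n (((Cochain.ofHom s).comp (N.act n (B.toGr n z)) (zero_add n)).comp
      (Cochain.ofHom ε) (add_zero n)) = z'.1.1) :
    Q.map s ≫ N.derivedAct n z ≫ (Q.map ε)⟦n⟧' = (tautological k I).derivedAct n z' := by
  have h := congrArg (fun f => ShiftedHom.map f Q) (cocycleAct_eq z z' hz)
  refine Eq.trans ?_ h
  rw [DGModule.derivedAct_apply]
  simp only [ShiftedHom.map, Functor.map_comp, Category.assoc]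
  rw [← Functor.commShiftIso_hom_naturality]

lemma Q_map_eq_id {f : I ⟶ I} {b : Tot I I} (hb : b ∈ endGr k I (-1))
    (h : totD k b = tot k 0 (Cochain.ofHom f) - totOne k I) : Q.map f = 𝟙 _ := by
  obtain ⟨y, rfl⟩ := hb
  have h : δ (-1) 0 y = Cochain.ofHom f - Cochain.ofHom (𝟙 I) := tot_injective k 0 (by
    rw [← totD_tot (by omega), map_sub, h]
    rfl)
  rw [Q_map_eq_of_homotopy _ ((Cochain.equivHomotopy f (𝟙 I)).symm ⟨y, by rw [h]; abel⟩),
    CategoryTheory.Functor.map_id]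

/-- The functor from the derived category of DG-modules is essentially surjective onto the objects
whose Hochschild obstruction groups vanish. -/
theorem exists_forgetF_iso {k : Type w} [Field k]
    {C : Type u} [Category.{v} C] [Abelian C] [Linear k C] [IsGrothendieckAbelian.{w} C]
    [HasDerivedCategory.{s} C] (B : DGAlgebra.{w} k)
    (M : GradedObj B.cohomologyGr (DerivedCategory C))
    (hM : ∀ n : ℕ, 3 ≤ n → Subsingleton (HH B.cohomologyGr M.extGr n (-(n : ℤ) + 2))) :
    ∃ N : DerivedDG B C, Nonempty ((forgetF B C).obj N ≅ M) := by
  obtain ⟨I, i, hi, hI⟩ := exists_kInjective_resolution (DerivedCategory.Q.objPreimage M.obj)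
  let e : DerivedCategory.Q.obj I ≅ M.obj :=
    (asIso (DerivedCategory.Q.map i)).symm ≪≫ DerivedCategory.Q.objObjPreimageIso M.obj
  obtain ⟨φ, hφ, hu, hact⟩ := exists_unobstructed (tautological k I).toDerivedObj
    (tautological_bijective k I) e hM
  obtain ⟨τ, h₁, hτ, hc, hp⟩ := exists_twistingCochain hφ hu
  have : Limits.HasCoproducts.{w} C := fun _ => inferInstance
  obtain ⟨N, ε, s, ⟨hεs⟩, hN⟩ := exists_dgModule h₁ hτ hc
  have hd : ∀ z : B.cocycles, (endDG k I).d (τ (ι k z.1)) = 0 := fun z =>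
    d_letter h₁ (fun w _ => by rw [hc, LinearMap.zero_apply]) z.2
  have hdeg : ∀ {n : ℤ} (z : B.cocyclesGr n), τ (ι k z.1.1) ∈ (endDG k I).gr n := fun z =>
    hτ (sub_add_cancel _ 1) _ (by
      have := cons_mem_barDeg (add_zero _) z.2 (one_mem_barDeg (B := B))
      rwa [mul_one] at this)
  have hεs' : DerivedCategory.Q.map ε ≫ DerivedCategory.Q.map s = 𝟙 _ := by
    rw [← Functor.map_comp, DerivedCategory.Q_map_eq_of_homotopy _ hεs,
      CategoryTheory.Functor.map_id]
  -- The cochain `τ` need not be unital, so `s ≫ ε` is only homotopic to the identity: it is the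
  -- value of `τ` on the letter `1`, whose class is `φ 1 = 1`.
  have hsε : DerivedCategory.Q.map s ≫ DerivedCategory.Q.map ε = 𝟙 _ := by
    have h₀ := hdeg (⟨1, SetLike.GradedOne.one_mem (A := B.gr)⟩ : B.cocyclesGr 0)
    obtain ⟨b, hb, hb'⟩ := (endDG k I).exists_d_eq_sub_one φ (x := ⟨τ (ι k 1), hd 1⟩)
      ((hp 1 (hd 1)).trans (congrArg φ (map_one B.proj))) h₀
    have h := hN 0 ⟨1, SetLike.GradedOne.one_mem⟩
    rw [N.act_one, Cochain.comp_id, ← Cochain.ofHom_comp] at h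
    rw [← Functor.map_comp]
    exact Q_map_eq_id hb (hb'.trans (congrArg (· - totOne k I) h.symm))
  have : IsIso (DerivedCategory.Q.map ε) := ⟨_, hεs', hsε⟩
  let f : N.toDerivedObj ⟶ M :=
    { hom := DerivedCategory.Q.map ε ≫ e.hom
      comm := fun n a => by
        obtain ⟨z, rfl⟩ := B.projGr_surjective n a
        let z' : (endDG k I).cocyclesGr n := ⟨⟨τ (ι k z.1.1), hd z.1⟩, hdeg z⟩
        -- The element `τ z` of `E` is a representative of `φ` of the class of `z`, so its action on
        -- `I` is the one that `e` carries to the action on `M`.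
        have hz' : (⟨φ (B.projGr n z), hφ _ (B.projGr n z).2⟩ : (endDG k I).cohomologyGr n) =
            (endDG k I).projGr n z' := Subtype.ext (hp z.1 (hd z.1)).symm
        have h := hact n (B.projGr n z) (hφ _ (B.projGr n z).2)
        rw [hz'] at h
        have h' : (tautological k I).cohomologyAct n ((endDG k I).projGr n z') =
            DerivedCategory.Q.map s ≫ N.derivedAct n z ≫ (DerivedCategory.Q.map ε)⟦n⟧' :=
          ((tautological k I).cohomologyAct_projGr n z').trans
            (derivedAct_eq z z' (hN n (B.toGr n z))).symm
        change N.cohomologyAct n (B.projGr n z) ≫ _ = _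
        rw [N.cohomologyAct_projGr]
        exact comp_shift_eq_of_retract hεs' ((congrArg (· ≫ e.hom⟦n⟧') h').symm.trans h) }
  have : IsIso f.hom := inferInstanceAs (IsIso (DerivedCategory.Q.map ε ≫ e.hom))
  have := GradedObj.isIso_of_isIso_hom f
  let g := asIso f
  -- On the image of a DG-module in the localization, `forgetF` agrees by definition with
  -- `toDerived`.
  exact ⟨(DGModule.qis B C).Q.obj N, ⟨g⟩⟩

end Lifting

end

end DGLift

theorem proposition9p1p1 {k : Type w} [Field k]
    {C : Type u} [Category.{v} C] [Abelian C] [Linear k C] [IsGrothendieckAbelian.{w} C]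
    [HasDerivedCategory.{s} C]
    (B : DGLift.DGAlgebra.{w} k)
    (M : DGLift.GradedObj B.cohomologyGr (DerivedCategory C))
    (hM : ∀ n : ℕ, 3 ≤ n →
      Subsingleton (DGLift.HH B.cohomologyGr M.extGr n (-(n : ℤ) + 2))) :
    ∃ N : DGLift.DerivedDG B C, Nonempty ((DGLift.forgetF B C).obj N ≅ M) :=
  DGLift.exists_forgetF_iso B M hM
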